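/- **Setting.** Let $B$ be a unital $C^*$-algebra. Let $M_{11},M_{22},M_{12},M_{21}$ be smooth manifolds (Hausdorff, second countable, possibly with boundary), and let $V_1,V_2,W_1,W_2,U$ be manifolds fitting in a commutative diagram $$\begin{array}{ccccc} M_{11} & \leftarrow & V_1 & \to & M_{12}\\ \uparrow & & \uparrow & & \uparrow\\ W_1 & \leftarrow & U & \to & W_2\\ \downarrow & & \downarrow & & \downarrow\\ M_{21} & \leftarrow & V_2 & \to & M_{22}\end{array}$$ in which all arrows are diffeomorphisms onto open subsets and, identifying domains with their images, $M_{ij}=V_i\cup W_j$ and $U=V_i\cap W_j$ for $i,j=1,2$. Assume that $U$ is non-empty, has no boundary, and has compact closure in $M_{11}$ and in $M_{22}$. Each manifold carries a locally finite Borel measure of full support (for instance a smooth positive density) and two smooth vector $B$-bundles $E,F$ (locally trivial bundles of finitely generated projective $B$-modules) with smooth $B$-valued fibre inner products making the fibres Hilbert $B$-modules; measures and bundles with their inner products satisfy the same diagram as the manifolds. $L^2(M_{ij};E)$ denotes the Hilbert $B$-module completion of $C_c^\infty(M_{ij};E)$ in the inner product $\int\langle s,t\rangle\,d\mu$. Let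 $D_{ij}\colon C_c^\infty(M_{ij};E)\to C_c^\infty(M_{ij};F)$ be $B$-linear differential operators. Let $b_{V_i}$ and $b_{W_j}$ be boundary operators, that is, $B$-linear maps from $C^\infty(V_i;E)$, respectively $C^\infty(W_j;E)$, to some $B$-module (such as the sections of a vector $B$-bundle over $\partial V_i$, respectively $\partial W_j$) which vanish on sections that vanish near $\partial V_i$, respectively $\partial W_j$; they may be nonlocal along the boundary. Put $$\mathcal E_{ij}=\{f\in C_c^\infty(M_{ij};E): b_{V_i}(f|_{V_i})=0,\ b_{W_j}(f|_{W_j})=0\}.$$ Assume that the closure of the graph of $D_{ij}|_{\mathcal E_{ij}}$ is the graph of an operator from $L^2(M_{ij};E)$ to $L^2(M_{ij};F)$, again denoted $D_{ij}$, and that it is regular: closed and densely defined, with densely defined adjoint, and such that $1+D_{ij}^*D_{ij}$ has dense range. Its domain $\operatorname{Dom}D_{ij}$ is a Hilbert $B$-module with the graph inner product. A regular operator is called $B$-Fredholm if, as an adjointable operator from its domain, it is invertible modulo $B$-compact operators (norm limits of $B$-finite rank operators). Its index is $\operatorname{ind}_B D=[\ker R]-[\ker R^*]\in K_0(B)$,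 where $R$ is any adjointable operator $\operatorname{Dom}D\oplus B^n\to L^2(M;F)\oplus B^n$ having a pseudo-inverse ($RGR=R$, $GRG=G$ with $G$ adjointable) whose upper left corner is $D$; such $R$ exist, the kernels are finitely generated projective, and the class does not depend on $R$. **Theorem.** Assume that for $i,j=1,2$ 1. $D_{i1}=D_{i2}$ on $V_i$; 2. $D_{1j}=D_{2j}$ on $W_j$; 3. for every $a\in C_c^\infty(U)$, the commutator $[D_{ij},a]$ (defined on $\mathcal E_{ij}$) extends to a $B$-compact operator from $\operatorname{Dom}D_{ij}$ to $L^2(M_{ij};F)$. Then $D_{11}$ and $D_{22}$ are both $B$-Fredholm if and only if $D_{12}$ and $D_{21}$ are both $B$-Fredholm, and in that case $$\operatorname{ind}_B D_{11}+\operatorname{ind}_B D_{22}=\operatorname{ind}_B D_{12}+\operatorname{ind}_B D_{21}\quad\text{in }K_0(B).$$ (Hilbert modules are written as left modules; right Hilbert modules over $A$ are the case $B=A^{\mathrm{op}}$.) -/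

import Mathlib

open scoped Manifold ContDiff InnerProductSpace
open MeasureTheory Set Topology

set_option linter.unusedSectionVars false
set_option linter.checkUnivs false

universe u v w

noncomputable section

namespace RelIndex

/-! ### Hilbert modules over a C*-algebra

Hilbert `B`-modules are Mathlib's `CStarModule B X` (together with completeness): the action of `B`
is written as a left action and the inner product is `B`-linear in its second variable,
`⟪x, b • y⟫ = b * ⟪x, y⟫`.  Right Hilbert modules over a C*-algebra `A` are the case `B = Aᵐᵒᵖ`. -/

section HilbertModules

variable {B : Type u} [CStarAlgebra B] [PartialOrder B]
variable {X : Type v} [NormedAddCommGroup X] [NormedSpace ℂ X] [Module B X] [CStarModule B X]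
variable {Y : Type w} [NormedAddCommGroup Y] [NormedSpace ℂ Y] [Module B Y] [CStarModule B Y]

theorem ext_inner {x y : X} (h : ∀ z : X, inner B z x = inner B z y) : x = y := by
  have h0 : inner B (x - y) (x - y) = 0 := by
    rw [CStarModule.inner_sub_right, h, sub_self]
  exact sub_eq_zero.mp (CStarModule.inner_self.mp h0)

instance instIsScalarTower : IsScalarTower ℂ B X where
  smul_assoc c b x := ext_inner (B := B) fun z => by simp

instance instSMulCommClass : SMulCommClass ℂ B X where
  smul_comm c b x := ext_inner (B := B) fun z => by simp

theorem norm_smul_le' [StarOrderedRing B] (b : B) (x : X) : ‖b • x‖ ≤ ‖b‖ * ‖x‖ := by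
  have h : ‖b • x‖ ^ 2 ≤ (‖b‖ * ‖x‖) ^ 2 := by
    rw [mul_pow, CStarModule.norm_sq_eq B (x := b • x), CStarModule.norm_sq_eq B (x := x)]
    simp only [CStarModule.inner_op_smul_right, CStarModule.inner_op_smul_left]
    calc ‖b * (inner B x x * star b)‖ ≤ ‖b‖ * (‖inner B x x‖ * ‖star b‖) :=
          (norm_mul_le _ _).trans (mul_le_mul_of_nonneg_left (norm_mul_le _ _) (norm_nonneg _))
      _ = ‖b‖ ^ 2 * ‖inner B x x‖ := by rw [norm_star]; ring
  exact le_of_sq_le_sq h (by positivity)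

instance instUniformContinuousConstSMul [StarOrderedRing B] : UniformContinuousConstSMul B X where
  uniformContinuous_const_smul b :=
    (AddMonoidHomClass.lipschitz_of_bound (DistribSMul.toAddMonoidHom X b) ‖b‖
      (norm_smul_le' b)).uniformContinuous

end HilbertModules

/-! ### Completion of a pre-Hilbert module -/

section Completion

open UniformSpace

variable {B : Type u} [CStarAlgebra B] [PartialOrder B] [StarOrderedRing B]
variable {X : Type v} [NormedAddCommGroup X] [NormedSpace ℂ X] [Module B X] [CStarModule B X]

theorem completion_inner_coe (x y : X) :
    inner B (x : Completion X) (y : Completion X) = inner B x y :=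
  (Completion.isDenseInducing_coe.prodMap Completion.isDenseInducing_coe).extend_eq
    (CStarModule.continuous_inner (A := B) (E := X)) (x, y)

theorem completion_continuous_inner :
    Continuous fun p : Completion X × Completion X => inner B p.1 p.2 := by
  let inner' : X →+ X →+ B :=
    { toFun := fun x => ((CStarModule.innerₛₗ (A := B) (E := X)) x).toAddMonoidHom
      map_zero' := by ext x; simp
      map_add' := fun x y => by ext z; simp }
  have h : Continuous fun p : X × X => inner' p.1 p.2 :=
    CStarModule.continuous_inner (A := B) (E := X)
  exact (Completion.isDenseInducing_toCompl X).extend_Z_bilin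
    (Completion.isDenseInducing_toCompl X) h

/-- The completion of a pre-Hilbert `B`-module is a Hilbert `B`-module; its inner product is the
continuous extension of the given one. -/
instance instCStarModuleCompletion : CStarModule B (Completion X) where
  toInner := Completion.toInner
  inner_add_right {x y z} := by
    refine Completion.induction_on₃ x y z (isClosed_eq ?_ ?_) fun a b c => ?_
    · exact completion_continuous_inner.comp (by fun_prop : Continuous
        fun p : Completion X × Completion X × Completion X => (p.1, p.2.1 + p.2.2))
    · exact (completion_continuous_inner.comp (by fun_prop : Continuous
        fun p : Completion X × Completion X × Completion X => (p.1, p.2.1))).add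
        (completion_continuous_inner.comp (by fun_prop : Continuous
        fun p : Completion X × Completion X × Completion X => (p.1, p.2.2)))
    · rw [← Completion.coe_add]
      simp only [completion_inner_coe, CStarModule.inner_add_right]
  inner_self_nonneg {x} := by
    refine Completion.induction_on x (isClosed_le continuous_const ?_) fun a => ?_
    · exact completion_continuous_inner.comp (by fun_prop : Continuous
        fun p : Completion X => (p, p))
    · rw [completion_inner_coe]; exact CStarModule.inner_self_nonneg
  inner_self {x} := by
    have h : ‖x‖ ^ 2 = ‖inner B x x‖ := by
      refine Completion.induction_on x (isClosed_eq (by fun_prop) ?_) fun a => ?_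
      · exact (completion_continuous_inner.comp (by fun_prop : Continuous
          fun p : Completion X => (p, p))).norm
      · rw [completion_inner_coe, Completion.norm_coe, CStarModule.norm_sq_eq B]
    rw [← norm_eq_zero, ← h, sq_eq_zero_iff, norm_eq_zero]
  inner_op_smul_right {b x y} := by
    refine Completion.induction_on₂ x y (isClosed_eq ?_ ?_) fun a c => ?_
    · exact completion_continuous_inner.comp
        (continuous_fst.prodMk (continuous_snd.const_smul b))
    · exact continuous_const.mul completion_continuous_inner
    · rw [← Completion.coe_smul]
      simp only [completion_inner_coe, CStarModule.inner_op_smul_right]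
  inner_smul_right_complex {b x y} := by
    refine Completion.induction_on₂ x y (isClosed_eq ?_ ?_) fun a c => ?_
    · exact completion_continuous_inner.comp
        (continuous_fst.prodMk (continuous_snd.const_smul b))
    · exact completion_continuous_inner.const_smul b
    · rw [← Completion.coe_smul]
      simp only [completion_inner_coe, CStarModule.inner_smul_right_complex]
  star_inner x y := by
    refine Completion.induction_on₂ x y (isClosed_eq ?_ ?_) fun a c => ?_
    · exact completion_continuous_inner.star
    · exact completion_continuous_inner.comp (continuous_snd.prodMk continuous_fst)
    · simp only [completion_inner_coe, CStarModule.star_inner]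
  norm_eq_sqrt_norm_inner_self x := by
    refine Completion.induction_on x (isClosed_eq (by fun_prop) ?_) fun a => ?_
    · exact (completion_continuous_inner.comp (by fun_prop : Continuous
        fun p : Completion X => (p, p))).norm.sqrt
    · rw [completion_inner_coe, Completion.norm_coe,
        CStarModule.norm_eq_sqrt_norm_inner_self (A := B)]

end Completion

/-! ### Adjointable, compact and Fredholm operators -/

section Operators

variable {B : Type u} [CStarAlgebra B] [PartialOrder B]
variable {X : Type v} [NormedAddCommGroup X] [NormedSpace ℂ X] [Module B X] [CStarModule B X]
variable {Y : Type w} [NormedAddCommGroup Y] [NormedSpace ℂ Y] [Module B Y] [CStarModule B Y]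

/-- `S` is the adjoint of `T`. -/
def IsAdjointPair (T : X →ₗ[B] Y) (S : Y →ₗ[B] X) : Prop :=
  ∀ x y, inner B (T x) y = inner B x (S y)

/-- `T` belongs to `𝓛(X, Y)` (boundedness of `T` is then automatic on Hilbert modules). -/
def IsAdjointable (T : X →ₗ[B] Y) : Prop :=
  ∃ S : Y →ₗ[B] X, IsAdjointPair T S

/-- `T` belongs to `𝓚(X, Y)`: it is a limit in operator norm of finite sums of the rank one
operators `z ↦ ⟪x, z⟫ • y`. -/
def IsCompactOp (T : X →ₗ[B] Y) : Prop :=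
  ∀ ε : ℝ, 0 < ε → ∃ (n : ℕ) (x : Fin n → X) (y : Fin n → Y),
    ∀ z, ‖T z - ∑ i, (inner B (x i) z : B) • y i‖ ≤ ε * ‖z‖

/-- `T ∈ 𝓛(X, Y)` is `B`-Fredholm: it is left and right invertible in `𝓛` modulo compacts. -/
def IsFredholm (T : X →ₗ[B] Y) : Prop :=
  IsAdjointable T ∧
  (∃ S : Y →ₗ[B] X, IsAdjointable S ∧ IsCompactOp (LinearMap.id - S ∘ₗ T)) ∧
  (∃ S : Y →ₗ[B] X, IsAdjointable S ∧ IsCompactOp (LinearMap.id - T ∘ₗ S))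

end Operators

/-! ### `K₀` of a unital ring -/

section KTheory

variable (B : Type u) [Ring B]

/-- Finitely generated projective `B`-modules, realized as submodules of some `Bⁿ`
(every finitely generated projective module is isomorphic to one of these). -/
structure FGProj where
  rank : ℕ
  carrier : Submodule B (Fin rank → B)
  finite : Module.Finite B carrier
  projective : Module.Projective B carrier

/-- The relations `[P] = [Q] + [R]` whenever `P ≅ Q ⊕ R`. -/
def K0Relations : AddSubgroup (FreeAbelianGroup (FGProj B)) :=
  AddSubgroup.closure {z | ∃ P Q R : FGProj B,
    Nonempty (P.carrier ≃ₗ[B] Q.carrier × R.carrier) ∧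
    z = FreeAbelianGroup.of P - (FreeAbelianGroup.of Q + FreeAbelianGroup.of R)}

/-- `K₀(B)`: the abelian group generated by the finitely generated projective `B`-modules, subject
to `[P] = [Q] + [R]` whenever `P ≅ Q ⊕ R` (in particular isomorphic modules have the same class). -/
abbrev K0 : Type u := FreeAbelianGroup (FGProj B) ⧸ K0Relations B

open Classical in
/-- The class in `K₀(B)` of a finitely generated projective `B`-module (and `0` for a module that
is not finitely generated projective). -/
def K0.cls (P : Type v) [AddCommGroup P] [Module B P] : K0 B :=
  if h : ∃ Q : FGProj B, Nonempty (P ≃ₗ[B] Q.carrier) then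
    QuotientAddGroup.mk (FreeAbelianGroup.of h.choose)
  else 0

end KTheory

/-! ### The index of a Fredholm operator -/

section Index

open scoped WithCStarModule

variable {B : Type u} [CStarAlgebra B] [PartialOrder B] [StarOrderedRing B]
variable {X : Type v} [NormedAddCommGroup X] [NormedSpace ℂ X] [Module B X] [CStarModule B X]
variable {Y : Type w} [NormedAddCommGroup Y] [NormedSpace ℂ Y] [Module B Y] [CStarModule B Y]

variable (B X) in
/-- The Hilbert module `X ⊕ Bⁿ`. -/
abbrev Stab (n : ℕ) : Type (max v u) := C⋆ᵐᵒᵈ(B, X × C⋆ᵐᵒᵈ(B, Fin n → B))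

/-- `R ∈ 𝓛(X ⊕ Bⁿ, Y ⊕ Bⁿ)` with adjoint `R'` is a regular extension of `T`: its upper left corner
is `T`, and it has a pseudo-inverse `G` in `𝓛`. -/
structure IsRegularExtension (T : X →ₗ[B] Y) (n : ℕ)
    (R : Stab B X n →ₗ[B] Stab B Y n) (R' : Stab B Y n →ₗ[B] Stab B X n) : Prop where
  adjoint : IsAdjointPair R R'
  corner : ∀ x : X, (R ((WithCStarModule.equiv B _).symm (x, 0))).1 = T x
  pseudoInverse : ∃ G : Stab B Y n →ₗ[B] Stab B X n, IsAdjointable G ∧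
    R ∘ₗ G ∘ₗ R = R ∧ G ∘ₗ R ∘ₗ G = G

open Classical in
/-- The index in `K₀(B)` of a `B`-Fredholm operator `T`: the kernel of a regular extension `R` of
`T` and the kernel of its adjoint are finitely generated projective, and the index of `T` is
`[ker R] - [ker R*]`, which does not depend on the choice of `R`. -/
def index (T : X →ₗ[B] Y) : K0 B :=
  if h : ∃ (n : ℕ) (p : (Stab B X n →ₗ[B] Stab B Y n) × (Stab B Y n →ₗ[B] Stab B X n)),
      IsRegularExtension T n p.1 p.2 then
    K0.cls B (LinearMap.ker h.choose_spec.choose.1) -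
      K0.cls B (LinearMap.ker h.choose_spec.choose.2)
  else 0

end Index

/-! ### Unbounded operators -/

section Unbounded

variable {B : Type u} [CStarAlgebra B] [PartialOrder B] [StarOrderedRing B]
variable {X : Type v} [NormedAddCommGroup X] [NormedSpace ℂ X] [Module B X] [CStarModule B X]
variable {Y : Type w} [NormedAddCommGroup Y] [NormedSpace ℂ Y] [Module B Y] [CStarModule B Y]

/-- `y` lies in the domain of the adjoint of `T`, and `T* y = z`. -/
def AdjointGraph (T : X →ₗ.[B] Y) (y : Y) (z : X) : Prop :=
  ∀ x : T.domain, inner B (T x) y = inner B (x : X) z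

/-- Regular operators: closed and densely defined, with densely defined adjoint, and such that
`1 + T* T` has dense range. -/
structure IsRegularOp (T : X →ₗ.[B] Y) : Prop where
  closed : IsClosed (T.graph : Set (X × Y))
  dense_domain : Dense (T.domain : Set X)
  dense_adjoint : Dense {y : Y | ∃ z, AdjointGraph T y z}
  dense_range : Dense {w : X | ∃ (x : T.domain) (z : X), AdjointGraph T (T x) z ∧ w = x + z}

/-- The domain of `T`, to be equipped with the graph inner product. -/
def Dom (T : X →ₗ.[B] Y) : Type v := T.domain

namespace Dom

variable (T : X →ₗ.[B] Y)

instance : AddCommGroup (Dom T) := inferInstanceAs (AddCommGroup T.domain)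
instance : Module B (Dom T) := inferInstanceAs (Module B T.domain)
instance : Module ℂ (Dom T) := inferInstanceAs (Module ℂ T.domain)

/-- The inclusion of the domain. -/
def incl : Dom T →ₗ[B] X := T.domain.subtype

/-- `T` as an everywhere defined operator on its domain. -/
def op : Dom T →ₗ[B] Y := T.toFun

theorem incl_injective : Function.Injective (incl T) := Subtype.val_injective

theorem incl_smul (c : ℂ) (x : Dom T) : incl T (c • x) = c • incl T x := rfl

theorem op_smul (c : ℂ) (x : Dom T) : op T (c • x) = c • op T x := by
  have h : c • x = (c • (1 : B)) • x := incl_injective T (by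
    rw [incl_smul, map_smul, smul_assoc, one_smul])
  rw [h, map_smul, smul_assoc, one_smul]

instance : Norm (Dom T) where
  norm x := √‖inner B (incl T x) (incl T x) + inner B (op T x) (op T x)‖

/-- The graph inner product `⟪x, y⟫ + ⟪T x, T y⟫`. -/
instance : CStarModule B (Dom T) where
  inner x y := inner B (incl T x) (incl T y) + inner B (op T x) (op T y)
  inner_add_right {x y z} := by
    simp only [map_add, CStarModule.inner_add_right]; abel
  inner_self_nonneg := add_nonneg CStarModule.inner_self_nonneg CStarModule.inner_self_nonneg
  inner_self {x} := by
    refine ⟨fun h => ?_, fun h => by simp [h]⟩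
    have h1 : inner B (incl T x) (incl T x) = 0 :=
      le_antisymm (h ▸ le_add_of_nonneg_right CStarModule.inner_self_nonneg)
        CStarModule.inner_self_nonneg
    exact incl_injective T (by rw [CStarModule.inner_self.mp h1, map_zero])
  inner_op_smul_right := by simp [mul_add]
  inner_smul_right_complex := by simp [incl_smul, op_smul]
  star_inner x y := by simp
  norm_eq_sqrt_norm_inner_self x := rfl

instance : NormedAddCommGroup (Dom T) := NormedAddCommGroup.ofCore (CStarModule.normedSpaceCore B)
instance : NormedSpace ℂ (Dom T) := NormedSpace.ofCore (CStarModule.normedSpaceCore B)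

end Dom

/-- A regular operator is `B`-Fredholm if it is so as an operator from its domain. -/
def IsFredholmOp (T : X →ₗ.[B] Y) : Prop := IsFredholm (Dom.op T)

/-- The index of a regular `B`-Fredholm operator. -/
def indexOp (T : X →ₗ.[B] Y) : K0 B := index (Dom.op T)

end Unbounded

/-! ### Vector `B`-bundles and their sections -/

section Geometry

variable {EM : Type*} [NormedAddCommGroup EM] [NormedSpace ℝ EM]
  {HM : Type*} [TopologicalSpace HM] (I : ModelWithCorners ℝ EM HM)
  (B : Type u) [CStarAlgebra B] [PartialOrder B] [StarOrderedRing B]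

/-- A smooth vector `B`-bundle over `M`, i.e. a locally trivial bundle of finitely generated
projective `B`-modules, each fibre being a Hilbert `B`-module.  For every point `p` there is a
trivialization `triv p`, with inverse `symm p`, over an open set `baseSet p ∋ p`, with values in a
finitely generated projective Hilbert `B`-module `model p`; it is given by (continuous) `B`-linear
isomorphisms of the fibres, and the transition functions are smooth in the operator norm.
(The values of `triv p` and `symm p` outside `baseSet p` are irrelevant.) -/
structure VectorBBundle (M : Type v) [TopologicalSpace M] [ChartedSpace HM M] where
  fiber : M → Type w
  [fiberNACG : ∀ x, NormedAddCommGroup (fiber x)]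
  [fiberNS : ∀ x, NormedSpace ℂ (fiber x)]
  [fiberModule : ∀ x, Module B (fiber x)]
  [fiberCStar : ∀ x, CStarModule B (fiber x)]
  model : M → Type w
  [modelNACG : ∀ p, NormedAddCommGroup (model p)]
  [modelNS : ∀ p, NormedSpace ℂ (model p)]
  [modelModule : ∀ p, Module B (model p)]
  [modelCStar : ∀ p, CStarModule B (model p)]
  [modelComplete : ∀ p, CompleteSpace (model p)]
  [modelFinite : ∀ p, Module.Finite B (model p)]
  [modelProjective : ∀ p, Module.Projective B (model p)]
  baseSet : M → Set M
  isOpen_baseSet : ∀ p, IsOpen (baseSet p)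
  mem_baseSet : ∀ p, p ∈ baseSet p
  triv : ∀ p x, fiber x →L[ℂ] model p
  symm : ∀ p x, model p →L[ℂ] fiber x
  triv_smul : ∀ p, ∀ x ∈ baseSet p, ∀ (b : B) (v : fiber x), triv p x (b • v) = b • triv p x v
  symm_triv : ∀ p, ∀ x ∈ baseSet p, ∀ v : fiber x, symm p x (triv p x v) = v
  triv_symm : ∀ p, ∀ x ∈ baseSet p, ∀ v : model p, triv p x (symm p x v) = v
  contMDiffOn_transition : ∀ p q, ContMDiffOn I 𝓘(ℝ, model p →L[ℂ] model q) ∞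
    (fun x => triv q x ∘L symm p x) (baseSet p ∩ baseSet q)

attribute [instance] VectorBBundle.fiberNACG VectorBBundle.fiberNS VectorBBundle.fiberModule
  VectorBBundle.fiberCStar VectorBBundle.modelNACG VectorBBundle.modelNS VectorBBundle.modelModule
  VectorBBundle.modelCStar VectorBBundle.modelComplete VectorBBundle.modelFinite
  VectorBBundle.modelProjective

variable {I B}

/-- A section is smooth at `x` if it is smooth at `x` when read in the trivialization at `x`. -/
def VectorBBundle.SmoothAt {M : Type v} [TopologicalSpace M] [ChartedSpace HM M]
    (E : VectorBBundle.{u, v, w} I B M) (s : ∀ x, E.fiber x) (x : M) : Prop :=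
  ContMDiffAt I 𝓘(ℝ, E.model x) ∞ (fun y => E.triv x y (s y)) x

variable (I B) in
/-- A vector `B`-bundle whose fibrewise `B`-valued inner products vary smoothly: they are smooth on
smooth sections. -/
structure HermitianBundle (M : Type v) [TopologicalSpace M] [ChartedSpace HM M]
    extends VectorBBundle.{u, v, w} I B M where
  contMDiffAt_inner : ∀ (s t : ∀ x, toVectorBBundle.fiber x) (x : M),
    toVectorBBundle.SmoothAt s x → toVectorBBundle.SmoothAt t x →
      ContMDiffAt I 𝓘(ℝ, B) ∞ (fun y => (inner B (s y) (t y) : B)) x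

namespace HermitianBundle

variable {M : Type v} [TopologicalSpace M] [ChartedSpace HM M]
variable (E : HermitianBundle.{u, v, w} I B M)

/-- `C^∞(M; E)`. -/
def SmoothSec : Submodule B (∀ x, E.fiber x) where
  carrier := {s | ∀ x, E.SmoothAt s x}
  add_mem' {s t} hs ht x := by
    have h := (hs x).add (ht x)
    unfold VectorBBundle.SmoothAt
    simpa only [Pi.add_apply, map_add] using! h
  zero_mem' x := by
    unfold VectorBBundle.SmoothAt
    simpa only [Pi.zero_apply, map_zero] using! contMDiffAt_const
  smul_mem' b s hs x := by
    let L : E.model x →L[ℝ] E.model x :=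
      LinearMap.mkContinuous
        { toFun := fun v => b • v
          map_add' := smul_add b
          map_smul' := fun (c : ℝ) v => by
            change b • ((c : ℂ) • v) = (c : ℂ) • (b • v)
            exact smul_comm _ _ _ } ‖b‖ (norm_smul_le' b)
    have h : ContMDiffAt I 𝓘(ℝ, E.model x) ∞ (fun y => L (E.triv x y (s y))) x :=
      L.contMDiff.contMDiffAt.comp x (hs x)
    refine h.congr_of_eventuallyEq ?_
    filter_upwards [(E.isOpen_baseSet x).mem_nhds (E.mem_baseSet x)] with y hy
    exact E.triv_smul x y hy b (s y)

/-- `C_c^∞(M; E)`. -/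
def CcSec : Submodule B (∀ x, E.fiber x) where
  carrier := {s | s ∈ E.SmoothSec ∧ IsCompact (closure {x | s x ≠ 0})}
  add_mem' {s t} hs ht := by
    refine ⟨add_mem hs.1 ht.1, (hs.2.union ht.2).of_isClosed_subset isClosed_closure ?_⟩
    rw [← closure_union]
    refine closure_mono fun x hx => ?_
    by_contra h
    simp only [mem_union, mem_ofPred_eq, not_or, not_not] at h
    exact hx (by simp [h.1, h.2])
  zero_mem' := ⟨zero_mem _, by simp⟩
  smul_mem' b s hs := by
    refine ⟨Submodule.smul_mem _ b hs.1, hs.2.of_isClosed_subset isClosed_closure ?_⟩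
    refine closure_mono fun x hx h => hx ?_
    rw [Pi.smul_apply, h, smul_zero]

/-- A compactly supported smooth section as a smooth section. -/
def CcSec.toSmooth : E.CcSec →ₗ[B] E.SmoothSec :=
  Submodule.inclusion fun _ hs => hs.1

/-- Multiplication of compactly supported smooth sections by a smooth complex function. -/
def CcSec.mulFun (a : C^∞⟮I, M; 𝓘(ℝ, ℂ), ℂ⟯) : E.CcSec →ₗ[B] E.CcSec where
  toFun s := ⟨fun x => a x • s.1 x, by
    refine ⟨fun x => ?_, s.2.2.of_isClosed_subset isClosed_closure
      (closure_mono fun x hx h => hx (by simp [h]))⟩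
    have h : ContMDiffAt I 𝓘(ℝ, E.model x) ∞ (fun y => a y • E.triv x y (s.1 y)) x :=
      ((ContinuousLinearMap.lsmul ℝ ℂ (E := E.model x)).contMDiff.contMDiffAt.comp x
        (a.contMDiff x)).clm_apply (s.2.1 x)
    unfold VectorBBundle.SmoothAt
    simpa only [map_smul] using! h⟩
  map_add' s t := by
    ext x
    exact smul_add _ _ _
  map_smul' b s := by
    ext x
    exact smul_comm _ _ _

variable {E}

/-- The commutator `[D, a]` with a smooth function. -/
def commutator {F : HermitianBundle.{u, v, w} I B M} (D : E.CcSec →ₗ[B] F.CcSec)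
    (a : C^∞⟮I, M; 𝓘(ℝ, ℂ), ℂ⟯) : E.CcSec →ₗ[B] F.CcSec :=
  D ∘ₗ CcSec.mulFun E a - CcSec.mulFun F a ∘ₗ D

/-- `D` is a differential operator of order at most `m`: all iterated commutators of `D` with
`m + 1` smooth functions vanish (Grothendieck's definition). -/
def HasOrderLE {F : HermitianBundle.{u, v, w} I B M} :
    ℕ → (E.CcSec →ₗ[B] F.CcSec) → Prop
  | 0, D => ∀ a, commutator D a = 0
  | m + 1, D => ∀ a, HasOrderLE m (commutator D a)

/-- `D` is a differential operator (with coefficients in `B`). -/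
def IsDiffOp {F : HermitianBundle.{u, v, w} I B M} (D : E.CcSec →ₗ[B] F.CcSec) : Prop :=
  ∃ m, HasOrderLE m D

end HermitianBundle

end Geometry

/-! ### The Hilbert module of square integrable sections -/

section L2

variable {EM : Type*} [NormedAddCommGroup EM] [NormedSpace ℝ EM]
  {HM : Type*} [TopologicalSpace HM] {I : ModelWithCorners ℝ EM HM}
  {B : Type u} [CStarAlgebra B] [PartialOrder B] [StarOrderedRing B]
  {M : Type v} [TopologicalSpace M] [ChartedSpace HM M]
  [MeasurableSpace M] [BorelSpace M]

/-- `C_c^∞(M; E)`, to be equipped with the `L²` inner product with respect to `μ`. -/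
def PreL2 (E : HermitianBundle.{u, v, w} I B M) (_μ : Measure M) : Type max v w := E.CcSec

namespace PreL2

variable (E : HermitianBundle.{u, v, w} I B M) (μ : Measure M)

instance : AddCommGroup (PreL2 E μ) := inferInstanceAs (AddCommGroup E.CcSec)
instance : Module B (PreL2 E μ) := inferInstanceAs (Module B E.CcSec)
instance : Module ℂ (PreL2 E μ) := inferInstanceAs (Module ℂ E.CcSec)

/-- The underlying section. -/
def sec : PreL2 E μ →ₗ[B] E.CcSec := LinearMap.id

/-- A section as an element of `PreL2`. -/
def ofSec : E.CcSec →ₗ[B] PreL2 E μ := LinearMap.id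

/-- The `L²` inner product `∫ ⟪s x, t x⟫ dμ(x)`. -/
instance : Inner B (PreL2 E μ) where
  inner s t := ∫ x, (inner B ((sec E μ s).1 x) ((sec E μ t).1 x) : B) ∂μ

theorem inner_def (s t : PreL2 E μ) :
    (inner B s t : B) = ∫ x, (inner B ((sec E μ s).1 x) ((sec E μ t).1 x) : B) ∂μ := rfl

instance : Norm (PreL2 E μ) := CStarModule.norm B

variable {E}

theorem continuous_inner (s t : E.CcSec) :
    Continuous fun x => (inner B (s.1 x) (t.1 x) : B) :=
  continuous_iff_continuousAt.mpr fun x =>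
    (E.contMDiffAt_inner s.1 t.1 x (s.2.1 x) (t.2.1 x)).continuousAt

variable [IsLocallyFiniteMeasure μ]

theorem integrable_inner (s t : E.CcSec) :
    Integrable (fun x => (inner B (s.1 x) (t.1 x) : B)) μ := by
  refine (continuous_inner s t).integrable_of_hasCompactSupport ?_
  refine s.2.2.of_isClosed_subset (isClosed_tsupport _) (closure_mono fun x hx h => hx ?_)
  simp [h]

variable [μ.IsOpenPosMeasure]

theorem eq_zero_of_inner_self (s : E.CcSec)
    (h : ∫ x, (inner B (s.1 x) (s.1 x) : B) ∂μ = 0) : s = 0 := by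
  have hc := continuous_inner s s
  have hi := integrable_inner μ s s
  have hnn : ∀ x, 0 ≤ (inner B (s.1 x) (s.1 x) : B) := fun x => CStarModule.inner_self_nonneg
  have hae : (fun x => (inner B (s.1 x) (s.1 x) : B)) =ᵐ[μ] 0 := by
    refine hi.ae_eq_zero_of_forall_setIntegral_eq_zero fun t ht _ => ?_
    refine le_antisymm ?_ (integral_nonneg hnn)
    rw [← h, ← integral_add_compl ht hi]
    exact le_add_of_nonneg_right (integral_nonneg hnn)
  have h0 := (hc.ae_eq_iff_eq μ continuous_zero).mp hae
  ext x
  exact CStarModule.inner_self.mp (congrFun h0 x)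

instance : CStarModule B (PreL2 E μ) where
  inner_add_right {s t r} := by
    simp only [inner_def]
    rw [← integral_add (integrable_inner μ (sec E μ s) (sec E μ t))
      (integrable_inner μ (sec E μ s) (sec E μ r))]
    exact integral_congr_ae (.of_forall fun x => CStarModule.inner_add_right)
  inner_self_nonneg {s} := integral_nonneg fun x => CStarModule.inner_self_nonneg
  inner_self {s} := by
    refine ⟨eq_zero_of_inner_self μ s, ?_⟩
    rintro rfl
    rw [inner_def]
    exact integral_eq_zero_of_ae (.of_forall fun x => CStarModule.inner_zero_right)
  inner_op_smul_right {b s t} := by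
    have h := (ContinuousLinearMap.mul ℝ B b).integral_comp_comm
      (integrable_inner μ (sec E μ s) (sec E μ t))
    simp only [inner_def]
    rw [ContinuousLinearMap.mul_apply'] at h
    rw [← h]
    exact integral_congr_ae (.of_forall fun x => CStarModule.inner_op_smul_right)
  inner_smul_right_complex {c s t} := by
    simp only [inner_def]
    rw [← integral_smul]
    exact integral_congr_ae (.of_forall fun x => CStarModule.inner_smul_right_complex)
  star_inner s t := by
    have h := (starL' ℝ (A := B)).toContinuousLinearMap.integral_comp_comm
      (integrable_inner μ (sec E μ s) (sec E μ t))
    simp only [inner_def]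
    refine h.symm.trans ?_
    exact integral_congr_ae (.of_forall fun x => CStarModule.star_inner _ _)
  norm_eq_sqrt_norm_inner_self s := rfl

instance : NormedAddCommGroup (PreL2 E μ) :=
  NormedAddCommGroup.ofCore (CStarModule.normedSpaceCore B)
instance : NormedSpace ℂ (PreL2 E μ) := NormedSpace.ofCore (CStarModule.normedSpaceCore B)

end PreL2

variable (E : HermitianBundle.{u, v, w} I B M) (μ : Measure M)
  [IsLocallyFiniteMeasure μ] [μ.IsOpenPosMeasure]

/-- The Hilbert `B`-module `L²(M; E)`: the completion of `C_c^∞(M; E)` with respect to the inner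
product `∫ ⟪s x, t x⟫ dμ(x)`. -/
abbrev L2 : Type max v w := UniformSpace.Completion (PreL2 E μ)

/-- The inclusion of `C_c^∞(M; E)` in `L²(M; E)`. -/
def toL2 (s : E.CcSec) : L2 E μ := (PreL2.ofSec E μ s : PreL2 E μ)

end L2

/-! ### Manifolds with bundles, embeddings, and the gluing diagram -/

section Gluing

variable {EM : Type*} [NormedAddCommGroup EM] [NormedSpace ℝ EM]
  {HM : Type*} [TopologicalSpace HM] (I : ModelWithCorners ℝ EM HM)
  (B : Type u) [CStarAlgebra B] [PartialOrder B] [StarOrderedRing B]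

/-- A smooth manifold (possibly with boundary, modelled on `I`), with the measure defining
`L²`-sections, and with two vector `B`-bundles `E` and `F`. -/
structure BundledManifold where
  carrier : Type v
  [top : TopologicalSpace carrier]
  [charted : ChartedSpace HM carrier]
  [manifold : IsManifold I ∞ carrier]
  [t2 : T2Space carrier]
  [secondCountable : SecondCountableTopology carrier]
  [measurable : MeasurableSpace carrier]
  [borel : BorelSpace carrier]
  μ : Measure carrier
  [locallyFinite : IsLocallyFiniteMeasure μ]
  [openPos : μ.IsOpenPosMeasure]
  E : HermitianBundle.{u, v, w} I B carrier
  F : HermitianBundle.{u, v, w} I B carrier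

instance : CoeSort (BundledManifold.{u, v, w} I B) (Type v) := ⟨BundledManifold.carrier⟩

attribute [instance] BundledManifold.top BundledManifold.charted BundledManifold.manifold
  BundledManifold.t2 BundledManifold.secondCountable BundledManifold.measurable
  BundledManifold.borel BundledManifold.locallyFinite BundledManifold.openPos

variable {I B}

/-- An isometric isomorphism of the bundle `E` over `X` with the pullback of the bundle `E'` over
`Y` along a local diffeomorphism `f : X → Y`.  It is smooth in both directions: it identifies the
smooth germs of sections. -/
structure BundleIso {X Y : BundledManifold.{u, v, w} I B} (f : X → Y)
    (E : HermitianBundle.{u, v, w} I B X) (E' : HermitianBundle.{u, v, w} I B Y) where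
  equiv : ∀ x, E.fiber x ≃ₗ[B] E'.fiber (f x)
  inner_equiv : ∀ x v w, (inner B (equiv x v) (equiv x w) : B) = inner B v w
  smoothAt_iff : ∀ (s : ∀ y, E'.fiber y) (x : X),
    E.SmoothAt (fun x' => (equiv x').symm (s (f x'))) x ↔ E'.SmoothAt s (f x)

/-- The pullback of a section. -/
def BundleIso.pull {X Y : BundledManifold.{u, v, w} I B} {f : X → Y}
    {E : HermitianBundle.{u, v, w} I B X} {E' : HermitianBundle.{u, v, w} I B Y}
    (Φ : BundleIso f E E') (s : ∀ y, E'.fiber y) : ∀ x, E.fiber x :=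
  fun x => (Φ.equiv x).symm (s (f x))

/-- The pullback (restriction) of a smooth section. -/
def BundleIso.pullSmooth {X Y : BundledManifold.{u, v, w} I B} {f : X → Y}
    {E : HermitianBundle.{u, v, w} I B X} {E' : HermitianBundle.{u, v, w} I B Y}
    (Φ : BundleIso f E E') (s : E'.SmoothSec) : E.SmoothSec :=
  ⟨Φ.pull s.1, fun x => (Φ.smoothAt_iff s.1 x).mpr (s.2 (f x))⟩

/-- A diffeomorphism of `X` onto an open subset of `Y`, compatible with the measures, together with
isometric identifications of the bundles `E` and `F` of `X` with the restrictions of those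
of `Y`. -/
structure OpenEmb (X Y : BundledManifold.{u, v, w} I B) where
  toFun : X → Y
  injective : Function.Injective toFun
  isLocalDiffeomorph : IsLocalDiffeomorph I I ∞ toFun
  comap_measure : Y.μ.comap toFun = X.μ
  mapE : BundleIso toFun X.E Y.E
  mapF : BundleIso toFun X.F Y.F

variable (I B) in
/-- The gluing diagram: four manifolds `M i j = V i ∪ W j` with `V i ∩ W j = U`, and bundles
`E`, `F` on them that satisfy the same diagram. -/
structure GluingDiagram where
  U : BundledManifold.{u, v, w} I B
  V : Fin 2 → BundledManifold.{u, v, w} I B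
  W : Fin 2 → BundledManifold.{u, v, w} I B
  M : Fin 2 → Fin 2 → BundledManifold.{u, v, w} I B
  uV : ∀ i, OpenEmb U (V i)
  uW : ∀ j, OpenEmb U (W j)
  vM : ∀ i j, OpenEmb (V i) (M i j)
  wM : ∀ i j, OpenEmb (W j) (M i j)
  /-- The squares of the diagram commute, on manifolds and on bundles. -/
  comm : ∀ i j x, (vM i j).toFun ((uV i).toFun x) = (wM i j).toFun ((uW j).toFun x)
  commE : ∀ i j (s : ∀ y, (M i j).E.fiber y),
    (uV i).mapE.pull ((vM i j).mapE.pull s) = (uW j).mapE.pull ((wM i j).mapE.pull s)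
  commF : ∀ i j (s : ∀ y, (M i j).F.fiber y),
    (uV i).mapF.pull ((vM i j).mapF.pull s) = (uW j).mapF.pull ((wM i j).mapF.pull s)
  union : ∀ i j, range (vM i j).toFun ∪ range (wM i j).toFun = univ
  inter : ∀ i j, range (vM i j).toFun ∩ range (wM i j).toFun =
    range ((vM i j).toFun ∘ (uV i).toFun)
  /-- `U` is a non-empty manifold without boundary, precompact in `M₁₁` and `M₂₂`. -/
  nonempty : Nonempty U
  boundaryless : BoundarylessManifold I U
  precompact : ∀ i, IsCompact (closure (range ((vM i i).toFun ∘ (uV i).toFun)))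

/-- A boundary operator on `X`, with values in a `B`-module `G` (for instance the smooth sections
of a vector `B`-bundle over the boundary of `X`): a `B`-linear map on `C^∞(X; E)`, possibly
nonlocal along the boundary, that only depends on the section near the boundary. -/
structure BoundaryOp (X : BundledManifold.{u, v, w} I B) (G : Type*) [AddCommGroup G]
    [Module B G] where
  toFun : X.E.SmoothSec →ₗ[B] G
  eq_zero : ∀ s : X.E.SmoothSec, (∀ x ∈ I.boundary X, ∀ᶠ y in 𝓝 x, s.1 y = 0) → toFun s = 0

namespace GluingDiagram

variable (𝔇 : GluingDiagram.{u, v, w} I B)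

/-- The sections in `C_c^∞(M i j; E)` whose restrictions to `V i` and `W j` satisfy the boundary
conditions. -/
def bcSections {GV GW : Fin 2 → Type*}
    [∀ i, AddCommGroup (GV i)] [∀ i, Module B (GV i)]
    [∀ j, AddCommGroup (GW j)] [∀ j, Module B (GW j)]
    (bV : ∀ i, BoundaryOp (𝔇.V i) (GV i)) (bW : ∀ j, BoundaryOp (𝔇.W j) (GW j)) (i j : Fin 2) :
    Set (𝔇.M i j).E.CcSec :=
  {f | (bV i).toFun ((𝔇.vM i j).mapE.pullSmooth (HermitianBundle.CcSec.toSmooth _ f)) = 0 ∧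
    (bW j).toFun ((𝔇.wM i j).mapE.pullSmooth (HermitianBundle.CcSec.toSmooth _ f)) = 0}

end GluingDiagram

namespace BundledManifold

variable (X : BundledManifold.{u, v, w} I B)

/-- `T` is the closed realization of `D` with core `core`: `T` is the closure of the restriction
of `D` to `core`, as an operator from `L²(X; E)` to `L²(X; F)`. -/
def IsClosedRealization (D : X.E.CcSec →ₗ[B] X.F.CcSec) (core : Set X.E.CcSec)
    (T : L2 X.E X.μ →ₗ.[B] L2 X.F X.μ) : Prop :=
  (T.graph : Set (L2 X.E X.μ × L2 X.F X.μ)) =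
    closure ((fun f => (toL2 X.E X.μ f, toL2 X.F X.μ (D f))) '' core)

/-- `[D, a]`, defined on `core`, extends to a compact operator from `Dom T` to `L²(X; F)`. -/
def CommutatorCompact (D : X.E.CcSec →ₗ[B] X.F.CcSec) (core : Set X.E.CcSec)
    (T : L2 X.E X.μ →ₗ.[B] L2 X.F X.μ) (a : C^∞⟮I, X; 𝓘(ℝ, ℂ), ℂ⟯) : Prop :=
  ∃ K : Dom T →ₗ[B] L2 X.F X.μ, IsCompactOp K ∧
    ∀ f ∈ core, ∀ z : Dom T, Dom.incl T z = toL2 X.E X.μ f →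
      K z = toL2 X.F X.μ (HermitianBundle.commutator D a f)

end BundledManifold

/-- Differential operators `D` on `X` and `D'` on `Y` agree on the common open piece `Z` of `X`
and `Y`: sections that agree on `Z` are mapped to sections that agree on `Z`. -/
def AgreeOn {Z X Y : BundledManifold.{u, v, w} I B} (φ : OpenEmb Z X) (ψ : OpenEmb Z Y)
    (D : X.E.CcSec →ₗ[B] X.F.CcSec) (D' : Y.E.CcSec →ₗ[B] Y.F.CcSec) : Prop :=
  ∀ (s : X.E.CcSec) (t : Y.E.CcSec), φ.mapE.pull s.1 = ψ.mapE.pull t.1 →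
    φ.mapF.pull (D s).1 = ψ.mapF.pull (D' t).1

end Gluing

end RelIndex

end

open RelIndex

namespace RelIndex

/-! ### Classes in `K₀` and stably invertible maps -/

section StableIndex

variable {B : Type u} [Ring B]

attribute [instance] FGProj.finite FGProj.projective

/-! Choose compatible smooth functions `χ` on the four manifolds, equal to `0` near the complement
of `W j`, to `1` near the complement of `V i`, and locally constant outside a compact subset of `U`
(`nonempty_transition`). Multiplication by `cos (π χ / 2)` followed by transport along `V i` gives
operators `S : L²(M i j) → L²(M i j')`. Multiplication by `sin (π χ / 2)` followed by transport
along `W j` gives `R : L²(M i j) → L²(M i' j)`. From `cos² + sin² = 1` one gets `S S + R R = 1`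
(`shiftV_shiftV_add`). Both orders of composing `S` with `R` multiply by `sin · cos` over `U` and
give zero elsewhere, so `S R = R S` (`shiftV_shiftW`). The rotation matrix with rows `(S, R)` and
`(-R, S)` is therefore an isomorphism from `M 0 0 ⊔ M 1 1` to `M 0 1 ⊔ M 1 0` at the level of
sections (`squareEquiv`).

Differential operators are local, so `D` fails to commute with `S` and `R` only by a commutator with
a compactly supported function on `U`, and this is compact by hypothesis. Consequently `S` and `R`
also act adjointably on the domains and intertwine the closed operators up to compact ones
(`CutOff.exists_transplant_dom`). The boundary conditions survive because `cos (π χ / 2)` is `1`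
near `∂V i`, `sin (π χ / 2)` is `1` near `∂W j`, and each transplant vanishes near the other piece's
boundary.

What remains is abstract (`square_index`). The relation `S S + R R = 1` exhibits each operator,
modulo compacts, as a direct summand of the sum of its two neighbours in the square, so Fredholmness
passes from the neighbours to it (`IsFredholm.of_summand`). For the index, call `T : A → C` stably
invertible if it is the corner of an isomorphism `A ⊕ P ≅ C ⊕ Q` with `P`, `Q` finitely generated
projective; formally `[A] - [C] = [Q] - [P]`. This class is well defined (`HasIndex.unique`),
additive, invariant under isomorphisms, and stable under small perturbations of a bounded parametrix
and under perturbations through finitely generated projective modules, hence under compact ones. It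
agrees with the index defined by regular extensions (`IsFredholm.exists_hasIndexWith`), so
conjugation by the rotation gives the formula (`index_add_index_eq`). -/

theorem exists_fgProj_equiv (P : Type*) [AddCommGroup P] [Module B P] [Module.Finite B P]
    [Module.Projective B P] : ∃ Q : FGProj B, Nonempty (P ≃ₗ[B] Q.carrier) := by
  obtain ⟨n, f, g, -, hg, hfg⟩ := Module.Finite.exists_comp_eq_id_of_projective B P
  let e : P ≃ₗ[B] LinearMap.range g := LinearEquiv.ofInjective g hg
  exact ⟨⟨n, LinearMap.range g, Module.Finite.equiv e, Module.Projective.of_equiv e⟩, ⟨e⟩⟩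

variable (B) in
/-- The zero module. -/
def FGProj.zero : FGProj B := ⟨0, ⊥, inferInstance, inferInstance⟩

instance : Subsingleton (FGProj.zero B).carrier :=
  inferInstanceAs (Subsingleton (⊥ : Submodule B (Fin 0 → B)))

namespace K0

theorem mk_of_eq_add {P Q R : FGProj B} (e : P.carrier ≃ₗ[B] Q.carrier × R.carrier) :
    (QuotientAddGroup.mk (FreeAbelianGroup.of P) : K0 B) =
      QuotientAddGroup.mk (FreeAbelianGroup.of Q) +
        QuotientAddGroup.mk (FreeAbelianGroup.of R) := by
  rw [← QuotientAddGroup.mk_add, ← sub_eq_zero, ← QuotientAddGroup.mk_sub,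
    QuotientAddGroup.eq_zero_iff]
  exact AddSubgroup.subset_closure ⟨P, Q, R, ⟨e⟩, rfl⟩

/-- Since `0 ≅ 0 ⊕ 0`, the class satisfies `[0] = [0] + [0]`. -/
theorem mk_of_zero : (QuotientAddGroup.mk (FreeAbelianGroup.of (FGProj.zero B)) : K0 B) = 0 := by
  have h := mk_of_eq_add (B := B) (P := FGProj.zero B) (Q := FGProj.zero B) (R := FGProj.zero B)
    (LinearEquiv.ofLinearMap 0 0 (LinearMap.ext fun x => Subsingleton.elim _ _)
      (LinearMap.ext fun x => Subsingleton.elim _ _))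
  exact left_eq_add.mp h

theorem mk_of_congr {P Q : FGProj B} (e : P.carrier ≃ₗ[B] Q.carrier) :
    (QuotientAddGroup.mk (FreeAbelianGroup.of P) : K0 B) =
      QuotientAddGroup.mk (FreeAbelianGroup.of Q) := by
  have f : Q.carrier ≃ₗ[B] Q.carrier × (FGProj.zero B).carrier :=
    LinearEquiv.ofLinearMap (LinearMap.inl B _ _) (LinearMap.fst B _ _)
      (LinearMap.ext fun x => Prod.ext rfl (Subsingleton.elim _ _)) rfl
  rw [mk_of_eq_add (e.trans f), mk_of_zero, add_zero]

/-- The representative picked by choice in `cls` is immaterial, because isomorphic modules have the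
same class. -/
theorem cls_eq_mk {P : Type v} [AddCommGroup P] [Module B P] {Q : FGProj B}
    (e : P ≃ₗ[B] Q.carrier) : cls B P = QuotientAddGroup.mk (FreeAbelianGroup.of Q) := by
  have h : ∃ Q : FGProj B, Nonempty (P ≃ₗ[B] Q.carrier) := ⟨Q, ⟨e⟩⟩
  rw [cls, dif_pos h]
  exact mk_of_congr (h.choose_spec.some.symm.trans e)

variable {P : Type v} [AddCommGroup P] [Module B P] [Module.Finite B P] [Module.Projective B P]
  {Q : Type w} [AddCommGroup Q] [Module B Q]

theorem cls_congr (e : P ≃ₗ[B] Q) : cls B P = cls B Q := by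
  obtain ⟨R, ⟨f⟩⟩ := exists_fgProj_equiv (B := B) P
  rw [cls_eq_mk f, cls_eq_mk (e.symm.trans f)]

theorem cls_prod [Module.Finite B Q] [Module.Projective B Q] :
    cls B (P × Q) = cls B P + cls B Q := by
  obtain ⟨P', ⟨e⟩⟩ := exists_fgProj_equiv (B := B) P
  obtain ⟨Q', ⟨f⟩⟩ := exists_fgProj_equiv (B := B) Q
  obtain ⟨R', ⟨g⟩⟩ := exists_fgProj_equiv (B := B) (P × Q)
  rw [cls_eq_mk e, cls_eq_mk f, cls_eq_mk g]
  exact mk_of_eq_add (g.symm.trans (e.prodCongr f))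

end K0

/-! ### Stably invertible maps and uniqueness of their index. -/

section HasIndex

variable {A : Type*} [AddCommGroup A] [Module B A] {C : Type*} [AddCommGroup C] [Module B C]
  {A' : Type*} [AddCommGroup A'] [Module B A'] {C' : Type*} [AddCommGroup C'] [Module B C']

/-- `T : A → C` is the corner of an isomorphism `A ⊕ P ≃ C ⊕ Q` with finitely generated projective
`P` and `Q`, the corner of the inverse is `S`, and `k = [Q] - [P]`. -/
def HasIndexWith (T : A →ₗ[B] C) (S : C → A) (k : K0 B) : Prop :=
  ∃ (P Q : FGProj B) (Ψ : (A × P.carrier) ≃ₗ[B] C × Q.carrier),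
    (∀ x, (Ψ (x, 0)).1 = T x) ∧ (∀ y, (Ψ.symm (y, 0)).1 = S y) ∧
      k = K0.cls B Q.carrier - K0.cls B P.carrier

/-- `T` is stably invertible with index `k`. -/
def HasIndex (T : A →ₗ[B] C) (k : K0 B) : Prop := ∃ S, HasIndexWith T S k

theorem HasIndexWith.of_equiv {P : Type*} [AddCommGroup P] [Module B P] [Module.Finite B P]
    [Module.Projective B P] {Q : Type*} [AddCommGroup Q] [Module B Q] [Module.Finite B Q]
    [Module.Projective B Q] {T : A →ₗ[B] C} {S : C → A} (Ψ : (A × P) ≃ₗ[B] C × Q)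
    (hT : ∀ x, (Ψ (x, 0)).1 = T x) (hS : ∀ y, (Ψ.symm (y, 0)).1 = S y) :
    HasIndexWith T S (K0.cls B Q - K0.cls B P) := by
  obtain ⟨P', ⟨e⟩⟩ := exists_fgProj_equiv (B := B) P
  obtain ⟨Q', ⟨f⟩⟩ := exists_fgProj_equiv (B := B) Q
  refine ⟨P', Q', (((LinearEquiv.refl B A).prodCongr e).symm.trans Ψ).trans
    ((LinearEquiv.refl B C).prodCongr f), fun x => ?_, fun y => ?_, ?_⟩
  · simp [← hT]
  · simp [← hS]
  · rw [K0.cls_congr e, K0.cls_congr f]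

theorem HasIndex.of_equiv {P : Type*} [AddCommGroup P] [Module B P] [Module.Finite B P]
    [Module.Projective B P] {Q : Type*} [AddCommGroup Q] [Module B Q] [Module.Finite B Q]
    [Module.Projective B Q] {T : A →ₗ[B] C} (Ψ : (A × P) ≃ₗ[B] C × Q)
    (hT : ∀ x, (Ψ (x, 0)).1 = T x) :
    HasIndex T (K0.cls B Q - K0.cls B P) :=
  ⟨_, .of_equiv Ψ hT fun _ => rfl⟩

/-- Gaussian elimination with the invertible corner `1` leaves the Schur complement of `Ψ`, which
must be an isomorphism `P ≅ Q`; its inverse is the lower right corner of `Ψ⁻¹`. -/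
theorem HasIndex.eq_zero_of_id {k : K0 B} (h : HasIndex (LinearMap.id : A →ₗ[B] A) k) :
    k = 0 := by
  obtain ⟨S, P, Q, Ψ, hT, -, rfl⟩ := h
  simp only [LinearMap.id_apply] at hT
  -- The correction in the `A` component is chosen so that the first component of `Ψ` vanishes; the
  -- second component of `f` is the Schur complement.
  let f : P.carrier →ₗ[B] A × Q.carrier := Ψ.toLinearMap ∘ₗ
    (LinearMap.prod (-(LinearMap.fst B _ _ ∘ₗ Ψ.toLinearMap ∘ₗ LinearMap.inr B _ _)) LinearMap.id)
  have hf1 : ∀ p, (f p).1 = 0 := fun p => by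
    have h1 : Ψ (-(Ψ (0, p)).1, p) = Ψ (-(Ψ (0, p)).1, 0) + Ψ (0, p) := by
      rw [← map_add]; simp
    simp [f, h1, hT]
  have hf : ∀ p, f p = (0, (f p).2) := fun p => Prod.ext (hf1 p) rfl
  have e : P.carrier ≃ₗ[B] Q.carrier := LinearEquiv.ofLinearMap (LinearMap.snd B _ _ ∘ₗ f)
    (LinearMap.snd B _ _ ∘ₗ Ψ.symm.toLinearMap ∘ₗ LinearMap.inr B _ _)
    (LinearMap.ext fun q => by
      set z := Ψ.symm (0, q) with hz
      have h1 : Ψ (z.1, 0) + Ψ (0, z.2) = (0, q) := by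
        rw [← map_add]; simp [hz]
      have h2 : z.1 + (Ψ (0, z.2)).1 = 0 := by
        have := congrArg Prod.fst h1
        simpa [hT] using this
      have h3 : f z.2 = (0, q) := by
        have : (-(Ψ (0, z.2)).1, z.2) = z := Prod.ext (neg_eq_of_add_eq_zero_left h2) rfl
        change Ψ (-(Ψ (0, z.2)).1, z.2) = _
        rw [this, hz, LinearEquiv.apply_symm_apply]
      change (f (Ψ.symm (0, q)).2).2 = q
      rw [← hz, h3])
    (LinearMap.ext fun p => by
      change (Ψ.symm (0, (f p).2)).2 = p
      rw [← hf p]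
      simp [f])
  rw [K0.cls_congr e, sub_self]

/-- The index does not change under perturbations that factor through a finitely generated
projective module. -/
theorem HasIndex.add_comp {T : A →ₗ[B] C} {k : K0 B} (h : HasIndex T k) {N : Type*}
    [AddCommGroup N] [Module B N] [Module.Finite B N] [Module.Projective B N]
    (α : A →ₗ[B] N) (β : N →ₗ[B] C) : HasIndex (T + β ∘ₗ α) k := by
  obtain ⟨S, P, Q, Ψ, hT, -, rfl⟩ := h
  -- This is `Ψ ⊕ 1` between two shears: `α` is first added to the `N` component, and `β` of the
  -- result is then added to the `C` component.
  let Ψ' : (A × P.carrier × N) ≃ₗ[B] C × Q.carrier × N :=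
    { toFun := fun x => ((Ψ (x.1, x.2.1)).1 + β (x.2.2 + α x.1), (Ψ (x.1, x.2.1)).2,
        x.2.2 + α x.1)
      map_add' := fun x y => by
        have h1 : Ψ (x.1 + y.1, x.2.1 + y.2.1) = Ψ (x.1, x.2.1) + Ψ (y.1, y.2.1) := by
          rw [← map_add]; rfl
        simp only [Prod.fst_add, Prod.snd_add, h1, map_add, Prod.mk_add_mk, Prod.mk.injEq]
        refine ⟨by abel, trivial, by abel⟩
      map_smul' := fun b x => by
        have h1 : Ψ (b • x.1, b • x.2.1) = b • Ψ (x.1, x.2.1) := by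
          rw [← map_smul]; rfl
        simp [h1]
      invFun := fun y => ((Ψ.symm (y.1 - β y.2.2, y.2.1)).1, (Ψ.symm (y.1 - β y.2.2, y.2.1)).2,
        y.2.2 - α (Ψ.symm (y.1 - β y.2.2, y.2.1)).1)
      left_inv := fun x => by simp
      right_inv := fun y => by simp }
  have h1 := HasIndex.of_equiv (T := T + β ∘ₗ α) Ψ' fun x => by simp [Ψ', hT]
  rw [K0.cls_prod, K0.cls_prod, add_sub_add_right_eq_sub] at h1
  exact h1

/-- Compose the second dilation with the inverse of the first. The resulting isomorphism dilates `S₁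
T`, where `S₁` is the corner of `Ψ₁⁻¹`, and `1 - S₁ T` factors through `Q₁`. So the identity of `A`
has index `[P₁] + [Q₂] - [P₂] - [Q₁]`, which is then zero. -/
theorem HasIndex.unique {T : A →ₗ[B] C} {k₁ k₂ : K0 B} (h₁ : HasIndex T k₁)
    (h₂ : HasIndex T k₂) : k₁ = k₂ := by
  obtain ⟨S₁, P₁, Q₁, Ψ₁, hT₁, -, rfl⟩ := h₁
  obtain ⟨S₂, P₂, Q₂, Ψ₂, hT₂, -, rfl⟩ := h₂
  let T' : A →ₗ[B] A := LinearMap.fst B _ _ ∘ₗ Ψ₁.symm.toLinearMap ∘ₗ LinearMap.inl B _ _ ∘ₗ T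
  let Θ : (A × P₂.carrier × Q₁.carrier) ≃ₗ[B] A × P₁.carrier × Q₂.carrier :=
    { toFun := fun x => ((Ψ₁.symm ((Ψ₂ (x.1, x.2.1)).1, x.2.2)).1,
        (Ψ₁.symm ((Ψ₂ (x.1, x.2.1)).1, x.2.2)).2, (Ψ₂ (x.1, x.2.1)).2)
      map_add' := fun x y => by
        have h1 : Ψ₂ (x.1 + y.1, x.2.1 + y.2.1) = Ψ₂ (x.1, x.2.1) + Ψ₂ (y.1, y.2.1) := by
          rw [← map_add]; rfl
        have h2 : Ψ₁.symm ((Ψ₂ (x.1, x.2.1)).1 + (Ψ₂ (y.1, y.2.1)).1, x.2.2 + y.2.2) =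
            Ψ₁.symm ((Ψ₂ (x.1, x.2.1)).1, x.2.2) + Ψ₁.symm ((Ψ₂ (y.1, y.2.1)).1, y.2.2) := by
          rw [← map_add]; rfl
        simp only [Prod.fst_add, Prod.snd_add, h1, h2, Prod.mk_add_mk]
      map_smul' := fun b x => by
        have h1 : Ψ₂ (b • x.1, b • x.2.1) = b • Ψ₂ (x.1, x.2.1) := by
          rw [← map_smul]; rfl
        have h2 : Ψ₁.symm (b • (Ψ₂ (x.1, x.2.1)).1, b • x.2.2) =
            b • Ψ₁.symm ((Ψ₂ (x.1, x.2.1)).1, x.2.2) := by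
          rw [← map_smul]; rfl
        simp [h1, h2]
      invFun := fun y => ((Ψ₂.symm ((Ψ₁ (y.1, y.2.1)).1, y.2.2)).1,
        (Ψ₂.symm ((Ψ₁ (y.1, y.2.1)).1, y.2.2)).2, (Ψ₁ (y.1, y.2.1)).2)
      left_inv := fun x => by simp
      right_inv := fun y => by simp }
  have h1 := HasIndex.of_equiv (T := T') Θ fun x => by simp [Θ, T', hT₂]
  have h2 := (h1.add_comp (LinearMap.snd B _ _ ∘ₗ Ψ₁.toLinearMap ∘ₗ LinearMap.inl B _ _)
    (LinearMap.fst B _ _ ∘ₗ Ψ₁.symm.toLinearMap ∘ₗ LinearMap.inr B _ _))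
  have h3 : T' + (LinearMap.fst B _ _ ∘ₗ Ψ₁.symm.toLinearMap ∘ₗ LinearMap.inr B _ _) ∘ₗ
      (LinearMap.snd B _ _ ∘ₗ Ψ₁.toLinearMap ∘ₗ LinearMap.inl B _ _) = LinearMap.id := by
    ext x
    have h4 : Ψ₁.symm (T x, 0) + Ψ₁.symm (0, (Ψ₁ (x, 0)).2) = (x, 0) := by
      rw [← map_add, ← hT₁]
      simp
    exact congrArg Prod.fst h4
  rw [h3] at h2
  have h5 := h2.eq_zero_of_id
  rw [K0.cls_prod, K0.cls_prod] at h5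
  rw [← sub_eq_zero, ← neg_eq_zero, ← h5]
  abel

theorem HasIndex.congr {T : A →ₗ[B] C} {k : K0 B} (h : HasIndex T k) (e : A ≃ₗ[B] A')
    (f : C ≃ₗ[B] C') {T' : A' →ₗ[B] C'} (hT' : ∀ x, T' (e x) = f (T x)) : HasIndex T' k := by
  obtain ⟨S, P, Q, Ψ, hT, -, rfl⟩ := h
  refine .of_equiv (((e.prodCongr (LinearEquiv.refl B _)).symm.trans Ψ).trans
    (f.prodCongr (LinearEquiv.refl B _))) fun x => ?_
  have := hT' (e.symm x)
  simp_all

theorem HasIndexWith.prodMap {T : A →ₗ[B] C} {S : C → A} {k : K0 B} (h : HasIndexWith T S k)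
    {T' : A' →ₗ[B] C'} {S' : C' → A'} {k' : K0 B} (h' : HasIndexWith T' S' k') :
    HasIndexWith (T.prodMap T') (Prod.map S S') (k + k') := by
  obtain ⟨P, Q, Ψ, hT, hS, rfl⟩ := h
  obtain ⟨P', Q', Ψ', hT', hS', rfl⟩ := h'
  have h1 := HasIndexWith.of_equiv (T := T.prodMap T') (S := Prod.map S S')
    (((LinearEquiv.prodProdProdComm B A A' P.carrier P'.carrier).trans (Ψ.prodCongr Ψ')).trans
      (LinearEquiv.prodProdProdComm B C Q.carrier C' Q'.carrier))
    (fun x => by simp [hT, hT']) (fun x => by simp [hS, hS', Prod.map])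
  rw [K0.cls_prod, K0.cls_prod] at h1
  rwa [sub_add_sub_comm]

theorem HasIndex.id : HasIndex (LinearMap.id : A →ₗ[B] A) 0 := by
  have := HasIndex.of_equiv (T := (LinearMap.id : A →ₗ[B] A))
    (LinearEquiv.refl B (A × (FGProj.zero B).carrier)) fun x => rfl
  rwa [sub_self] at this

/-- Perturbation by a map `E` for which `1 + S E` is invertible. -/
theorem HasIndexWith.add_of_bijective {T : A →ₗ[B] C} {S : C → A} {k : K0 B}
    (h : HasIndexWith T S k) (E : A →ₗ[B] C) (hE : Function.Bijective fun x => x + S (E x)) :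
    HasIndex (T + E) k := by
  obtain ⟨P, Q, Ψ, hT, hS, rfl⟩ := h
  let SE : A →ₗ[B] A := LinearMap.fst B _ _ ∘ₗ Ψ.symm.toLinearMap ∘ₗ LinearMap.inl B _ _ ∘ₗ E
  let γ : A →ₗ[B] P.carrier :=
    LinearMap.snd B _ _ ∘ₗ Ψ.symm.toLinearMap ∘ₗ LinearMap.inl B _ _ ∘ₗ E
  have hSE : ∀ x, S (E x) = SE x := fun x => (hS _).symm
  let v : A ≃ₗ[B] A := LinearEquiv.ofBijective (LinearMap.id + SE) (by
    convert hE using 1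
    ext x
    simp [hSE])
  have hv : ∀ x, v x = x + SE x := fun x => rfl
  let m : (A × P.carrier) ≃ₗ[B] A × P.carrier :=
    { toFun := fun x => (v x.1, x.2 + γ x.1)
      map_add' := fun x y => by
        simp only [Prod.fst_add, Prod.snd_add, map_add, Prod.mk_add_mk, Prod.mk.injEq, true_and]
        abel
      map_smul' := fun b x => by simp
      invFun := fun x => (v.symm x.1, x.2 - γ (v.symm x.1))
      left_inv := fun x => by simp
      right_inv := fun x => by simp }
  refine .of_equiv (m.trans Ψ) fun x => ?_
  have h1 : m (x, 0) = (x, 0) + Ψ.symm (E x, 0) := by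
    refine Prod.ext ?_ ?_
    · simp [m, hv, SE]
    · simp [m, γ]
  rw [LinearEquiv.trans_apply, h1, map_add, LinearEquiv.apply_symm_apply]
  simp [hT]

variable {R : A →ₗ[B] C} {G : C →ₗ[B] A} {k : K0 B}

/-- On `ker R` the isomorphism `Ψ` takes values in `0 ⊕ Q`, which embeds the kernel in `Q`. Going
back by `Ψ⁻¹` and applying the projection `1 - G R` onto the kernel is a retraction. -/
theorem HasIndex.finite_projective_ker (h : HasIndex R k) (hRGR : R ∘ₗ G ∘ₗ R = R) :
    Module.Finite B (LinearMap.ker R) ∧ Module.Projective B (LinearMap.ker R) := by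
  obtain ⟨S, P, Q, Ψ, hT, -, rfl⟩ := h
  have hRGR' : ∀ x, R (G (R x)) = R x := fun x => LinearMap.congr_fun hRGR x
  let i : LinearMap.ker R →ₗ[B] Q.carrier :=
    LinearMap.snd B _ _ ∘ₗ Ψ.toLinearMap ∘ₗ LinearMap.inl B _ _ ∘ₗ (LinearMap.ker R).subtype
  let r : Q.carrier →ₗ[B] LinearMap.ker R :=
    LinearMap.codRestrict _ ((LinearMap.id - G ∘ₗ R) ∘ₗ LinearMap.fst B _ _ ∘ₗ
      Ψ.symm.toLinearMap ∘ₗ LinearMap.inr B _ _) fun q => by simp [hRGR']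
  have hri : r ∘ₗ i = LinearMap.id := by
    refine LinearMap.ext fun x => Subtype.ext ?_
    have hx : R x = 0 := x.2
    have h1 : Ψ (x, 0) = (0, (Ψ ((x : A), 0)).2) := Prod.ext (by rw [hT, hx]) rfl
    have h2 : Ψ.symm (0, (Ψ ((x : A), 0)).2) = ((x : A), 0) := by
      rw [← h1, LinearEquiv.symm_apply_apply]
    change (LinearMap.id - G ∘ₗ R : A →ₗ[B] A) (Ψ.symm (0, (Ψ ((x : A), 0)).2)).1 = x
    rw [h2]
    simp [hx]
  exact ⟨Module.Finite.of_surjective r fun x => ⟨i x, LinearMap.congr_fun hri x⟩,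
    Module.Projective.of_split i r hri⟩

/-- The `P` component of `Ψ⁻¹ (l, 0)` determines `l` modulo the range of `R`, and `1 - R G` kills
that range while fixing `l`. So the range of this idempotent is a retract of `P`. -/
theorem HasIndex.finite_projective_range (h : HasIndex R k) (hRGR : R ∘ₗ G ∘ₗ R = R) :
    Module.Finite B (LinearMap.range (LinearMap.id - R ∘ₗ G)) ∧
      Module.Projective B (LinearMap.range (LinearMap.id - R ∘ₗ G)) := by
  obtain ⟨S, P, Q, Ψ, hT, -, rfl⟩ := h
  have hRGR' : ∀ x, R (G (R x)) = R x := fun x => LinearMap.congr_fun hRGR x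
  let i : LinearMap.range (LinearMap.id - R ∘ₗ G) →ₗ[B] P.carrier :=
    LinearMap.snd B _ _ ∘ₗ Ψ.symm.toLinearMap ∘ₗ LinearMap.inl B _ _ ∘ₗ Submodule.subtype _
  let r : P.carrier →ₗ[B] LinearMap.range (LinearMap.id - R ∘ₗ G) :=
    (LinearMap.id - R ∘ₗ G).rangeRestrict ∘ₗ LinearMap.fst B _ _ ∘ₗ
      Ψ.toLinearMap ∘ₗ LinearMap.inr B _ _
  have hri : r ∘ₗ i = LinearMap.id := by
    ext ⟨_, y, rfl⟩
    set l : C := (LinearMap.id - R ∘ₗ G : C →ₗ[B] C) y with hl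
    have h0 : (LinearMap.id - R ∘ₗ G : C →ₗ[B] C) l = l := by simp [hl, hRGR']
    set z := Ψ.symm (l, 0) with hz
    have h1 : Ψ (z.1, 0) + Ψ (0, z.2) = (l, 0) := by
      rw [← map_add]; simp [hz]
    have h2 : (Ψ (0, z.2)).1 = l - R z.1 := by
      rw [eq_sub_iff_add_eq', ← hT]
      exact congrArg Prod.fst h1
    change (LinearMap.id - R ∘ₗ G : C →ₗ[B] C) (Ψ (0, z.2)).1 = l
    rw [h2, map_sub, h0]
    simp [hRGR']
  exact ⟨Module.Finite.of_surjective r fun x => ⟨i x, LinearMap.congr_fun hri x⟩,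
    Module.Projective.of_split i r hri⟩

/-- The pseudo-inverse splits `A` as `range (G R) ⊕ ker R` and `C` as `range (R G) ⊕ range (1 - R
G)`, with `R` an isomorphism between the first summands. Adding the missing summands crosswise
dilates `R` to an isomorphism, and uniqueness of the index applies. -/
theorem HasIndex.eq_ker_sub_range (h : HasIndex R k) (hRGR : R ∘ₗ G ∘ₗ R = R)
    (hGRG : G ∘ₗ R ∘ₗ G = G) :
    k = K0.cls B (LinearMap.ker R) - K0.cls B (LinearMap.range (LinearMap.id - R ∘ₗ G)) := by
  obtain ⟨_, _⟩ := h.finite_projective_ker hRGR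
  obtain ⟨_, _⟩ := h.finite_projective_range hRGR
  have hRGR' : ∀ x, R (G (R x)) = R x := fun x => LinearMap.congr_fun hRGR x
  have hGRG' : ∀ x, G (R (G x)) = G x := fun x => LinearMap.congr_fun hGRG x
  have hRl : ∀ l : LinearMap.range (LinearMap.id - R ∘ₗ G), G l = 0 := by
    rintro ⟨_, y, rfl⟩
    simp [hGRG']
  let f : (A × LinearMap.range (LinearMap.id - R ∘ₗ G)) →ₗ[B] C × LinearMap.ker R :=
    LinearMap.prod (R ∘ₗ LinearMap.fst B _ _ + Submodule.subtype _ ∘ₗ LinearMap.snd B _ _)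
      (LinearMap.codRestrict _ (LinearMap.id - G ∘ₗ R) (fun x => by simp [hRGR']) ∘ₗ
        LinearMap.fst B _ _)
  let g : (C × LinearMap.ker R) →ₗ[B] A × LinearMap.range (LinearMap.id - R ∘ₗ G) :=
    LinearMap.prod (G ∘ₗ LinearMap.fst B _ _ + Submodule.subtype _ ∘ₗ LinearMap.snd B _ _)
      ((LinearMap.id - R ∘ₗ G).rangeRestrict ∘ₗ LinearMap.fst B _ _)
  refine h.unique (.of_equiv (LinearEquiv.ofLinearMap f g ?_ ?_) fun x => ?_)
  · refine LinearMap.ext fun ⟨y, z⟩ => Prod.ext ?_ (Subtype.ext ?_)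
    · simp [f, g]
    · have hz : R z = 0 := z.2
      simp [f, g, hz, hGRG']
  · refine LinearMap.ext fun ⟨x, l⟩ => Prod.ext ?_ (Subtype.ext ?_)
    · simp [f, g, hRl]
    · simp [f, g, hRl, hRGR']
  · simp [f]

end HasIndex

end StableIndex

/-! ### Operators on Hilbert modules -/

section Neumann

variable {B : Type u} [CStarAlgebra B]

/-- Neumann series; only the complex Banach space structure matters. -/
theorem bijective_of_norm_sub_le {A : Type*} [NormedAddCommGroup A] [NormedSpace ℂ A]
    [CompleteSpace A] [Module B A] [IsScalarTower ℂ B A] (f : A →ₗ[B] A) {c : ℝ} (hc : c < 1)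
    (h : ∀ x, ‖x - f x‖ ≤ c * ‖x‖) : Function.Bijective f := by
  -- The bound `c` may be negative, whereas a bound for the operator norm has to be nonnegative;
  -- hence `max c 0`.
  let g : A →L[ℂ] A := ((LinearMap.id - f).restrictScalars ℂ).mkContinuous (max c 0) fun x =>
    (h x).trans (by gcongr; exact le_max_left _ _)
  have hg : ‖g‖ < 1 :=
    (LinearMap.mkContinuous_norm_le _ (le_max_right _ _) _).trans_lt (by simp [hc])
  have h1 := ContinuousLinearMap.isUnit_iff_bijective.mp (isUnit_one_sub_of_norm_lt_one hg)
  convert h1 using 1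
  ext x
  change f x = x - (x - f x)
  abel

end Neumann

section Operators

variable {B : Type u} [CStarAlgebra B] [PartialOrder B] [StarOrderedRing B]
variable {X : Type*} [NormedAddCommGroup X] [NormedSpace ℂ X] [Module B X] [CStarModule B X]
variable {Y : Type*} [NormedAddCommGroup Y] [NormedSpace ℂ Y] [Module B Y] [CStarModule B Y]
variable {Z : Type*} [NormedAddCommGroup Z] [NormedSpace ℂ Z] [Module B Z] [CStarModule B Z]

namespace IsAdjointPair

theorem symm {T : X →ₗ[B] Y} {S : Y →ₗ[B] X} (h : IsAdjointPair T S) : IsAdjointPair S T :=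
  fun y x => by rw [← CStarModule.star_inner, ← h, CStarModule.star_inner]

theorem add {T T' : X →ₗ[B] Y} {S S' : Y →ₗ[B] X} (h : IsAdjointPair T S)
    (h' : IsAdjointPair T' S') : IsAdjointPair (T + T') (S + S') :=
  fun x y => by simp [h x y, h' x y]

theorem neg {T : X →ₗ[B] Y} {S : Y →ₗ[B] X} (h : IsAdjointPair T S) :
    IsAdjointPair (-T) (-S) :=
  fun x y => by simp [h x y]

theorem sub {T T' : X →ₗ[B] Y} {S S' : Y →ₗ[B] X} (h : IsAdjointPair T S)
    (h' : IsAdjointPair T' S') : IsAdjointPair (T - T') (S - S') :=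
  fun x y => by simp [h x y, h' x y]

theorem comp {T : Y →ₗ[B] Z} {S : Z →ₗ[B] Y} (h : IsAdjointPair T S)
    {T' : X →ₗ[B] Y} {S' : Y →ₗ[B] X} (h' : IsAdjointPair T' S') :
    IsAdjointPair (T ∘ₗ T') (S' ∘ₗ S) :=
  fun x z => by simp [h _ z, h' x]

theorem id : IsAdjointPair (LinearMap.id : X →ₗ[B] X) LinearMap.id := fun _ _ => rfl

theorem adjoint_unique {T : X →ₗ[B] Y} {S S' : Y →ₗ[B] X} (h : IsAdjointPair T S)
    (h' : IsAdjointPair T S') : S = S' :=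
  LinearMap.ext fun y => ext_inner (B := B) fun z => by rw [← h, ← h']

/-- By Cauchy–Schwarz `‖S y‖² = ‖⟪T (S y), y⟫‖ ≤ C ‖S y‖ ‖y‖`; the factor `‖S y‖` cancels unless it
is zero. -/
theorem bound {T : X →ₗ[B] Y} {S : Y →ₗ[B] X} (h : IsAdjointPair T S) {C : ℝ} (hC0 : 0 ≤ C)
    (hC : ∀ x, ‖T x‖ ≤ C * ‖x‖) (y : Y) : ‖S y‖ ≤ C * ‖y‖ := by
  rcases (norm_nonneg (S y)).eq_or_lt with h0 | h0
  · rw [← h0]; positivity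
  · have h1 : ‖S y‖ * ‖S y‖ ≤ ‖S y‖ * (C * ‖y‖) := by
      rw [← sq, CStarModule.norm_sq_eq B, ← h]
      refine (CStarModule.norm_inner_le Y).trans ?_
      calc ‖T (S y)‖ * ‖y‖ ≤ (C * ‖S y‖) * ‖y‖ := by gcongr; exact hC _
        _ = _ := by ring
    exact le_of_mul_le_mul_left h1 h0

/-- Closed graph theorem: the adjoint relation describes the graph by the closed conditions `⟪z, y⟫
= ⟪S z, x⟫`. -/
theorem exists_bound [CompleteSpace X] [CompleteSpace Y] {T : X →ₗ[B] Y} {S : Y →ₗ[B] X}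
    (h : IsAdjointPair T S) : ∃ C, 0 < C ∧ ∀ x, ‖T x‖ ≤ C * ‖x‖ := by
  have hc : Continuous (T.restrictScalars ℂ) := by
    refine LinearMap.continuous_of_isClosed_graph _ ?_
    have : ((T.restrictScalars ℂ).graph : Set (X × Y)) =
        ⋂ z : Y, {p | (inner B z p.2 : B) = inner B (S z) p.1} := by
      ext ⟨x, y⟩
      simp only [SetLike.mem_coe, LinearMap.mem_graph_iff, LinearMap.restrictScalars_apply,
        mem_iInter]
      refine ⟨?_, fun hz => ext_inner (B := B) fun z => ?_⟩
      · rintro hy z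
        change (inner B z y : B) = inner B (S z) x
        rw [hy, h.symm]
      · rw [h.symm z x |>.symm]
        exact hz z
    rw [this]
    refine isClosed_iInter fun z => isClosed_eq ?_ ?_
    · exact CStarModule.continuous_inner.comp (continuous_const.prodMk continuous_snd)
    · exact CStarModule.continuous_inner.comp (continuous_const.prodMk continuous_fst)
  obtain ⟨C, hC0, hC⟩ := (⟨T.restrictScalars ℂ, hc⟩ : X →L[ℂ] Y).bound
  exact ⟨C, hC0, hC⟩

/-- The inverse of a bijective map with a bijective adjoint. -/
theorem inverse {T : X ≃ₗ[B] Y} {S : Y ≃ₗ[B] X}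
    (h : IsAdjointPair (T : X →ₗ[B] Y) (S : Y →ₗ[B] X)) :
    IsAdjointPair (T.symm : Y →ₗ[B] X) (S.symm : X →ₗ[B] Y) := fun y x => by
  have := h (T.symm y) (S.symm x)
  simpa using this.symm

end IsAdjointPair

namespace IsAdjointable

theorem add {T T' : X →ₗ[B] Y} (h : IsAdjointable T) (h' : IsAdjointable T') :
    IsAdjointable (T + T') :=
  ⟨_, h.choose_spec.add h'.choose_spec⟩

theorem neg {T : X →ₗ[B] Y} (h : IsAdjointable T) : IsAdjointable (-T) := ⟨_, h.choose_spec.neg⟩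

theorem comp {T : Y →ₗ[B] Z} (h : IsAdjointable T) {T' : X →ₗ[B] Y} (h' : IsAdjointable T') :
    IsAdjointable (T ∘ₗ T') :=
  ⟨_, h.choose_spec.comp h'.choose_spec⟩

theorem id : IsAdjointable (LinearMap.id : X →ₗ[B] X) := ⟨_, .id⟩

theorem exists_bound [CompleteSpace X] [CompleteSpace Y] {T : X →ₗ[B] Y}
    (h : IsAdjointable T) : ∃ C, 0 < C ∧ ∀ x, ‖T x‖ ≤ C * ‖x‖ :=
  h.choose_spec.exists_bound

end IsAdjointable

/-! #### Extension by continuity -/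

/-- The source `P` carries no topology of its own, so the lemma serves both for spaces of sections
and for modules of pairs such as the graph of a partially defined adjoint. -/
theorem exists_extension [CompleteSpace Y] {P : Type*} [AddCommGroup P] [Module ℂ P] [Module B P]
    [IsScalarTower ℂ B P] (j : P →ₗ[B] X) (hj : DenseRange j) (f : P →ₗ[B] Y) (C : ℝ)
    (hf : ∀ p, ‖f p‖ ≤ C * ‖j p‖) :
    ∃ F : X →ₗ[B] Y, (∀ p, F (j p) = f p) ∧ ∀ x, ‖F x‖ ≤ C * ‖x‖ := by
  let g := (f.restrictScalars ℂ).extendOfNorm (j.restrictScalars ℂ)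
  have hg : ∀ p, g (j p) = f p := LinearMap.extendOfNorm_eq (e := j.restrictScalars ℂ) hj ⟨C, hf⟩
  refine ⟨{ toFun := g, map_add' := map_add g, map_smul' := fun b x => ?_ }, hg,
    LinearMap.norm_extendOfNorm_apply_le (e := j.restrictScalars ℂ) hj C hf⟩
  refine hj.induction_on (p := fun x => g (b • x) = b • g x) x (isClosed_eq ?_ ?_) fun p => ?_
  · exact g.continuous.comp (continuous_const_smul b)
  · exact g.continuous.const_smul b
  · rw [← map_smul, hg, hg, map_smul]

/-- The adjoint is defined on a dense submodule, where Cauchy–Schwarz bounds it by the same constant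
as `T`; its extension by continuity is the adjoint. -/
theorem IsAdjointable.of_dense [CompleteSpace X] (T : X →ₗ[B] Y) {C : ℝ} (hC0 : 0 ≤ C)
    (hC : ∀ x, ‖T x‖ ≤ C * ‖x‖)
    (hd : Dense {y : Y | ∃ s : X, ∀ x, (inner B (T x) y : B) = inner B x s}) :
    IsAdjointable T := by
  -- The graph of the densely defined adjoint; its two projections are the dense inclusion and the
  -- map to be extended.
  let P : Submodule B (Y × X) :=
    { carrier := {p | ∀ x, (inner B (T x) p.1 : B) = inner B x p.2}
      add_mem' := fun hp hq x => by simp [hp x, hq x]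
      zero_mem' := fun x => by simp
      smul_mem' := fun b p hp x => by simp [hp x] }
  have hP : ∀ (p : P) x, (inner B (T x) p.1.1 : B) = inner B x p.1.2 := fun p => p.2
  obtain ⟨S, hS, hSC⟩ := exists_extension (LinearMap.fst B Y X ∘ₗ P.subtype) (by
      refine hd.mono ?_
      rintro y ⟨s, hs⟩
      exact ⟨⟨(y, s), hs⟩, rfl⟩) (LinearMap.snd B Y X ∘ₗ P.subtype) C (fun p => by
    change ‖p.1.2‖ ≤ C * ‖p.1.1‖
    rcases (norm_nonneg p.1.2).eq_or_lt with h0 | h0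
    · rw [← h0]; positivity
    · have h1 : ‖p.1.2‖ * ‖p.1.2‖ ≤ ‖p.1.2‖ * (C * ‖p.1.1‖) := by
        rw [← sq, CStarModule.norm_sq_eq B, ← hP]
        refine (CStarModule.norm_inner_le Y).trans ?_
        calc ‖T p.1.2‖ * ‖p.1.1‖ ≤ (C * ‖p.1.2‖) * ‖p.1.1‖ := by gcongr; exact hC _
          _ = _ := by ring
      exact le_of_mul_le_mul_left h1 h0)
  refine ⟨S, fun x y => ?_⟩
  refine hd.induction (P := fun y => (inner B (T x) y : B) = inner B x (S y)) ?_
    (isClosed_eq ?_ ?_) y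
  · rintro y ⟨s, hs⟩
    have : S y = s := hS ⟨(y, s), hs⟩
    rw [this, hs]
  · exact CStarModule.continuous_inner.comp (continuous_const.prodMk continuous_id)
  · have hcS : Continuous S := AddMonoidHomClass.continuous_of_bound S C hSC
    exact CStarModule.continuous_inner.comp (continuous_const.prodMk hcS)

/-! #### Compact operators -/

/-- The functional `z ↦ ⟪x, z⟫`. -/
def innerLin (x : X) : X →ₗ[B] B where
  toFun z := inner B x z
  map_add' _ _ := CStarModule.inner_add_right
  map_smul' _ _ := CStarModule.inner_op_smul_right

/-- The finite rank operator `z ↦ ∑ ⟪x i, z⟫ • y i`. -/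
def finRankOp {n : ℕ} (x : Fin n → X) (y : Fin n → Y) : X →ₗ[B] Y :=
  Fintype.linearCombination B y ∘ₗ LinearMap.pi fun i => innerLin (x i)

theorem finRankOp_apply {n : ℕ} (x : Fin n → X) (y : Fin n → Y) (z : X) :
    finRankOp (B := B) x y z = ∑ i, (inner B (x i) z : B) • y i := rfl

theorem isAdjointPair_finRankOp {n : ℕ} (x : Fin n → X) (y : Fin n → Y) :
    IsAdjointPair (finRankOp (B := B) x y) (finRankOp y x) := fun z w => by
  simp only [finRankOp_apply, CStarModule.inner_sum_left, CStarModule.inner_sum_right,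
    CStarModule.inner_op_smul_left, CStarModule.inner_op_smul_right, CStarModule.star_inner]

theorem norm_finRankOp_le {n : ℕ} (x : Fin n → X) (y : Fin n → Y) (z : X) :
    ‖finRankOp (B := B) x y z‖ ≤ (∑ i, ‖x i‖ * ‖y i‖) * ‖z‖ := by
  rw [finRankOp_apply, Finset.sum_mul]
  refine (norm_sum_le _ _).trans (Finset.sum_le_sum fun i _ => ?_)
  calc ‖(inner B (x i) z : B) • y i‖ ≤ ‖(inner B (x i) z : B)‖ * ‖y i‖ := norm_smul_le' _ _
    _ ≤ (‖x i‖ * ‖z‖) * ‖y i‖ := by gcongr; exact CStarModule.norm_inner_le X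
    _ = _ := by ring

theorem comp_finRankOp (T : Y →ₗ[B] Z) {n : ℕ} (x : Fin n → X) (y : Fin n → Y) (z : X) :
    T (finRankOp (B := B) x y z) = finRankOp (B := B) x (fun i => T (y i)) z := by
  simp [finRankOp_apply]

theorem finRankOp_comp {T : X →ₗ[B] Y} {S : Y →ₗ[B] X} (h : IsAdjointPair T S) {n : ℕ}
    (x : Fin n → Y) (y : Fin n → Z) (z : X) :
    finRankOp (B := B) x y (T z) = finRankOp (B := B) (fun i => S (x i)) y z := by
  simp [finRankOp_apply, h.symm _ _]

theorem isCompactOp_iff {T : X →ₗ[B] Y} : IsCompactOp T ↔ ∀ ε : ℝ, 0 < ε →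
    ∃ (n : ℕ) (x : Fin n → X) (y : Fin n → Y), ∀ z, ‖T z - finRankOp (B := B) x y z‖ ≤ ε * ‖z‖ :=
  Iff.rfl

namespace IsCompactOp

theorem exists_bound {T : X →ₗ[B] Y} (h : IsCompactOp T) :
    ∃ C, 0 < C ∧ ∀ x, ‖T x‖ ≤ C * ‖x‖ := by
  obtain ⟨n, x, y, hxy⟩ := isCompactOp_iff.mp h 1 one_pos
  refine ⟨1 + ∑ i, ‖x i‖ * ‖y i‖, by positivity, fun z => ?_⟩
  calc ‖T z‖ = ‖(T z - finRankOp (B := B) x y z) + finRankOp (B := B) x y z‖ := by simp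
    _ ≤ 1 * ‖z‖ + (∑ i, ‖x i‖ * ‖y i‖) * ‖z‖ :=
      (norm_add_le _ _).trans (add_le_add (hxy z) (norm_finRankOp_le x y z))
    _ = _ := by ring

/-- The adjoints of finite rank approximants satisfy the same norm estimates, so they form a Cauchy
sequence at every vector, and the limit is the adjoint. -/
theorem isAdjointable [CompleteSpace X] {T : X →ₗ[B] Y} (h : IsCompactOp T) :
    IsAdjointable T := by
  obtain ⟨C, hC0, hC⟩ := h.exists_bound
  refine .of_dense T hC0.le hC ?_
  convert dense_univ
  refine eq_univ_of_forall fun w => ?_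
  have hε : ∀ k : ℕ, 0 < 1 / ((k : ℝ) + 1) := fun k => Nat.one_div_pos_of_nat
  choose n x y hxy using fun k : ℕ => isCompactOp_iff.mp h _ (hε k)
  let s : ℕ → X := fun k => finRankOp (B := B) (y k) (x k) w
  have hs : ∀ k l, ‖s k - s l‖ ≤ (1 / ((k : ℝ) + 1) + 1 / ((l : ℝ) + 1)) * ‖w‖ := fun k l => by
    refine ((isAdjointPair_finRankOp (x k) (y k)).sub
      (isAdjointPair_finRankOp (x l) (y l))).bound (add_pos (hε k) (hε l)).le (fun z => ?_) w
    have h1 := hxy k z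
    have h2 := hxy l z
    rw [← norm_neg, neg_sub] at h1
    rw [LinearMap.sub_apply, add_mul]
    calc _ = ‖(finRankOp (B := B) (x k) (y k) z - T z) +
          (T z - finRankOp (B := B) (x l) (y l) z)‖ := by
          rw [sub_add_sub_cancel]
      _ ≤ _ := (norm_add_le _ _).trans (add_le_add h1 h2)
  have ht := tendsto_one_div_add_atTop_nhds_zero_nat (𝕜 := ℝ)
  have hcau : CauchySeq s := by
    refine cauchySeq_of_le_tendsto_0' (fun k : ℕ => (2 * (1 / ((k : ℝ) + 1))) * ‖w‖)
      (fun k l hkl => ?_) ?_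
    · rw [dist_eq_norm]
      refine (hs k l).trans ?_
      rw [two_mul]
      gcongr
    · simpa using (ht.const_mul 2).mul_const ‖w‖
  obtain ⟨s₀, hs₀⟩ := cauchySeq_tendsto_of_complete hcau
  refine ⟨s₀, fun z => ?_⟩
  have h1 : Filter.Tendsto (fun k => finRankOp (B := B) (x k) (y k) z) Filter.atTop (𝓝 (T z)) := by
    rw [tendsto_iff_norm_sub_tendsto_zero]
    refine squeeze_zero (fun _ => norm_nonneg _) (fun k => ?_)
      (by simpa using ht.mul_const ‖z‖)
    rw [← norm_neg, neg_sub]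
    simpa only [one_div] using hxy k z
  have h2 := (CStarModule.continuous_inner (A := B) (E := Y)).tendsto (T z, w) |>.comp
    (h1.prodMk_nhds tendsto_const_nhds)
  have h3 := (CStarModule.continuous_inner (A := B) (E := X)).tendsto (z, s₀) |>.comp
    ((tendsto_const_nhds (x := z)).prodMk_nhds hs₀)
  refine tendsto_nhds_unique h2 (h3.congr fun k => ?_)
  exact ((isAdjointPair_finRankOp (x k) (y k)) z w).symm

/-- On the left a bounded `T` is enough: it only moves the vectors `y i` of a finite rank
approximant. -/
theorem comp_left {K : X →ₗ[B] Y} (h : IsCompactOp K) (T : Y →ₗ[B] Z)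
    (hT : ∃ C, 0 < C ∧ ∀ x, ‖T x‖ ≤ C * ‖x‖) : IsCompactOp (T ∘ₗ K) := by
  obtain ⟨C, hC0, hC⟩ := hT
  refine isCompactOp_iff.mpr fun ε hε => ?_
  obtain ⟨n, x, y, hxy⟩ := isCompactOp_iff.mp h (ε / C) (by positivity)
  refine ⟨n, x, fun i => T (y i), fun z => ?_⟩
  rw [← comp_finRankOp, LinearMap.comp_apply, ← map_sub]
  refine (hC _).trans ?_
  calc _ ≤ C * (ε / C * ‖z‖) := by gcongr; exact hxy z
    _ = _ := by field_simp

/-- On the right `T` must be adjointable, in order to rewrite `⟪x i, T z⟫` as `⟪T* (x i), z⟫`. -/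
theorem comp_right [CompleteSpace X] [CompleteSpace Y] {K : Y →ₗ[B] Z} (h : IsCompactOp K)
    {T : X →ₗ[B] Y} (hT : IsAdjointable T) : IsCompactOp (K ∘ₗ T) := by
  obtain ⟨C, hC0, hC⟩ := hT.exists_bound
  obtain ⟨S, hS⟩ := hT
  refine isCompactOp_iff.mpr fun ε hε => ?_
  obtain ⟨n, x, y, hxy⟩ := isCompactOp_iff.mp h (ε / C) (by positivity)
  refine ⟨n, fun i => S (x i), y, fun z => ?_⟩
  rw [← finRankOp_comp hS, LinearMap.comp_apply]
  refine (hxy _).trans ?_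
  calc _ ≤ ε / C * (C * ‖z‖) := by gcongr; exact hC z
    _ = _ := by field_simp

theorem add {K L : X →ₗ[B] Y} (hK : IsCompactOp K) (hL : IsCompactOp L) :
    IsCompactOp (K + L) := by
  refine isCompactOp_iff.mpr fun ε hε => ?_
  obtain ⟨n, x, y, hxy⟩ := isCompactOp_iff.mp hK (ε / 2) (by positivity)
  obtain ⟨m, x', y', hxy'⟩ := isCompactOp_iff.mp hL (ε / 2) (by positivity)
  refine ⟨n + m, Fin.append x x', Fin.append y y', fun z => ?_⟩
  have : finRankOp (B := B) (Fin.append x x') (Fin.append y y') z =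
      finRankOp (B := B) x y z + finRankOp (B := B) x' y' z := by
    simp [finRankOp_apply, Fin.sum_univ_add]
  rw [this, LinearMap.add_apply, add_sub_add_comm]
  refine (norm_add_le _ _).trans ((add_le_add (hxy z) (hxy' z)).trans_eq (by ring))

theorem neg {K : X →ₗ[B] Y} (hK : IsCompactOp K) : IsCompactOp (-K) := by
  have := hK.comp_left (-LinearMap.id : Y →ₗ[B] Y) ⟨1, one_pos, fun x => by simp⟩
  simpa using this

theorem sub {K L : X →ₗ[B] Y} (hK : IsCompactOp K) (hL : IsCompactOp L) :
    IsCompactOp (K - L) := by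
  rw [sub_eq_add_neg]
  exact hK.add hL.neg

end IsCompactOp

/-! #### Idempotents -/

/-- Since `⟪x, t T* T x⟫ = t ⟪T x, T x⟫` is positive, `⟪x, x⟫ ≤ ⟪x, x + t T* T x⟫`. The bound is
uniform in `t`, as the method of continuity requires. -/
theorem norm_le_norm_add_smul {T : X →ₗ[B] Y} {S : Y →ₗ[B] X} (h : IsAdjointPair T S) {t : ℝ}
    (ht : 0 ≤ t) (x : X) : ‖x‖ ≤ ‖x + t • S (T x)‖ := by
  rcases (norm_nonneg x).eq_or_lt with h0 | h0
  · rw [← h0]; positivity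
  · have h1 : (inner B x x : B) ≤ inner B x (x + t • S (T x)) := by
      rw [CStarModule.inner_add_right, CStarModule.inner_smul_right_real, ← h]
      exact le_add_of_nonneg_right (smul_nonneg ht CStarModule.inner_self_nonneg)
    have h2 : ‖x‖ * ‖x‖ ≤ ‖x‖ * ‖x + t • S (T x)‖ := by
      rw [← sq, CStarModule.norm_sq_eq B]
      exact (CStarAlgebra.norm_le_norm_of_nonneg_of_le CStarModule.inner_self_nonneg h1).trans
        (CStarModule.norm_inner_le X)
    exact le_of_mul_le_mul_left h2 h0

/-- Method of continuity along `1 + t T* T` from `t = 0` to `t = 1`. -/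
theorem bijective_id_add [CompleteSpace X] [CompleteSpace Y] {T : X →ₗ[B] Y} {S : Y →ₗ[B] X}
    (h : IsAdjointPair T S) : Function.Bijective (LinearMap.id + S ∘ₗ T : X →ₗ[B] X) := by
  obtain ⟨C, hC0, hC⟩ := (h.symm.comp h).exists_bound
  -- With `C` a bound for `T* T` and steps of length `1 / m`, each step is a perturbation of
  -- relative size at most `1 / 2`, because the inverses met on the way have norm at most `1`.
  obtain ⟨m, hm⟩ := exists_nat_gt (2 * C)
  have hm0 : (0 : ℝ) < m := by linarith
  let L : ℝ → X →ₗ[B] X := fun t =>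
    { toFun := fun x => x + t • S (T x)
      map_add' := fun x y => by simp only [map_add, smul_add]; abel
      map_smul' := fun b x => by
        simp only [map_smul, smul_add, RingHom.id_apply, add_right_inj]
        exact smul_comm (t : ℂ) b (S (T x)) }
  have hL : ∀ t x, L t x = x + t • S (T x) := fun t x => rfl
  suffices H : ∀ k : ℕ, Function.Bijective (L (k / m)) by
    convert H m using 2
    rw [div_self hm0.ne']
    ext x
    simp [hL]
  intro k
  induction k with
  | zero =>
    convert Function.bijective_id (α := X) using 1
    ext x
    simp [hL]
  | succ k ih =>
    let e : X ≃ₗ[B] X := LinearEquiv.ofBijective _ ih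
    have he : ∀ x, e x = L (k / m) x := fun x => rfl
    have h1 : Function.Bijective (L ((k + 1 : ℕ) / m) ∘ₗ (e.symm : X →ₗ[B] X)) := by
      refine bijective_of_norm_sub_le _ (c := 1 / 2) (by norm_num) fun x => ?_
      obtain ⟨x, rfl⟩ := e.surjective x
      simp only [LinearMap.comp_apply, LinearEquiv.coe_coe, LinearEquiv.symm_apply_apply]
      have h2 : e x - L ((k + 1 : ℕ) / m) x = -((1 / m : ℝ) • S (T x)) := by
        rw [he, hL, hL, add_sub_add_left_eq_sub, ← sub_smul, ← neg_smul]
        congr 1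
        push_cast
        ring
      rw [h2, norm_neg, norm_smul]
      calc ‖(1 / m : ℝ)‖ * ‖S (T x)‖ ≤ (1 / m) * (C * ‖x‖) := by
            rw [Real.norm_of_nonneg (by positivity)]
            gcongr
            exact hC x
        _ ≤ 1 / 2 * ‖x‖ := by
            rw [← mul_assoc]
            gcongr
            rw [one_div, inv_mul_le_iff₀ hm0]
            linarith
        _ ≤ _ := by
            gcongr
            rw [he, hL]
            exact norm_le_norm_add_smul h (by positivity) x
    have h3 := h1.comp e.bijective
    convert h3 using 1
    ext x
    simp

/-- An adjointable idempotent and its adjoint have isomorphic ranges. -/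
theorem nonempty_range_equiv_range_adjoint [CompleteSpace X] {e e' : X →ₗ[B] X}
    (h : IsAdjointPair e e') (he : e ∘ₗ e = e) :
    Nonempty (LinearMap.range e' ≃ₗ[B] LinearMap.range e) := by
  have he' : e' ∘ₗ e' = e' := (h.comp h).adjoint_unique (by rwa [he])
  have h1 : ∀ x, e (e x) = e x := LinearMap.congr_fun he
  have h2 : ∀ x, e' (e' x) = e' x := LinearMap.congr_fun he'
  -- This element intertwines the idempotents, `s e' = e e' = e s`, and its square `1 + (e' - e)*
  -- (e' - e)` is invertible.
  let s : X →ₗ[B] X := e + e' - LinearMap.id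
  have hs2 : s ∘ₗ s = LinearMap.id + (e - e') ∘ₗ (e' - e) := by
    ext x
    simp [s, h1, h2]
    abel
  have hb : Function.Bijective (s ∘ₗ s) := hs2 ▸ bijective_id_add (h.symm.sub h)
  have hs : Function.Bijective s :=
    ⟨hb.1.of_comp (f := s) (g := s), hb.2.of_comp (f := s) (g := s)⟩
  let σ : X ≃ₗ[B] X := LinearEquiv.ofBijective s hs
  refine ⟨LinearEquiv.ofSubmodules σ _ _ ?_⟩
  have h3 : s ∘ₗ e' = e ∘ₗ s := by
    ext x
    simp [s, h1, h2]
  have h4 : (σ : X →ₗ[B] X) = s := rfl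
  rw [h4, ← LinearMap.range_comp, h3, LinearMap.range_comp, LinearMap.range_eq_top.mpr hs.2,
    Submodule.map_top]

end Operators

/-! ### The index of a Fredholm operator -/

section Algebra

variable {B : Type u} [Ring B] {A : Type*} [AddCommGroup A] [Module B A]
  {C : Type*} [AddCommGroup C] [Module B C]
  {N : Type*} [AddCommGroup N] [Module B N] [Module.Finite B N] [Module.Projective B N]
  {N' : Type*} [AddCommGroup N'] [Module B N'] [Module.Finite B N'] [Module.Projective B N']

/-- A map that is invertible up to maps that factor through finitely generated projective modules
is stably invertible. -/
theorem exists_hasIndexWith {T : A →ₗ[B] C} {S : C →ₗ[B] A} (α : C →ₗ[B] N) (β : N →ₗ[B] C)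
    (hr : ∀ y, T (S y) + β (α y) = y) {S' : C →ₗ[B] A} (α' : A →ₗ[B] N') (β' : N' →ₗ[B] A)
    (hl : ∀ x, S' (T x) + β' (α' x) = x) : ∃ k, HasIndexWith T S k := by
  -- The row `(T, β)` is onto with section `(S, α)`, so `A ⊕ N ≅ C ⊕ ker ρ`; the left parametrix is
  -- needed to see that the kernel is finitely generated projective.
  let ρ : (A × N) →ₗ[B] C := T.coprod β
  let γ : C →ₗ[B] A × N := S.prod α
  have hργ : ∀ y, ρ (γ y) = y := hr
  let π : (A × N) →ₗ[B] LinearMap.ker ρ :=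
    LinearMap.codRestrict _ (LinearMap.id - γ ∘ₗ ρ) fun x => by simp [hργ]
  have hπ : ∀ x : LinearMap.ker ρ, π x = x := fun x => Subtype.ext (by
    have hx : ρ x = 0 := x.2
    simp [π, hx])
  -- An element `(a, n)` of the kernel is recovered from `(α' a, n)`: as `T a = -β n`, the left
  -- parametrix gives `a = β' (α' a) - S' (β n)`.
  let i : LinearMap.ker ρ →ₗ[B] N' × N := (α'.prodMap LinearMap.id) ∘ₗ Submodule.subtype _
  let r : (N' × N) →ₗ[B] LinearMap.ker ρ :=
    π ∘ₗ ((β' ∘ₗ LinearMap.fst B _ _ - S' ∘ₗ β ∘ₗ LinearMap.snd B _ _).prod (LinearMap.snd B _ _))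
  have hri : r ∘ₗ i = LinearMap.id := by
    refine LinearMap.ext fun x => ?_
    obtain ⟨⟨a, n⟩, hx⟩ := x
    have hx' : T a + β n = 0 := hx
    have h1 : β' (α' a) - S' (β n) = a := by
      rw [← eq_neg_iff_add_eq_zero] at hx'
      have := hl a
      rw [hx', map_neg] at this
      rw [sub_eq_neg_add, this]
    change π (β' (α' a) - S' (β n), n) = _
    rw [h1]
    exact hπ ⟨(a, n), hx⟩
  have := Module.Finite.of_surjective r fun x => ⟨i x, LinearMap.congr_fun hri x⟩
  have := Module.Projective.of_split i r hri
  let Ψ : (A × N) ≃ₗ[B] C × LinearMap.ker ρ := LinearEquiv.ofLinearMap (ρ.prod π)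
    (γ.coprod (Submodule.subtype _))
    (LinearMap.ext fun ⟨y, z⟩ => by
      have hz : ρ z = 0 := z.2
      refine Prod.ext ?_ ?_
      · simp [hργ, hz]
      · have h0 : π (γ y) = 0 := Subtype.ext (by simp [π, hργ])
        simp [h0, hπ])
    (LinearMap.ext fun x => by simp [π])
  exact ⟨_, .of_equiv Ψ (fun x => by simp [Ψ, ρ]) fun y => by simp [Ψ, γ]⟩

end Algebra

section Fredholm

open scoped WithCStarModule

variable {B : Type u} [CStarAlgebra B] [PartialOrder B] [StarOrderedRing B]
variable {X : Type*} [NormedAddCommGroup X] [NormedSpace ℂ X] [Module B X] [CStarModule B X]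
variable {Y : Type*} [NormedAddCommGroup Y] [NormedSpace ℂ Y] [Module B Y] [CStarModule B Y]

/-- A finite rank correction brings `V` within `1 / 2` of the identity. The corrected adjoint is
equally close to the identity, hence also bijective, so the inverse is adjointable. -/
theorem exists_equiv_of_isCompactOp_id_sub [CompleteSpace X] {V : X →ₗ[B] X}
    (hV : IsAdjointable V) (hK : IsCompactOp (LinearMap.id - V)) :
    ∃ (n : ℕ) (x y : Fin n → X) (v v' : X ≃ₗ[B] X),
      IsAdjointPair (v : X →ₗ[B] X) (v' : X →ₗ[B] X) ∧
      ∀ z, v z = V z + finRankOp (B := B) x y z := by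
  obtain ⟨V', hV'⟩ := hV
  obtain ⟨n, x, y, hxy⟩ := isCompactOp_iff.mp hK (1 / 2) (by norm_num)
  have hadj := hV'.add (isAdjointPair_finRankOp x y)
  have h1 : ∀ z, ‖(LinearMap.id - (V + finRankOp (B := B) x y) : X →ₗ[B] X) z‖ ≤
      1 / 2 * ‖z‖ := fun z => by
    rw [← sub_sub]
    exact hxy z
  have hb := bijective_of_norm_sub_le (V + finRankOp (B := B) x y) (c := 1 / 2) (by norm_num) h1
  have hb' := bijective_of_norm_sub_le (V' + finRankOp (B := B) y x) (c := 1 / 2) (by norm_num)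
    ((IsAdjointPair.id.sub hadj).bound (by norm_num) h1)
  exact ⟨n, x, y, LinearEquiv.ofBijective _ hb, LinearEquiv.ofBijective _ hb', hadj, fun z => rfl⟩

variable {T : X →ₗ[B] Y}

/-- If `T S + F = v` is invertible with `F` of finite rank, then `T (S v⁻¹) + F v⁻¹ = 1`. The
operator `F v⁻¹` has finite rank because `v⁻¹` is adjointable. -/
theorem IsFredholm.exists_right_inverse [CompleteSpace X] [CompleteSpace Y] (hT : IsFredholm T) :
    ∃ (n : ℕ) (x y : Fin n → Y) (S : Y →ₗ[B] X), IsAdjointable S ∧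
      ∀ z, T (S z) + finRankOp (B := B) x y z = z := by
  obtain ⟨hTa, -, S, hS, hK⟩ := hT
  obtain ⟨n, x, y, v, v', hvv', hv⟩ := exists_equiv_of_isCompactOp_id_sub (hTa.comp hS) hK
  refine ⟨n, fun i => v'.symm (x i), y, S ∘ₗ v.symm, hS.comp ⟨_, hvv'.inverse⟩, fun z => ?_⟩
  obtain ⟨z, rfl⟩ := v.surjective z
  have := finRankOp_comp hvv' (fun i => v'.symm (x i)) y z
  simp only [LinearEquiv.coe_coe, LinearEquiv.apply_symm_apply] at this
  rw [this, LinearMap.comp_apply, LinearEquiv.coe_coe, LinearEquiv.symm_apply_apply]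
  exact (hv z).symm

theorem IsFredholm.exists_left_inverse [CompleteSpace X] [CompleteSpace Y] (hT : IsFredholm T) :
    ∃ (n : ℕ) (x y : Fin n → X) (S : Y →ₗ[B] X),
      ∀ z, S (T z) + finRankOp (B := B) x y z = z := by
  obtain ⟨hTa, ⟨S, hS, hK⟩, -⟩ := hT
  obtain ⟨n, x, y, v, v', hvv', hv⟩ := exists_equiv_of_isCompactOp_id_sub (hS.comp hTa) hK
  refine ⟨n, x, fun i => v.symm (y i), (v.symm : X →ₗ[B] X) ∘ₗ S, fun z => ?_⟩
  have := comp_finRankOp (v.symm : X →ₗ[B] X) x y z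
  simp only [LinearEquiv.coe_coe] at this
  rw [← this, LinearMap.comp_apply, LinearEquiv.coe_coe, ← map_add, LinearEquiv.symm_apply_eq, hv]
  rfl

namespace Stab

variable (B X) in
/-- `X ⊕ Bⁿ` without its Hilbert module structure. -/
def linearEquiv (n : ℕ) : Stab B X n ≃ₗ[B] X × (Fin n → B) :=
  (WithCStarModule.linearEquiv B B _).trans
    ((LinearEquiv.refl B X).prodCongr (WithCStarModule.linearEquiv B B _))

variable {n : ℕ}

/-- On `B` as a left Hilbert module `⟪a, b⟫ = b * star a`, which accounts for the order of the
factors. -/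
theorem inner_def (p q : Stab B X n) : (inner B p q : B) =
    inner B (linearEquiv B X n p).1 (linearEquiv B X n q).1 +
      ∑ i, (linearEquiv B X n q).2 i * star ((linearEquiv B X n p).2 i) := rfl

variable (x' : Fin n → X)

/-- The row `(x, b) ↦ V x + ∑ b i • y i`. -/
def row (V : X →ₗ[B] Y) (y : Fin n → Y) : Stab B X n →ₗ[B] Y :=
  V.coprod (Fintype.linearCombination B y) ∘ₗ (linearEquiv B X n : Stab B X n →ₗ[B] _)

/-- The column `z ↦ (V z, (⟪y i, z⟫))`. -/
def col (V : Y →ₗ[B] X) (y : Fin n → Y) : Y →ₗ[B] Stab B X n :=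
  ((linearEquiv B X n).symm : _ →ₗ[B] Stab B X n) ∘ₗ
    V.prod (LinearMap.pi fun i => innerLin (y i))

theorem isAdjointPair_row_col {V : X →ₗ[B] Y} {V' : Y →ₗ[B] X} (h : IsAdjointPair V V')
    (y : Fin n → Y) : IsAdjointPair (row V y) (col V' y) := fun p z => by
  rw [inner_def]
  simp [row, col, innerLin, Fintype.linearCombination_apply, CStarModule.inner_sum_left, h _ z]

end Stab

/-- The row `(T, y) : X ⊕ Bⁿ → Y` has the adjointable section `(S, x)`. Followed by the inclusion of
`Y` in `Y ⊕ Bⁿ` it becomes the extension, and the section preceded by the projection onto `Y` is its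
pseudo-inverse. -/
theorem IsFredholm.exists_isRegularExtension [CompleteSpace X] [CompleteSpace Y]
    (hT : IsFredholm T) : ∃ (n : ℕ)
      (p : (Stab B X n →ₗ[B] Stab B Y n) × (Stab B Y n →ₗ[B] Stab B X n)),
      IsRegularExtension T n p.1 p.2 := by
  obtain ⟨n, x, y, S, ⟨S', hS⟩, hTS⟩ := hT.exists_right_inverse
  obtain ⟨T', hT'⟩ := hT.1
  let inl : Y →ₗ[B] Stab B Y n := Stab.col LinearMap.id 0
  let fst : Stab B Y n →ₗ[B] Y := Stab.row LinearMap.id 0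
  have hif : IsAdjointPair inl fst := (Stab.isAdjointPair_row_col .id 0).symm
  have hfi : ∀ z, fst (inl z) = z := fun z => by
    simp [fst, inl, Stab.row, Stab.col, Fintype.linearCombination_apply]
  have hrc : ∀ z, Stab.row T y (Stab.col S x z) = z := fun z => by
    refine Eq.trans ?_ (hTS z)
    simp [Stab.row, Stab.col, finRankOp]
  refine ⟨n, (inl ∘ₗ Stab.row T y, Stab.col T' y ∘ₗ fst),
    hif.comp (Stab.isAdjointPair_row_col hT' y), fun z => ?_,
    Stab.col S x ∘ₗ fst,
    ⟨_, (Stab.isAdjointPair_row_col hS.symm x).symm.comp hif.symm⟩, ?_, ?_⟩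
  · change (Stab.linearEquiv B Y n
      (inl (Stab.row T y ((Stab.linearEquiv B X n).symm (z, 0))))).1 = _
    simp [inl, Stab.row, Stab.col]
  · ext1 p
    simp [hfi, hrc]
  · ext1 p
    simp [hfi, hrc]

/-- The extension and `T ⊕ 1` have the same upper left corner, and their other entries differ by
maps that factor through `Bⁿ ⊕ Bⁿ`; such a change does not affect the index. -/
theorem IsRegularExtension.hasIndex {n : ℕ} {R : Stab B X n →ₗ[B] Stab B Y n}
    {R' : Stab B Y n →ₗ[B] Stab B X n} (h : IsRegularExtension T n R R') {k : K0 B}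
    (hk : HasIndex T k) : HasIndex R k := by
  let R₁ : (X × (Fin n → B)) →ₗ[B] Y × (Fin n → B) :=
    (Stab.linearEquiv B Y n : Stab B Y n →ₗ[B] _) ∘ₗ
    R ∘ₗ ((Stab.linearEquiv B X n).symm : _ →ₗ[B] Stab B X n)
  have hR₁ : ∀ x, (R₁ (x, 0)).1 = T x := h.corner
  suffices H : HasIndex R₁ k from
    H.congr (Stab.linearEquiv B X n).symm (Stab.linearEquiv B Y n).symm fun x => by simp [R₁]
  obtain ⟨S, hS⟩ := hk
  obtain ⟨S', hS'⟩ := HasIndex.id (B := B) (A := Fin n → B)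
  have h1 : HasIndex (T.prodMap (LinearMap.id : (Fin n → B) →ₗ[B] _)) (k + 0) := ⟨_, hS.prodMap hS'⟩
  rw [add_zero] at h1
  let α : (X × (Fin n → B)) →ₗ[B] (Fin n → B) × (Fin n → B) :=
    (LinearMap.snd B _ _ ∘ₗ R₁ ∘ₗ LinearMap.inl B _ _).prodMap LinearMap.id
  let β : ((Fin n → B) × (Fin n → B)) →ₗ[B] Y × (Fin n → B) :=
    (LinearMap.inr B _ _).coprod ((R₁ - T.prodMap LinearMap.id) ∘ₗ LinearMap.inr B _ _)
  convert h1.add_comp α β using 1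
  refine LinearMap.ext fun ⟨x, b⟩ => ?_
  have h2 : R₁ (x, b) = R₁ (x, 0) + R₁ (0, b) := by rw [← map_add]; simp
  have h3 : R₁ (x, 0) = (T x, 0) + (0, (R₁ (x, 0)).2) := Prod.ext (by simp [hR₁]) (by simp)
  simp only [α, β, LinearMap.add_apply, LinearMap.comp_apply, LinearMap.prodMap_apply,
    LinearMap.coprod_apply, LinearMap.inr_apply, LinearMap.inl_apply, LinearMap.snd_apply,
    LinearMap.sub_apply, LinearMap.id_apply, map_zero]
  rw [h2]
  nth_rw 1 [h3]
  have h4 : ((T x, b) : Y × (Fin n → B)) = (T x, 0) + (0, b) := by simp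
  rw [h4]
  abel

/-- The stable index is `[ker R] - [range (1 - R G)]`. The kernel of `R*` is the range of the
adjoint idempotent `1 - G* R*`, and an idempotent and its adjoint have isomorphic ranges. -/
theorem IsRegularExtension.cls_sub_cls [CompleteSpace X] [CompleteSpace Y] {n : ℕ}
    {R : Stab B X n →ₗ[B] Stab B Y n}
    {R' : Stab B Y n →ₗ[B] Stab B X n} (h : IsRegularExtension T n R R') {k : K0 B}
    (hk : HasIndex T k) : K0.cls B (LinearMap.ker R) - K0.cls B (LinearMap.ker R') = k := by
  have hR := h.hasIndex hk
  obtain ⟨G, ⟨G', hG⟩, hRGR, hGRG⟩ := h.pseudoInverse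
  rw [hR.eq_ker_sub_range hRGR hGRG]
  congr 1
  obtain ⟨_, _⟩ := hR.finite_projective_range hRGR
  have hadj := h.adjoint
  have he : IsAdjointPair (LinearMap.id - R ∘ₗ G) (LinearMap.id - G' ∘ₗ R') :=
    IsAdjointPair.id.sub (hadj.comp hG)
  have hR'G'R' : R' ∘ₗ G' ∘ₗ R' = R' := by
    have h1 := hadj.comp (hG.comp hadj)
    rw [hRGR] at h1
    exact h1.adjoint_unique hadj
  have hidem : (LinearMap.id - R ∘ₗ G) ∘ₗ (LinearMap.id - R ∘ₗ G) = LinearMap.id - R ∘ₗ G := by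
    ext1 x
    have := LinearMap.congr_fun hRGR (G x)
    simp only [LinearMap.comp_apply] at this
    simp [this]
  obtain ⟨f⟩ := nonempty_range_equiv_range_adjoint he hidem
  have hker : LinearMap.range (LinearMap.id - G' ∘ₗ R') = LinearMap.ker R' := by
    ext x
    constructor
    · rintro ⟨y, rfl⟩
      have := LinearMap.congr_fun hR'G'R' y
      simp only [LinearMap.comp_apply] at this
      simp [this]
    · intro hx
      have hx' : R' x = 0 := hx
      exact ⟨x, by simp [hx']⟩
  exact (K0.cls_congr (f.symm.trans (LinearEquiv.ofEq _ _ hker))).symm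

/-- The index of a Fredholm operator, computed by any stabilization. -/
theorem IsFredholm.exists_hasIndexWith [CompleteSpace X] [CompleteSpace Y] (hT : IsFredholm T) :
    ∃ S : Y →ₗ[B] X, IsAdjointable S ∧ HasIndexWith T S (index T) := by
  obtain ⟨n, x, y, S, hS, hTS⟩ := hT.exists_right_inverse
  obtain ⟨n', x', y', S', hST⟩ := hT.exists_left_inverse
  obtain ⟨k, hk⟩ := RelIndex.exists_hasIndexWith (LinearMap.pi fun i => innerLin (x i))
    (Fintype.linearCombination B y) hTS (LinearMap.pi fun i => innerLin (x' i))
    (Fintype.linearCombination B y') hST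
  have h : index T = k := by
    have h := hT.exists_isRegularExtension
    rw [index, dif_pos h]
    exact h.choose_spec.choose_spec.cls_sub_cls ⟨S, hk⟩
  exact ⟨S, hS, h ▸ hk⟩

end Fredholm

/-! ### Domains of regular operators -/

section Unbounded

variable {B : Type u} [CStarAlgebra B] [PartialOrder B] [StarOrderedRing B]
variable {X : Type*} [NormedAddCommGroup X] [NormedSpace ℂ X] [Module B X] [CStarModule B X]
variable {Y : Type*} [NormedAddCommGroup Y] [NormedSpace ℂ Y] [Module B Y] [CStarModule B Y]

namespace Dom

variable (T : X →ₗ.[B] Y)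

theorem inner_def (x y : Dom T) : (inner B x y : B) =
    inner B (incl T x) (incl T y) + inner B (op T x) (op T y) := rfl

theorem norm_incl_le (x : Dom T) : ‖incl T x‖ ≤ ‖x‖ := by
  refine le_of_sq_le_sq ?_ (norm_nonneg _)
  rw [CStarModule.norm_sq_eq B, CStarModule.norm_sq_eq B (x := x), inner_def]
  exact CStarAlgebra.norm_le_norm_of_nonneg_of_le CStarModule.inner_self_nonneg
    (le_add_of_nonneg_right CStarModule.inner_self_nonneg)

theorem norm_op_le (x : Dom T) : ‖op T x‖ ≤ ‖x‖ := by
  refine le_of_sq_le_sq ?_ (norm_nonneg _)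
  rw [CStarModule.norm_sq_eq B, CStarModule.norm_sq_eq B (x := x), inner_def]
  exact CStarAlgebra.norm_le_norm_of_nonneg_of_le CStarModule.inner_self_nonneg
    (le_add_of_nonneg_left CStarModule.inner_self_nonneg)

theorem norm_le (x : Dom T) : ‖x‖ ≤ ‖incl T x‖ + ‖op T x‖ := by
  refine le_of_sq_le_sq ?_ (by positivity)
  rw [CStarModule.norm_sq_eq B, inner_def]
  refine (norm_add_le _ _).trans ?_
  rw [← CStarModule.norm_sq_eq B, ← CStarModule.norm_sq_eq B]
  nlinarith [norm_nonneg (incl T x), norm_nonneg (op T x)]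

variable {T}

theorem mem_graph (x : Dom T) : (incl T x, op T x) ∈ T.graph :=
  T.mem_graph x

theorem exists_of_mem_graph {p : X × Y} (h : p ∈ T.graph) :
    ∃ x : Dom T, incl T x = p.1 ∧ op T x = p.2 := by
  obtain ⟨x, hx, hy⟩ := (LinearPMap.mem_graph_iff T).mp h
  exact ⟨x, hx, hy⟩

theorem tendsto_iff {ι : Type*} {l : Filter ι} {f : ι → Dom T} {x : Dom T} :
    Filter.Tendsto f l (𝓝 x) ↔ Filter.Tendsto (fun i => incl T (f i)) l (𝓝 (incl T x)) ∧
      Filter.Tendsto (fun i => op T (f i)) l (𝓝 (op T x)) := by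
  constructor
  · intro h
    exact ⟨((AddMonoidHomClass.continuous_of_bound (incl T) 1 fun x => by
      simpa using norm_incl_le T x).tendsto x).comp h,
      ((AddMonoidHomClass.continuous_of_bound (op T) 1 fun x => by
      simpa using norm_op_le T x).tendsto x).comp h⟩
  · rintro ⟨h1, h2⟩
    rw [tendsto_iff_norm_sub_tendsto_zero] at h1 h2 ⊢
    refine squeeze_zero (fun _ => norm_nonneg _) (fun i => norm_le T _) ?_
    simpa using h1.add h2

theorem completeSpace [CompleteSpace X] [CompleteSpace Y]
    (h : IsClosed (T.graph : Set (X × Y))) : CompleteSpace (Dom T) := by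
  refine Metric.complete_of_cauchySeq_tendsto fun s hs => ?_
  have h1 : CauchySeq fun n => incl T (s n) :=
    hs.map (AddMonoidHomClass.lipschitz_of_bound (incl T) 1 fun x => by
      simpa using norm_incl_le T x).uniformContinuous
  have h2 : CauchySeq fun n => op T (s n) :=
    hs.map (AddMonoidHomClass.lipschitz_of_bound (op T) 1 fun x => by
      simpa using norm_op_le T x).uniformContinuous
  obtain ⟨a, ha⟩ := cauchySeq_tendsto_of_complete h1
  obtain ⟨b, hb⟩ := cauchySeq_tendsto_of_complete h2
  have hab : (a, b) ∈ (T.graph : Set (X × Y)) :=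
    h.mem_of_tendsto (ha.prodMk_nhds hb) (.of_forall fun n => mem_graph (s n))
  obtain ⟨x, rfl, rfl⟩ := exists_of_mem_graph hab
  exact ⟨x, tendsto_iff.mpr ⟨ha, hb⟩⟩

variable [CompleteSpace X] [CompleteSpace Y]

/-- If `w = x + T* T x`, then `⟪u, w⟫` is the graph inner product of `u` with `x`. Thus the adjoint
is defined on the range of `1 + T* T`, which is dense by regularity. -/
theorem isAdjointable_incl (h : IsRegularOp T) : IsAdjointable (incl T) := by
  have := completeSpace h.closed
  refine .of_dense _ zero_le_one (fun x => by simpa using norm_incl_le T x)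
    (h.dense_range.mono ?_)
  rintro w ⟨x, z, hz, rfl⟩
  let x' : Dom T := x
  refine ⟨x', fun u => ?_⟩
  have h1 : (inner B (op T u) (op T x') : B) = inner B (incl T u) z := hz u
  rw [inner_def, h1, ← CStarModule.inner_add_right]
  rfl

/-- For `y` in the dense domain of `T*` the adjoint value is the adjoint of the inclusion applied to
`T* y`. -/
theorem isAdjointable_op (h : IsRegularOp T) : IsAdjointable (op T) := by
  have := completeSpace h.closed
  refine .of_dense _ zero_le_one (fun x => by simpa using norm_op_le T x)
    (h.dense_adjoint.mono ?_)
  rintro y ⟨z, hz⟩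
  obtain ⟨S, hS⟩ := isAdjointable_incl h
  exact ⟨S z, fun u => (hz u).trans (hS u z)⟩

/-- A pair of adjointable operators that intertwines two regular operators up to a compact operator
acts on the domains. -/
theorem exists_lift {X' : Type*} [NormedAddCommGroup X'] [NormedSpace ℂ X'] [Module B X']
    [CStarModule B X'] {Y' : Type*} [NormedAddCommGroup Y'] [NormedSpace ℂ Y'] [Module B Y']
    [CStarModule B Y'] {T' : X' →ₗ.[B] Y'} (h : IsRegularOp T) {P : X →ₗ[B] X'} {Q : Y →ₗ[B] Y'}
    (hP : IsAdjointable P) (hQ : IsAdjointable Q) {K : Dom T →ₗ[B] Y'} (hK : IsCompactOp K)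
    (hPQ : ∀ x : Dom T, (P (incl T x), Q (op T x) + K x) ∈ T'.graph) :
    ∃ S : Dom T →ₗ[B] Dom T', IsAdjointable S ∧ incl T' ∘ₗ S = P ∘ₗ incl T ∧
      op T' ∘ₗ S - Q ∘ₗ op T = K := by
  have := completeSpace h.closed
  choose s hs1 hs2 using fun x => exists_of_mem_graph (hPQ x)
  let S : Dom T →ₗ[B] Dom T' :=
    { toFun := s
      map_add' := fun x y => incl_injective T' (by simp [hs1])
      map_smul' := fun b x => incl_injective T' (by simp [hs1]) }
  have h1 : incl T' ∘ₗ S = P ∘ₗ incl T := LinearMap.ext hs1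
  have h2 : op T' ∘ₗ S - Q ∘ₗ op T = K := LinearMap.ext fun x => by
    change op T' (s x) - Q (op T x) = K x
    rw [hs2]
    simp
  refine ⟨S, ?_, h1, h2⟩
  obtain ⟨P', hP'⟩ := hP
  obtain ⟨Q', hQ'⟩ := hQ
  obtain ⟨K', hK'⟩ := hK.isAdjointable
  obtain ⟨i, hi⟩ := isAdjointable_incl h
  obtain ⟨o, ho⟩ := isAdjointable_op h
  -- The adjoint is read off from the graph inner product `⟪P x, y⟫ + ⟪Q T x + K x, T' y⟫`, where
  -- `i` and `o` are the adjoints of the inclusion and of `T` on the domain.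
  refine ⟨(i ∘ₗ P') ∘ₗ incl T' + ((o ∘ₗ Q') + K') ∘ₗ op T', fun x y => ?_⟩
  have e1 : incl T' (S x) = P (incl T x) := hs1 x
  have e2 : op T' (S x) = Q (op T x) + K x := hs2 x
  rw [inner_def, e1, e2]
  simp [hP' _ _, hQ' _ _, hK' _ _, hi _ _, ho _ _]

end Dom

end Unbounded

/-! ### Cutting and pasting of Fredholm operators -/

section Approximation

variable {B : Type u} [CStarAlgebra B]
variable {A : Type*} [NormedAddCommGroup A] [Module B A]
variable {C : Type*} [NormedAddCommGroup C] [Module B C]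
variable {A' : Type*} [NormedAddCommGroup A'] [Module B A']
variable {C' : Type*} [NormedAddCommGroup C'] [Module B C']

/-- `K` is a norm limit of maps that factor through some `Bⁿ`. -/
def IsApproxFinite (K : A →ₗ[B] C) : Prop :=
  ∀ ε : ℝ, 0 < ε → ∃ (n : ℕ) (α : A →ₗ[B] (Fin n → B)) (β : (Fin n → B) →ₗ[B] C),
    ∀ x, ‖K x - β (α x)‖ ≤ ε * ‖x‖

namespace IsApproxFinite

theorem comp_left {K : A →ₗ[B] C} (h : IsApproxFinite K) (g : C →ₗ[B] C') {M : ℝ} (hM : 0 < M)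
    (hg : ∀ y, ‖g y‖ ≤ M * ‖y‖) : IsApproxFinite (g ∘ₗ K) := fun ε hε => by
  obtain ⟨n, α, β, hαβ⟩ := h (ε / M) (by positivity)
  refine ⟨n, α, g ∘ₗ β, fun x => ?_⟩
  rw [LinearMap.comp_apply, LinearMap.comp_apply, ← map_sub]
  refine (hg _).trans ?_
  calc _ ≤ M * (ε / M * ‖x‖) := by gcongr; exact hαβ x
    _ = _ := by field_simp

theorem comp_right {K : A →ₗ[B] C} (h : IsApproxFinite K) (f : A' →ₗ[B] A)
    (hf : ∀ x, ‖f x‖ ≤ ‖x‖) : IsApproxFinite (K ∘ₗ f) := fun ε hε => by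
  obtain ⟨n, α, β, hαβ⟩ := h ε hε
  refine ⟨n, α ∘ₗ f, β, fun x => (hαβ (f x)).trans ?_⟩
  gcongr
  exact hf x

theorem add {K L : A →ₗ[B] C} (hK : IsApproxFinite K) (hL : IsApproxFinite L) :
    IsApproxFinite (K + L) := fun ε hε => by
  obtain ⟨n, α, β, h⟩ := hK (ε / 2) (by positivity)
  obtain ⟨m, α', β', h'⟩ := hL (ε / 2) (by positivity)
  let e : ((Fin n → B) × (Fin m → B)) ≃ₗ[B] (Fin (n + m) → B) :=
    (LinearEquiv.sumArrowLequivProdArrow (Fin n) (Fin m) B B).symm.trans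
      (LinearEquiv.funCongrLeft B B finSumFinEquiv.symm)
  refine ⟨n + m, e.toLinearMap ∘ₗ α.prod α', β.coprod β' ∘ₗ e.symm.toLinearMap, fun x => ?_⟩
  have : (β.coprod β' ∘ₗ e.symm.toLinearMap) ((e.toLinearMap ∘ₗ α.prod α') x) =
      β (α x) + β' (α' x) := by simp
  rw [this, LinearMap.add_apply, add_sub_add_comm]
  exact (norm_add_le _ _).trans ((add_le_add (h x) (h' x)).trans_eq (by ring))

end IsApproxFinite

/-- Split `K` into a part small compared with `1 / ‖S‖`, absorbed by a Neumann series, and a part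
through `Bⁿ`, absorbed by stabilization. No inner product is involved, so products with the sup norm
are allowed. -/
theorem HasIndexWith.add_isApproxFinite [NormedSpace ℂ A] [IsScalarTower ℂ B A] [CompleteSpace A]
    {T : A →ₗ[B] C} {S : C →ₗ[B] A} {k : K0 B} (h : HasIndexWith T S k) {M : ℝ} (hM : 0 < M)
    (hS : ∀ y, ‖S y‖ ≤ M * ‖y‖) {K : A →ₗ[B] C} (hK : IsApproxFinite K) :
    HasIndex (T + K) k := by
  obtain ⟨n, α, β, hαβ⟩ := hK (1 / (2 * M)) (by positivity)
  have h1 : HasIndex (T + (K - β ∘ₗ α)) k := by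
    refine h.add_of_bijective _ ?_
    have := bijective_of_norm_sub_le (LinearMap.id + S ∘ₗ (K - β ∘ₗ α)) (c := 1 / 2) (by norm_num)
      fun x => by
        have h2 : x - (LinearMap.id + S ∘ₗ (K - β ∘ₗ α) : A →ₗ[B] A) x =
            -(S (K x - β (α x))) := by simp
        rw [h2, norm_neg]
        refine (hS _).trans ?_
        calc _ ≤ M * (1 / (2 * M) * ‖x‖) := by gcongr; exact hαβ x
          _ = _ := by field_simp
    exact this
  have h2 := h1.add_comp α β
  rwa [add_assoc, sub_add_cancel] at h2

end Approximation

section CutAndPaste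

variable {B : Type u} [CStarAlgebra B] [PartialOrder B] [StarOrderedRing B]
variable {X₀ : Type*} [NormedAddCommGroup X₀] [NormedSpace ℂ X₀] [Module B X₀] [CStarModule B X₀]
variable {X₁ : Type*} [NormedAddCommGroup X₁] [NormedSpace ℂ X₁] [Module B X₁] [CStarModule B X₁]
variable {Y₀ : Type*} [NormedAddCommGroup Y₀] [NormedSpace ℂ Y₀] [Module B Y₀] [CStarModule B Y₀]
variable {Y₁ : Type*} [NormedAddCommGroup Y₁] [NormedSpace ℂ Y₁] [Module B Y₁] [CStarModule B Y₁]
variable {Z₀ : Type*} [NormedAddCommGroup Z₀] [NormedSpace ℂ Z₀] [Module B Z₀] [CStarModule B Z₀]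
variable {Z₁ : Type*} [NormedAddCommGroup Z₁] [NormedSpace ℂ Z₁] [Module B Z₁] [CStarModule B Z₁]
variable {W₀ : Type*} [NormedAddCommGroup W₀] [NormedSpace ℂ W₀] [Module B W₀] [CStarModule B W₀]
variable {W₁ : Type*} [NormedAddCommGroup W₁] [NormedSpace ℂ W₁] [Module B W₁] [CStarModule B W₁]
variable [CompleteSpace X₀] [CompleteSpace X₁] [CompleteSpace Y₀] [CompleteSpace Y₁]
  [CompleteSpace Z₀] [CompleteSpace Z₁] [CompleteSpace W₀] [CompleteSpace W₁]

theorem IsCompactOp.isApproxFinite {K : X₀ →ₗ[B] Y₀} (h : IsCompactOp K) : IsApproxFinite K :=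
  fun ε hε => by
    obtain ⟨n, x, y, hxy⟩ := isCompactOp_iff.mp h ε hε
    exact ⟨n, LinearMap.pi fun i => innerLin (x i), Fintype.linearCombination B y, hxy⟩

/-- An operator that is, up to compact operators, a direct summand of the sum of two Fredholm
operators is a Fredholm operator. -/
theorem IsFredholm.of_summand {T₀ : X₀ →ₗ[B] Y₀} {T₁ : X₁ →ₗ[B] Y₁} (h₀ : IsFredholm T₀)
    (h₁ : IsFredholm T₁) {T : Z₀ →ₗ[B] W₀} (hT : IsAdjointable T)
    {Φ₀ : X₀ →ₗ[B] Z₀} {Φ₁ : X₁ →ₗ[B] Z₀} {Θ₀ : Z₀ →ₗ[B] X₀} {Θ₁ : Z₀ →ₗ[B] X₁}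
    {φ₀ : Y₀ →ₗ[B] W₀} {φ₁ : Y₁ →ₗ[B] W₀} {θ₀ : W₀ →ₗ[B] Y₀} {θ₁ : W₀ →ₗ[B] Y₁}
    (hΦ₀ : IsAdjointable Φ₀) (hΦ₁ : IsAdjointable Φ₁)
    (hΘ₀ : IsAdjointable Θ₀) (hΘ₁ : IsAdjointable Θ₁)
    (hφ₀ : IsAdjointable φ₀) (hφ₁ : IsAdjointable φ₁)
    (hθ₀ : IsAdjointable θ₀) (hθ₁ : IsAdjointable θ₁)
    (hΦΘ : Φ₀ ∘ₗ Θ₀ + Φ₁ ∘ₗ Θ₁ = LinearMap.id) (hφθ : φ₀ ∘ₗ θ₀ + φ₁ ∘ₗ θ₁ = LinearMap.id)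
    (hK₀ : IsCompactOp (T ∘ₗ Φ₀ - φ₀ ∘ₗ T₀)) (hK₁ : IsCompactOp (T ∘ₗ Φ₁ - φ₁ ∘ₗ T₁))
    (hL₀ : IsCompactOp (T₀ ∘ₗ Θ₀ - θ₀ ∘ₗ T)) (hL₁ : IsCompactOp (T₁ ∘ₗ Θ₁ - θ₁ ∘ₗ T)) :
    IsFredholm T := by
  obtain ⟨-, ⟨S₀, hS₀, hl₀⟩, R₀, hR₀, hr₀⟩ := h₀
  obtain ⟨-, ⟨S₁, hS₁, hl₁⟩, R₁, hR₁, hr₁⟩ := h₁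
  -- With `S = ∑ Φ S_i θ`, the left error `1 - S T` is `∑ Φ (1 - S_i T_i) Θ + ∑ Φ S_i (T_i Θ - θ
  -- T)`. With `R = ∑ Φ R_i θ`, the right error `1 - T R` is `∑ φ (1 - T_i R_i) θ - ∑ (T Φ - φ T_i)
  -- R_i θ`.
  refine ⟨hT, ⟨Φ₀ ∘ₗ S₀ ∘ₗ θ₀ + Φ₁ ∘ₗ S₁ ∘ₗ θ₁,
    (hΦ₀.comp (hS₀.comp hθ₀)).add (hΦ₁.comp (hS₁.comp hθ₁)), ?_⟩,
    ⟨Φ₀ ∘ₗ R₀ ∘ₗ θ₀ + Φ₁ ∘ₗ R₁ ∘ₗ θ₁,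
    (hΦ₀.comp (hR₀.comp hθ₀)).add (hΦ₁.comp (hR₁.comp hθ₁)), ?_⟩⟩
  · have := (((hl₀.comp_right hΘ₀).comp_left Φ₀ hΦ₀.exists_bound).add
      ((hl₁.comp_right hΘ₁).comp_left Φ₁ hΦ₁.exists_bound)).add
      ((hL₀.comp_left (Φ₀ ∘ₗ S₀) (hΦ₀.comp hS₀).exists_bound).add
      (hL₁.comp_left (Φ₁ ∘ₗ S₁) (hΦ₁.comp hS₁).exists_bound))
    convert this using 1
    ext1 z
    have hz := LinearMap.congr_fun hΦΘ z
    simp only [LinearMap.add_apply, LinearMap.comp_apply, LinearMap.id_apply] at hz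
    simp only [LinearMap.add_apply, LinearMap.comp_apply, LinearMap.id_apply, LinearMap.sub_apply,
      map_sub]
    nth_rw 1 [← hz]
    abel
  · have := (((hr₀.comp_right hθ₀).comp_left φ₀ hφ₀.exists_bound).add
      ((hr₁.comp_right hθ₁).comp_left φ₁ hφ₁.exists_bound)).sub
      ((hK₀.comp_right (hR₀.comp hθ₀)).add (hK₁.comp_right (hR₁.comp hθ₁)))
    convert this using 1
    ext1 z
    have hz := LinearMap.congr_fun hφθ z
    simp only [LinearMap.add_apply, LinearMap.comp_apply, LinearMap.id_apply] at hz
    simp only [LinearMap.add_apply, LinearMap.comp_apply, LinearMap.id_apply, LinearMap.sub_apply,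
      map_sub, map_add]
    nth_rw 1 [← hz]
    abel

/-- Block matrices of linear maps. -/
def blockMap (a : X₀ →ₗ[B] Z₀) (b : X₁ →ₗ[B] Z₀) (c : X₀ →ₗ[B] Z₁) (d : X₁ →ₗ[B] Z₁) :
    (X₀ × X₁) →ₗ[B] Z₀ × Z₁ := (a.coprod b).prod (c.coprod d)

theorem blockMap_apply (a : X₀ →ₗ[B] Z₀) (b : X₁ →ₗ[B] Z₀) (c : X₀ →ₗ[B] Z₁) (d : X₁ →ₗ[B] Z₁)
    (x : X₀ × X₁) : blockMap a b c d x = (a x.1 + b x.2, c x.1 + d x.2) := rfl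

theorem exists_bound_blockMap {a : X₀ →ₗ[B] Z₀} {b : X₁ →ₗ[B] Z₀} {c : X₀ →ₗ[B] Z₁}
    {d : X₁ →ₗ[B] Z₁} (ha : IsAdjointable a) (hb : IsAdjointable b) (hc : IsAdjointable c)
    (hd : IsAdjointable d) : ∃ M, 0 < M ∧ ∀ x, ‖blockMap a b c d x‖ ≤ M * ‖x‖ := by
  obtain ⟨Ma, hMa0, hMa⟩ := ha.exists_bound
  obtain ⟨Mb, hMb0, hMb⟩ := hb.exists_bound
  obtain ⟨Mc, hMc0, hMc⟩ := hc.exists_bound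
  obtain ⟨Md, hMd0, hMd⟩ := hd.exists_bound
  refine ⟨Ma + Mb + Mc + Md, by positivity, fun x => ?_⟩
  have h1 := norm_fst_le x
  have h2 := norm_snd_le x
  have hx := norm_nonneg x
  rw [blockMap_apply, Prod.norm_mk]
  refine max_le ?_ ?_
  · refine (norm_add_le _ _).trans ?_
    have := (hMa x.1).trans (mul_le_mul_of_nonneg_left h1 hMa0.le)
    have := (hMb x.2).trans (mul_le_mul_of_nonneg_left h2 hMb0.le)
    nlinarith [mul_nonneg hMc0.le hx, mul_nonneg hMd0.le hx]
  · refine (norm_add_le _ _).trans ?_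
    have := (hMc x.1).trans (mul_le_mul_of_nonneg_left h1 hMc0.le)
    have := (hMd x.2).trans (mul_le_mul_of_nonneg_left h2 hMd0.le)
    nlinarith [mul_nonneg hMa0.le hx, mul_nonneg hMb0.le hx]

theorem isApproxFinite_blockMap {a : X₀ →ₗ[B] Z₀} {b : X₁ →ₗ[B] Z₀} {c : X₀ →ₗ[B] Z₁}
    {d : X₁ →ₗ[B] Z₁} (ha : IsCompactOp a) (hb : IsCompactOp b) (hc : IsCompactOp c)
    (hd : IsCompactOp d) : IsApproxFinite (blockMap a b c d) := by
  have hl : ∀ y : Z₀, ‖LinearMap.inl B Z₀ Z₁ y‖ ≤ 1 * ‖y‖ := fun y => by simp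
  have hr : ∀ y : Z₁, ‖LinearMap.inr B Z₀ Z₁ y‖ ≤ 1 * ‖y‖ := fun y => by simp
  have := (((ha.isApproxFinite.comp_right (LinearMap.fst B X₀ X₁) norm_fst_le).comp_left _
    one_pos hl).add ((hb.isApproxFinite.comp_right (LinearMap.snd B X₀ X₁) norm_snd_le).comp_left _
    one_pos hl)).add
    (((hc.isApproxFinite.comp_right (LinearMap.fst B X₀ X₁) norm_fst_le).comp_left _
    one_pos hr).add ((hd.isApproxFinite.comp_right (LinearMap.snd B X₀ X₁) norm_snd_le).comp_left _
    one_pos hr))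
  convert this using 1
  refine LinearMap.ext fun x => ?_
  simp [blockMap_apply]

/-- Two pairs of Fredholm operators that are intertwined by an invertible matrix of adjointable
operators, up to compact operators, have the same total index. -/
theorem index_add_index_eq {T₀ : X₀ →ₗ[B] Y₀} {T₁ : X₁ →ₗ[B] Y₁} (h₀ : IsFredholm T₀)
    (h₁ : IsFredholm T₁) {T₀' : Z₀ →ₗ[B] W₀} {T₁' : Z₁ →ₗ[B] W₁} (h₀' : IsFredholm T₀')
    (h₁' : IsFredholm T₁')
    {a : X₀ →ₗ[B] Z₀} {b : X₁ →ₗ[B] Z₀} {c : X₀ →ₗ[B] Z₁} {d : X₁ →ₗ[B] Z₁}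
    {a' : Y₀ →ₗ[B] W₀} {b' : Y₁ →ₗ[B] W₀} {c' : Y₀ →ₗ[B] W₁} {d' : Y₁ →ₗ[B] W₁}
    {p : W₀ →ₗ[B] Y₀} {q : W₁ →ₗ[B] Y₀} {r : W₀ →ₗ[B] Y₁} {s : W₁ →ₗ[B] Y₁}
    (hp : IsAdjointable p) (hq : IsAdjointable q) (hr : IsAdjointable r) (hs : IsAdjointable s)
    (e : (X₀ × X₁) ≃ₗ[B] Z₀ × Z₁) (he : (e : (X₀ × X₁) →ₗ[B] Z₀ × Z₁) = blockMap a b c d)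
    (f : (Y₀ × Y₁) ≃ₗ[B] W₀ × W₁) (hf : (f : (Y₀ × Y₁) →ₗ[B] W₀ × W₁) = blockMap a' b' c' d')
    (hf' : (f.symm : (W₀ × W₁) →ₗ[B] Y₀ × Y₁) = blockMap p q r s)
    (hKa : IsCompactOp (T₀' ∘ₗ a - a' ∘ₗ T₀)) (hKb : IsCompactOp (T₀' ∘ₗ b - b' ∘ₗ T₁))
    (hKc : IsCompactOp (T₁' ∘ₗ c - c' ∘ₗ T₀)) (hKd : IsCompactOp (T₁' ∘ₗ d - d' ∘ₗ T₁)) :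
    index T₀ + index T₁ = index T₀' + index T₁' := by
  obtain ⟨S₀, hS₀, hk₀⟩ := h₀.exists_hasIndexWith
  obtain ⟨S₁, hS₁, hk₁⟩ := h₁.exists_hasIndexWith
  obtain ⟨S₀', -, hk₀'⟩ := h₀'.exists_hasIndexWith
  obtain ⟨S₁', -, hk₁'⟩ := h₁'.exists_hasIndexWith
  obtain ⟨M, hM0, hM⟩ := exists_bound_blockMap hp hq hr hs
  -- This perturbation is `f⁻¹ (T' e - f T)` for the direct sums `T`, `T'` of the two pairs. Adding
  -- it to `T` gives `f⁻¹ T' e`, which has the index of `T'`.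
  have hK := (isApproxFinite_blockMap hKa hKb hKc hKd).comp_left (blockMap p q r s) hM0 hM
  have hz : IsAdjointable (0 : Y₁ →ₗ[B] X₀) := ⟨0, fun x y => by simp⟩
  have hz' : IsAdjointable (0 : Y₀ →ₗ[B] X₁) := ⟨0, fun x y => by simp⟩
  obtain ⟨N, hN0, hN⟩ := exists_bound_blockMap hS₀ hz hz' hS₁
  have h2 : HasIndexWith (T₀.prodMap T₁) (S₀.prodMap S₁) (index T₀ + index T₁) := hk₀.prodMap hk₁
  have h3 := h2.add_isApproxFinite hN0 (fun y => by
    simpa [blockMap_apply] using hN y) hK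
  refine (h3.congr e f (T' := T₀'.prodMap T₁') fun x => ?_).unique ⟨_, hk₀'.prodMap hk₁'⟩
  have he' : e x = blockMap a b c d x := LinearMap.congr_fun he x
  have hf'' : ∀ y, f y = blockMap a' b' c' d' y := LinearMap.congr_fun hf
  have hfs : ∀ w, blockMap p q r s w = f.symm w := fun w => (LinearMap.congr_fun hf' w).symm
  rw [LinearMap.add_apply, map_add, LinearMap.comp_apply, hfs, LinearEquiv.apply_symm_apply, hf'',
    he']
  simp only [blockMap_apply, LinearMap.prodMap_apply, LinearMap.sub_apply, LinearMap.comp_apply,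
    Prod.mk_add_mk, map_add]
  refine Prod.ext ?_ ?_ <;> dsimp only <;> abel

end CutAndPaste

/-! ### Transplantation of sections -/

section Geometry

variable {EM : Type*} [NormedAddCommGroup EM] [NormedSpace ℝ EM]
  {HM : Type*} [TopologicalSpace HM] {I : ModelWithCorners ℝ EM HM}
  {B : Type u} [CStarAlgebra B] [PartialOrder B] [StarOrderedRing B]

section SmoothAt

variable {M : Type v} [TopologicalSpace M] [ChartedSpace HM M]
  {E : VectorBBundle.{u, v, w} I B M} {s t : ∀ x, E.fiber x} {x : M}

theorem VectorBBundle.SmoothAt.congr (hs : E.SmoothAt s x) (h : ∀ᶠ y in 𝓝 x, t y = s y) :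
    E.SmoothAt t x := by
  refine ContMDiffAt.congr_of_eventuallyEq hs ?_
  filter_upwards [h] with y hy
  rw [hy]

theorem VectorBBundle.SmoothAt.smul (hs : E.SmoothAt s x) {a : M → ℂ}
    (ha : ContMDiffAt I 𝓘(ℝ, ℂ) ∞ a x) : E.SmoothAt (fun y => a y • s y) x := by
  have h : ContMDiffAt I 𝓘(ℝ, E.model x) ∞ (fun y => a y • E.triv x y (s y)) x :=
    ((ContinuousLinearMap.lsmul ℝ ℂ (E := E.model x)).contMDiff.contMDiffAt.comp x
      ha).clm_apply hs
  unfold VectorBBundle.SmoothAt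
  simpa only [map_smul] using! h

theorem VectorBBundle.smoothAt_zero : E.SmoothAt (fun _ => 0) x := by
  unfold VectorBBundle.SmoothAt
  simpa only [map_zero] using! contMDiffAt_const

end SmoothAt

variable {X Y Z : BundledManifold.{u, v, w} I B}

namespace OpenEmb

variable (φ : OpenEmb Z X)

theorem continuous : Continuous φ.toFun := φ.isLocalDiffeomorph.contMDiff.continuous

theorem isOpenEmbedding : IsOpenEmbedding φ.toFun :=
  .of_continuous_injective_isOpenMap φ.continuous φ.injective φ.isLocalDiffeomorph.isOpenMap

theorem integral_comp {F : Type*} [NormedAddCommGroup F] [NormedSpace ℝ F] (g : X → F) :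
    ∫ z, g (φ.toFun z) ∂Z.μ = ∫ x in range φ.toFun, g x ∂X.μ := by
  have he := φ.isOpenEmbedding.measurableEmbedding
  rw [← he.map_comap, he.integral_map, φ.comap_measure]

end OpenEmb

theorem BundleIso.inner_pull {f : Z → X} {E : HermitianBundle.{u, v, w} I B Z}
    {E' : HermitianBundle.{u, v, w} I B X} (Φ : BundleIso f E E') (s t : ∀ x, E'.fiber x) (z : Z) :
    (inner B (Φ.pull s z) (Φ.pull t z) : B) = inner B (s (f z)) (t (f z)) := by
  rw [← Φ.inner_equiv]
  simp [BundleIso.pull]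

theorem BundleIso.pull_smul {f : Z → X} {E : HermitianBundle.{u, v, w} I B Z}
    {E' : HermitianBundle.{u, v, w} I B X} (Φ : BundleIso f E E') (a : X → ℂ) (s : ∀ x, E'.fiber x)
    (z : Z) : Φ.pull (fun x => a x • s x) z = a (f z) • Φ.pull s z :=
  (Φ.equiv z).symm.toLinearMap.map_smul_of_tower (a (f z)) (s (f z))

/-- A smooth function on `Z`, bounded by `1`, whose support is closed in `X` and in `Y`. -/
structure CutOff (φ : OpenEmb Z X) (ψ : OpenEmb Z Y) where
  toFun : Z → ℝ
  smooth : ContMDiff I 𝓘(ℝ) ∞ toFun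
  abs_le : ∀ z, |toFun z| ≤ 1
  isClosed_left : IsClosed (φ.toFun '' tsupport toFun)
  isClosed_right : IsClosed (ψ.toFun '' tsupport toFun)

namespace CutOff

variable {φ : OpenEmb Z X} {ψ : OpenEmb Z Y} (c : CutOff φ ψ)

/-- The same function with the roles of `X` and `Y` exchanged. -/
noncomputable def symm : CutOff ψ φ :=
  ⟨c.toFun, c.smooth, c.abs_le, c.isClosed_right, c.isClosed_left⟩

variable {EX : HermitianBundle.{u, v, w} I B X} {EY : HermitianBundle.{u, v, w} I B Y}
  {EZ : HermitianBundle.{u, v, w} I B Z} (Φ : BundleIso φ.toFun EZ EX) (Ψ : BundleIso ψ.toFun EZ EY)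

open Classical in
/-- Multiply a section over `X` by the cutoff function and transport it from the image of `Z` in
`X` to the image of `Z` in `Y`; extend it by zero. -/
noncomputable def transplantFun (s : ∀ x, EX.fiber x) (y : Y) : EY.fiber y :=
  if h : ∃ z, ψ.toFun z = y then
    h.choose_spec ▸ Ψ.equiv h.choose ((c.toFun h.choose : ℂ) • Φ.pull s h.choose)
  else 0

variable {Φ Ψ}

theorem transplantFun_apply (s : ∀ x, EX.fiber x) (z : Z) :
    c.transplantFun Φ Ψ s (ψ.toFun z) = Ψ.equiv z ((c.toFun z : ℂ) • Φ.pull s z) := by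
  have h : ∃ z', ψ.toFun z' = ψ.toFun z := ⟨z, rfl⟩
  rw [transplantFun, dif_pos h]
  -- Generalizing the chosen preimage lets injectivity of `ψ` identify it with `z`, after which the
  -- cast between fibres disappears.
  have key : ∀ z' (h' : ψ.toFun z' = ψ.toFun z),
      (h' ▸ Ψ.equiv z' ((c.toFun z' : ℂ) • Φ.pull s z') : EY.fiber (ψ.toFun z)) =
        Ψ.equiv z ((c.toFun z : ℂ) • Φ.pull s z) := by
    intro z' h'
    obtain rfl := ψ.injective h'
    rfl
  exact key _ h.choose_spec

theorem pull_transplantFun (s : ∀ x, EX.fiber x) (z : Z) :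
    Ψ.pull (c.transplantFun Φ Ψ s) z = (c.toFun z : ℂ) • Φ.pull s z := by
  rw [BundleIso.pull, transplantFun_apply, LinearEquiv.symm_apply_apply]

theorem transplantFun_of_notMem (s : ∀ x, EX.fiber x) {y : Y}
    (hy : y ∉ ψ.toFun '' tsupport c.toFun) : c.transplantFun Φ Ψ s y = 0 := by
  by_cases h : ∃ z, ψ.toFun z = y
  · obtain ⟨z, rfl⟩ := h
    have hz : c.toFun z = 0 := by
      by_contra hz
      exact hy ⟨z, subset_tsupport _ hz, rfl⟩
    rw [transplantFun_apply, hz]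
    simp
  · rw [transplantFun, dif_neg h]

theorem eventually_transplantFun_eq_zero (s : ∀ x, EX.fiber x) {y : Y}
    (hy : y ∉ ψ.toFun '' tsupport c.toFun) : ∀ᶠ y' in 𝓝 y, c.transplantFun Φ Ψ s y' = 0 := by
  filter_upwards [c.isClosed_right.isOpen_compl.mem_nhds hy] with y' hy'
  exact c.transplantFun_of_notMem s hy'

/-- On the image of the support, smoothness can be tested after pulling back to `Z`; off this closed
set the transplant vanishes locally. -/
theorem smoothAt_transplantFun {s : ∀ x, EX.fiber x} (hs : ∀ x, EX.SmoothAt s x) (y : Y) :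
    EY.SmoothAt (c.transplantFun Φ Ψ s) y := by
  by_cases hy : y ∈ ψ.toFun '' tsupport c.toFun
  · obtain ⟨z, -, rfl⟩ := hy
    rw [← Ψ.smoothAt_iff]
    have h : EZ.SmoothAt (fun z' => (c.toFun z' : ℂ) • Φ.pull s z') z :=
      VectorBBundle.SmoothAt.smul ((Φ.smoothAt_iff s z).mpr (hs _))
        ((Complex.ofRealCLM.contMDiff.contMDiffAt).comp z (c.smooth z))
    refine h.congr (.of_forall fun z' => ?_)
    exact c.pull_transplantFun s z'
  · exact VectorBBundle.smoothAt_zero.congr (c.eventually_transplantFun_eq_zero s hy)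

/-- The part of the support of `s` that meets the cutoff is compact in `Z`: its image in `X` is the
intersection of a compact set with the closed image of the support of `c`. -/
theorem isCompact_closure_transplantFun {s : ∀ x, EX.fiber x}
    (hs : IsCompact (closure {x | s x ≠ 0})) :
    IsCompact (closure {y | c.transplantFun Φ Ψ s y ≠ 0}) := by
  have h1 : IsCompact (φ.toFun ⁻¹' (closure {x | s x ≠ 0}) ∩ tsupport c.toFun) := by
    rw [φ.isOpenEmbedding.isEmbedding.isCompact_iff, inter_comm, image_inter_preimage, inter_comm]
    exact hs.inter_right c.isClosed_left
  have h2 := h1.image ψ.continuous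
  refine h2.of_isClosed_subset isClosed_closure (closure_minimal ?_ h2.isClosed)
  intro y hy
  have hy' : y ∈ ψ.toFun '' tsupport c.toFun := by
    by_contra h
    exact hy (c.transplantFun_of_notMem s h)
  obtain ⟨z, hz, rfl⟩ := hy'
  refine ⟨z, ⟨subset_closure fun h => hy ?_, hz⟩, rfl⟩
  rw [transplantFun_apply, BundleIso.pull, h]
  simp

variable (Φ Ψ) in
/-- Transplantation of compactly supported smooth sections. -/
noncomputable def transplant : EX.CcSec →ₗ[B] EY.CcSec where
  toFun s := ⟨c.transplantFun Φ Ψ s.1, c.smoothAt_transplantFun s.2.1,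
    c.isCompact_closure_transplantFun s.2.2⟩
  map_add' s t := by
    ext y
    change c.transplantFun Φ Ψ (s.1 + t.1) y =
      c.transplantFun Φ Ψ s.1 y + c.transplantFun Φ Ψ t.1 y
    by_cases hy : y ∈ ψ.toFun '' tsupport c.toFun
    · obtain ⟨z, -, rfl⟩ := hy
      simp only [transplantFun_apply, BundleIso.pull, Pi.add_apply, map_add, smul_add]
    · simp only [c.transplantFun_of_notMem _ hy, add_zero]
  map_smul' b s := by
    ext y
    change c.transplantFun Φ Ψ (b • s.1) y = b • c.transplantFun Φ Ψ s.1 y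
    by_cases hy : y ∈ ψ.toFun '' tsupport c.toFun
    · obtain ⟨z, -, rfl⟩ := hy
      simp only [transplantFun_apply, BundleIso.pull, Pi.smul_apply, map_smul]
      rw [smul_comm, map_smul]
    · simp only [c.transplantFun_of_notMem _ hy, smul_zero]

theorem transplant_coe (s : EX.CcSec) :
    (c.transplant Φ Ψ s).1 = c.transplantFun Φ Ψ s.1 := rfl

variable (Φ Ψ) in
theorem integral_inner_transplant (s : EX.CcSec) (t : EY.CcSec) :
    ∫ y, (inner B ((c.transplant Φ Ψ s).1 y) (t.1 y) : B) ∂Y.μ =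
      ∫ z, (inner B ((c.toFun z : ℂ) • Φ.pull s.1 z) (Ψ.pull t.1 z) : B) ∂Z.μ := by
  rw [← setIntegral_eq_integral_of_forall_compl_eq_zero (s := range ψ.toFun), ← ψ.integral_comp]
  · congr 1
    ext z
    rw [← Ψ.inner_pull, transplant_coe, pull_transplantFun]
  · intro y hy
    rw [transplant_coe, c.transplantFun_of_notMem s.1 fun h => hy (image_subset_range _ _ h),
      CStarModule.inner_zero_left]

variable (Φ Ψ) in
-- Both sides are integrals over `Z` of `c ⟪s, t⟫`; the cutoff is real, so it may be moved across
-- the inner product.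
theorem integral_inner_transplant_symm (s : EX.CcSec) (t : EY.CcSec) :
    ∫ y, (inner B ((c.transplant Φ Ψ s).1 y) (t.1 y) : B) ∂Y.μ =
      ∫ x, (inner B (s.1 x) ((c.symm.transplant Ψ Φ t).1 x) : B) ∂X.μ := by
  rw [integral_inner_transplant]
  rw [← setIntegral_eq_integral_of_forall_compl_eq_zero (s := range φ.toFun), ← φ.integral_comp]
  · congr 1
    ext z
    rw [← Φ.inner_pull, transplant_coe, pull_transplantFun, CStarModule.inner_smul_left_complex,
      CStarModule.inner_smul_right_complex]
    simp [symm]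
  · intro y hy
    rw [transplant_coe, c.symm.transplantFun_of_notMem t.1 fun h => hy (image_subset_range _ _ h),
      CStarModule.inner_zero_right]

end CutOff

/-! ### Transplantation as an adjointable contraction of `L²`. -/

section L2

/-- The inclusion of sections in `L²` as a linear map. -/
noncomputable def toL2Lin (E : HermitianBundle.{u, v, w} I B X) : PreL2 E X.μ →ₗ[B] L2 E X.μ where
  toFun s := s
  map_add' := UniformSpace.Completion.coe_add
  map_smul' b s := UniformSpace.Completion.coe_smul b s

theorem denseRange_toL2 (E : HermitianBundle.{u, v, w} I B X) :
    DenseRange (toL2 E X.μ : E.CcSec → L2 E X.μ) :=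
  UniformSpace.Completion.denseRange_coe (α := PreL2 E X.μ)

theorem inner_toL2 (E : HermitianBundle.{u, v, w} I B X) (s t : E.CcSec) :
    (inner B (toL2 E X.μ s) (toL2 E X.μ t) : B) = ∫ x, (inner B (s.1 x) (t.1 x) : B) ∂X.μ :=
  completion_inner_coe _ _

theorem toL2_add (E : HermitianBundle.{u, v, w} I B X) (s t : E.CcSec) :
    toL2 E X.μ (s + t) = toL2 E X.μ s + toL2 E X.μ t :=
  map_add (toL2Lin E) s t

theorem toL2_sub (E : HermitianBundle.{u, v, w} I B X) (s t : E.CcSec) :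
    toL2 E X.μ (s - t) = toL2 E X.μ s - toL2 E X.μ t :=
  map_sub (toL2Lin E) s t

/-- Adjointable operators on `L²` are determined by their values on sections. -/
theorem IsAdjointable.ext_toL2 {E : HermitianBundle.{u, v, w} I B X}
    {H : Type*} [NormedAddCommGroup H] [NormedSpace ℂ H] [Module B H] [CStarModule B H]
    [CompleteSpace H] {P Q : L2 E X.μ →ₗ[B] H} (hP : IsAdjointable P) (hQ : IsAdjointable Q)
    (h : ∀ s, P (toL2 E X.μ s) = Q (toL2 E X.μ s)) : P = Q := by
  obtain ⟨C, -, hC⟩ := hP.exists_bound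
  obtain ⟨C', -, hC'⟩ := hQ.exists_bound
  ext x
  exact (denseRange_toL2 E).induction_on (p := fun x => P x = Q x) x
    (isClosed_eq (AddMonoidHomClass.continuous_of_bound P C hC)
      (AddMonoidHomClass.continuous_of_bound Q C' hC')) h

end L2

namespace CutOff

variable {φ : OpenEmb Z X} {ψ : OpenEmb Z Y} (c : CutOff φ ψ)
  {EX : HermitianBundle.{u, v, w} I B X} {EY : HermitianBundle.{u, v, w} I B Y}
  {EZ : HermitianBundle.{u, v, w} I B Z} (Φ : BundleIso φ.toFun EZ EX) (Ψ : BundleIso ψ.toFun EZ EY)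

/-- The transplant followed by its formal adjoint multiplies by `c² ≤ 1`, so the difference of the
two sides is the integral of a pointwise positive function. -/
theorem inner_transplant_le (s : EX.CcSec) :
    (inner B (toL2 EY Y.μ (c.transplant Φ Ψ s)) (toL2 EY Y.μ (c.transplant Φ Ψ s)) : B) ≤
      inner B (toL2 EX X.μ s) (toL2 EX X.μ s) := by
  rw [inner_toL2, integral_inner_transplant_symm, ← inner_toL2, ← sub_nonneg,
    ← CStarModule.inner_sub_right (A := B) (E := L2 EX X.μ), ← toL2_sub, inner_toL2]
  refine integral_nonneg fun x => ?_
  change 0 ≤ (inner B (s.1 x) (s.1 x - (c.symm.transplant Ψ Φ (c.transplant Φ Ψ s)).1 x) : B)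
  by_cases hx : x ∈ φ.toFun '' tsupport c.symm.toFun
  · obtain ⟨z, -, rfl⟩ := hx
    rw [CStarModule.inner_sub_right, ← Φ.inner_pull, ← Φ.inner_pull, transplant_coe,
      pull_transplantFun, transplant_coe, pull_transplantFun, smul_smul,
      CStarModule.inner_smul_right_complex, ← Complex.ofReal_mul]
    have h1 : (inner B (Φ.pull s.1 z) (Φ.pull s.1 z) : B) -
        ((c.toFun z * c.toFun z : ℝ) : ℂ) • (inner B (Φ.pull s.1 z) (Φ.pull s.1 z) : B) =
        (1 - c.toFun z * c.toFun z) • (inner B (Φ.pull s.1 z) (Φ.pull s.1 z) : B) := by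
      rw [sub_smul, one_smul]
      rfl
    refine (smul_nonneg ?_ CStarModule.inner_self_nonneg).trans_eq h1.symm
    have := c.abs_le z
    rw [← sq, sub_nonneg, sq_le_one_iff_abs_le_one]
    exact this
  · rw [transplant_coe, c.symm.transplantFun_of_notMem _ hx, sub_zero]
    exact CStarModule.inner_self_nonneg

theorem norm_transplant_le (s : EX.CcSec) :
    ‖toL2 EY Y.μ (c.transplant Φ Ψ s)‖ ≤ ‖toL2 EX X.μ s‖ := by
  refine le_of_sq_le_sq ?_ (norm_nonneg _)
  rw [CStarModule.norm_sq_eq B, CStarModule.norm_sq_eq B (x := toL2 EX X.μ s)]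
  exact CStarAlgebra.norm_le_norm_of_nonneg_of_le CStarModule.inner_self_nonneg
    (c.inner_transplant_le Φ Ψ s)

theorem exists_transplantL2 : ∃ P : L2 EX X.μ →ₗ[B] L2 EY Y.μ,
    (∀ s : PreL2 EX X.μ, P (toL2Lin EX s) = toL2 EY Y.μ (c.transplant Φ Ψ (PreL2.sec EX X.μ s))) ∧
      ∀ x, ‖P x‖ ≤ 1 * ‖x‖ :=
  exists_extension (toL2Lin EX) (denseRange_toL2 EX)
    (toL2Lin EY ∘ₗ PreL2.ofSec EY Y.μ ∘ₗ c.transplant Φ Ψ ∘ₗ PreL2.sec EX X.μ) 1 fun s => by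
      rw [one_mul]
      exact c.norm_transplant_le Φ Ψ s

/-- Transplantation on `L²`. -/
noncomputable def transplantL2 : L2 EX X.μ →ₗ[B] L2 EY Y.μ := (c.exists_transplantL2 Φ Ψ).choose

theorem transplantL2_toL2 (s : EX.CcSec) :
    c.transplantL2 Φ Ψ (toL2 EX X.μ s) = toL2 EY Y.μ (c.transplant Φ Ψ s) :=
  (c.exists_transplantL2 Φ Ψ).choose_spec.1 s

theorem norm_transplantL2_le (x : L2 EX X.μ) : ‖c.transplantL2 Φ Ψ x‖ ≤ 1 * ‖x‖ :=
  (c.exists_transplantL2 Φ Ψ).choose_spec.2 x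

theorem continuous_transplantL2 : Continuous (c.transplantL2 Φ Ψ) :=
  AddMonoidHomClass.continuous_of_bound _ 1 (c.norm_transplantL2_le Φ Ψ)

theorem isAdjointPair_transplantL2 :
    IsAdjointPair (c.transplantL2 Φ Ψ) (c.symm.transplantL2 Ψ Φ) := fun x y => by
  have hc := c.continuous_transplantL2 Φ Ψ
  have hc' := c.symm.continuous_transplantL2 Ψ Φ
  refine (denseRange_toL2 EX).induction_on (p := fun x => (inner B (c.transplantL2 Φ Ψ x) y : B) =
    inner B x (c.symm.transplantL2 Ψ Φ y)) x (isClosed_eq ?_ ?_) fun s => ?_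
  · exact CStarModule.continuous_inner.comp (hc.prodMk continuous_const)
  · exact CStarModule.continuous_inner.comp (continuous_id.prodMk continuous_const)
  refine (denseRange_toL2 EY).induction_on
    (p := fun y => (inner B (c.transplantL2 Φ Ψ (toL2 EX X.μ s)) y : B) =
    inner B (toL2 EX X.μ s) (c.symm.transplantL2 Ψ Φ y)) y (isClosed_eq ?_ ?_) fun t => ?_
  · exact CStarModule.continuous_inner.comp (continuous_const.prodMk continuous_id)
  · exact CStarModule.continuous_inner.comp (continuous_const.prodMk hc')
  rw [transplantL2_toL2, transplantL2_toL2, inner_toL2, inner_toL2,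
    integral_inner_transplant_symm]

theorem isAdjointable_transplantL2 : IsAdjointable (c.transplantL2 Φ Ψ) :=
  ⟨_, c.isAdjointPair_transplantL2 Φ Ψ⟩

end CutOff

end Geometry

/-! ### Locality of differential operators -/

section Locality

variable {EM : Type*} [NormedAddCommGroup EM] [NormedSpace ℝ EM] [FiniteDimensional ℝ EM]
  {HM : Type*} [TopologicalSpace HM] {I : ModelWithCorners ℝ EM HM}
  {B : Type u} [CStarAlgebra B] [PartialOrder B] [StarOrderedRing B]
  {M : Type v} [TopologicalSpace M] [ChartedSpace HM M] [T2Space M] [IsManifold I ∞ M]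
  {E F : HermitianBundle.{u, v, w} I B M}

namespace HermitianBundle

theorem commutator_apply (D : E.CcSec →ₗ[B] F.CcSec) (a : C^∞⟮I, M; 𝓘(ℝ, ℂ), ℂ⟯) (s : E.CcSec)
    (x : M) : (commutator D a s).1 x = (D (CcSec.mulFun E a s)).1 x - a x • (D s).1 x := rfl

/-- Take a bump function `a` with `a x = 1` supported where `s` vanishes. Then `a s = 0`, so `[D, a]
s` has the value `-(D s) x` at `x`, and induction on the order applies to `[D, a]`. -/
theorem HasOrderLE.apply_eq_zero {m : ℕ} {D : E.CcSec →ₗ[B] F.CcSec} (hD : HasOrderLE m D)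
    {s : E.CcSec} {x : M} (hs : ∀ᶠ y in 𝓝 x, s.1 y = 0) : (D s).1 x = 0 := by
  obtain ⟨f, hf⟩ : ∃ f : SmoothBumpFunction I x, tsupport f ⊆ {y | s.1 y = 0} :=
    ((SmoothBumpFunction.nhds_basis_tsupport x).mem_iff.mp hs).imp fun f hf => hf.2
  let a : C^∞⟮I, M; 𝓘(ℝ, ℂ), ℂ⟯ :=
    ⟨fun y => (f y : ℂ), Complex.ofRealCLM.contMDiff.comp f.contMDiff⟩
  have ha : a x = 1 := by
    change ((f x : ℝ) : ℂ) = 1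
    rw [f.eq_one, Complex.ofReal_one]
  have has : CcSec.mulFun E a s = 0 := by
    ext y
    change (f y : ℂ) • s.1 y = 0
    by_cases hy : f y = 0
    · simp [hy]
    · have h0 : s.1 y = 0 := hf (subset_tsupport _ hy)
      rw [h0, smul_zero]
  have hcomm : (commutator D a s).1 x = 0 := by
    cases m with
    | zero =>
      have h0 : commutator D a = 0 := hD a
      rw [h0]
      rfl
    | succ m => exact (hD a).apply_eq_zero hs
  rw [commutator_apply, has, map_zero, ha, one_smul] at hcomm
  change 0 - (D s).1 x = 0 at hcomm
  rwa [zero_sub, neg_eq_zero] at hcomm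

theorem IsDiffOp.apply_eq_zero {D : E.CcSec →ₗ[B] F.CcSec} (hD : IsDiffOp D)
    {s : E.CcSec} {x : M} (hs : ∀ᶠ y in 𝓝 x, s.1 y = 0) : (D s).1 x = 0 :=
  hD.choose_spec.apply_eq_zero hs

theorem IsDiffOp.apply_congr {D : E.CcSec →ₗ[B] F.CcSec} (hD : IsDiffOp D)
    {s t : E.CcSec} {x : M} (hs : ∀ᶠ y in 𝓝 x, s.1 y = t.1 y) : (D s).1 x = (D t).1 x := by
  have h := hD.apply_eq_zero (s := s - t) (x := x) (by
    filter_upwards [hs] with y hy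
    exact sub_eq_zero.mpr hy)
  rw [map_sub] at h
  exact sub_eq_zero.mp h

/-- Near `x` multiplication by `a` is multiplication by the scalar `a x`. The scalar is written as
an element of `B` because `D` is given as a `B`-linear map. -/
theorem IsDiffOp.commutator_eq_zero {D : E.CcSec →ₗ[B] F.CcSec} (hD : IsDiffOp D)
    {a : C^∞⟮I, M; 𝓘(ℝ, ℂ), ℂ⟯} (s : E.CcSec) {x : M} (ha : ∀ᶠ y in 𝓝 x, a y = a x) :
    (commutator D a s).1 x = 0 := by
  have h : (D (CcSec.mulFun E a s)).1 x = (D ((a x • (1 : B)) • s)).1 x := hD.apply_congr (by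
    filter_upwards [ha] with y hy
    change a y • s.1 y = (a x • (1 : B)) • s.1 y
    rw [hy, smul_assoc, one_smul])
  rw [commutator_apply, h, map_smul]
  change (a x • (1 : B)) • (D s).1 x - _ = 0
  rw [smul_assoc, one_smul, sub_self]

theorem IsDiffOp.commutator_congr {D : E.CcSec →ₗ[B] F.CcSec} (hD : IsDiffOp D)
    {a b : C^∞⟮I, M; 𝓘(ℝ, ℂ), ℂ⟯} (s : E.CcSec) {x : M} (h : ∀ᶠ y in 𝓝 x, a y = b y) :
    (commutator D a s).1 x = (commutator D b s).1 x := by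
  rw [commutator_apply, commutator_apply, h.self_of_nhds]
  congr 1
  refine hD.apply_congr ?_
  filter_upwards [h] with y hy
  change a y • s.1 y = b y • s.1 y
  rw [hy]

end HermitianBundle

end Locality

/-! ### Transplantation and differential operators -/

section Transplant

variable {EM : Type*} [NormedAddCommGroup EM] [NormedSpace ℝ EM] [FiniteDimensional ℝ EM]
  {HM : Type*} [TopologicalSpace HM] {I : ModelWithCorners ℝ EM HM}
  {B : Type u} [CStarAlgebra B] [PartialOrder B] [StarOrderedRing B]
  {X Y Z : BundledManifold.{u, v, w} I B} {φ : OpenEmb Z X} {ψ : OpenEmb Z Y}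

open HermitianBundle

/-- If `c` extends to a function `a` that is locally constant outside `C`, `p = 1` on `C`, and
`b = a` near the support of `p`, then transplantation by `c` commutes with `D` up to the transplant
by `p` of `[D, b]`. -/
theorem CutOff.apply_transplant_sub (c p : CutOff φ ψ) {D : X.E.CcSec →ₗ[B] X.F.CcSec}
    {D' : Y.E.CcSec →ₗ[B] Y.F.CcSec} (hD : IsDiffOp D) (hD' : IsDiffOp D')
    (hDD' : AgreeOn φ ψ D D') {a b : C^∞⟮I, X; 𝓘(ℝ, ℂ), ℂ⟯}
    (ha : ∀ z, a (φ.toFun z) = c.toFun z) {C : Set X}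
    (hC : ∀ x ∉ C, ∀ᶠ y in 𝓝 x, a y = a x) (hp : ∀ z, φ.toFun z ∈ C → p.toFun z = 1)
    (hb : ∀ z, p.toFun z ≠ 0 → ∀ᶠ x in 𝓝 (φ.toFun z), b x = a x) (f : X.E.CcSec) :
    D' (c.transplant φ.mapE ψ.mapE f) - c.transplant φ.mapF ψ.mapF (D f) =
      p.transplant φ.mapF ψ.mapF (commutator D b f) := by
  ext y
  change (D' (c.transplant φ.mapE ψ.mapE f)).1 y - c.transplantFun φ.mapF ψ.mapF (D f).1 y =
    p.transplantFun φ.mapF ψ.mapF (commutator D b f).1 y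
  by_cases hy : y ∈ range ψ.toFun
  · obtain ⟨z, rfl⟩ := hy
    refine (ψ.mapF.equiv z).symm.injective ?_
    -- The transplant of `f` by `c` and the section `a f` agree on `Z`, so `D'` of the former and
    -- `D` of the latter agree there as well.
    have h1 : (ψ.mapF.equiv z).symm ((D' (c.transplant φ.mapE ψ.mapE f)).1 (ψ.toFun z)) =
        φ.mapF.pull (D (CcSec.mulFun _ a f)).1 z := by
      refine (congrFun (hDD' (CcSec.mulFun _ a f) (c.transplant φ.mapE ψ.mapE f) ?_) z).symm
      ext z'
      rw [CutOff.transplant_coe, CutOff.pull_transplantFun]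
      change φ.mapE.pull (fun x => a x • f.1 x) z' = _
      rw [BundleIso.pull_smul, ha]
    have h2 := c.pull_transplantFun (Φ := φ.mapF) (Ψ := ψ.mapF) (D f).1 z
    have h3 := p.pull_transplantFun (Φ := φ.mapF) (Ψ := ψ.mapF) (commutator D b f).1 z
    rw [BundleIso.pull] at h2 h3
    rw [map_sub, h1, h2, h3, ← ha, ← BundleIso.pull_smul]
    have h4 : φ.mapF.pull (D (CcSec.mulFun _ a f)).1 z -
        φ.mapF.pull (fun x => a x • (D f).1 x) z = φ.mapF.pull (commutator D a f).1 z := by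
      rw [BundleIso.pull, BundleIso.pull, ← map_sub]
      rfl
    rw [h4]
    have h5 : p.toFun z ≠ 0 →
        (commutator D b f).1 (φ.toFun z) = (commutator D a f).1 (φ.toFun z) := fun h =>
      hD.commutator_congr f (hb z h)
    -- On `C` the function `p` is `1` and `[D, b] f` agrees with `[D, a] f`. Off `C` the commutator
    -- with `a` vanishes, and where `p ≠ 0` so does the one with `b`.
    by_cases hz : φ.toFun z ∈ C
    · rw [BundleIso.pull, BundleIso.pull, hp z hz, h5 (by simp [hp z hz]), Complex.ofReal_one,
        one_smul]
    · rw [BundleIso.pull, BundleIso.pull, hD.commutator_eq_zero f (hC _ hz), map_zero]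
      by_cases h0 : p.toFun z = 0
      · rw [h0, Complex.ofReal_zero, zero_smul]
      · rw [h5 h0, hD.commutator_eq_zero f (hC _ hz), map_zero, smul_zero]
  · have hy' : ∀ c' : CutOff φ ψ, y ∉ ψ.toFun '' tsupport c'.toFun := fun c' h =>
      hy (image_subset_range _ _ h)
    rw [c.transplantFun_of_notMem _ (hy' c), p.transplantFun_of_notMem _ (hy' p),
      hD'.apply_eq_zero (c.eventually_transplantFun_eq_zero f.1 (hy' c)), sub_zero]

theorem exists_seq_of_isClosedRealization {D : X.E.CcSec →ₗ[B] X.F.CcSec} {core : Set X.E.CcSec}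
    {T : L2 X.E X.μ →ₗ.[B] L2 X.F X.μ} (h : X.IsClosedRealization D core T) (z : Dom T) :
    ∃ (f : ℕ → X.E.CcSec) (s : ℕ → Dom T), (∀ n, f n ∈ core) ∧
      (∀ n, Dom.incl T (s n) = toL2 X.E X.μ (f n)) ∧
      (∀ n, Dom.op T (s n) = toL2 X.F X.μ (D (f n))) ∧ Filter.Tendsto s Filter.atTop (𝓝 z) := by
  have hz : (Dom.incl T z, Dom.op T z) ∈ (T.graph : Set _) := Dom.mem_graph z
  rw [h] at hz
  obtain ⟨p, hp, hpz⟩ := mem_closure_iff_seq_limit.mp hz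
  choose f hf hfp using hp
  have hg : ∀ n, p n ∈ T.graph := fun n => by
    rw [← SetLike.mem_coe, h, ← hfp]
    exact subset_closure ⟨f n, hf n, rfl⟩
  choose s hs1 hs2 using fun n => Dom.exists_of_mem_graph (hg n)
  have h1 : ∀ n, Dom.incl T (s n) = toL2 X.E X.μ (f n) := fun n => by rw [hs1, ← hfp]
  have h2 : ∀ n, Dom.op T (s n) = toL2 X.F X.μ (D (f n)) := fun n => by rw [hs2, ← hfp]
  refine ⟨f, s, hf, h1, h2, Dom.tendsto_iff.mpr ⟨?_, ?_⟩⟩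
  · simp only [hs1]
    exact (continuous_fst.tendsto _).comp hpz
  · simp only [hs2]
    exact (continuous_snd.tendsto _).comp hpz

/-- Transplantation acts on the domains of closed realizations and commutes with the operators up
to compact operators. -/
theorem CutOff.exists_transplant_dom (c p : CutOff φ ψ) {D : X.E.CcSec →ₗ[B] X.F.CcSec}
    {D' : Y.E.CcSec →ₗ[B] Y.F.CcSec} (hD : IsDiffOp D) (hD' : IsDiffOp D')
    (hDD' : AgreeOn φ ψ D D') {a b : C^∞⟮I, X; 𝓘(ℝ, ℂ), ℂ⟯}
    (ha : ∀ z, a (φ.toFun z) = c.toFun z) {C : Set X}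
    (hC : ∀ x ∉ C, ∀ᶠ y in 𝓝 x, a y = a x) (hp : ∀ z, φ.toFun z ∈ C → p.toFun z = 1)
    (hb : ∀ z, p.toFun z ≠ 0 → ∀ᶠ x in 𝓝 (φ.toFun z), b x = a x)
    {core : Set X.E.CcSec} {core' : Set Y.E.CcSec}
    (hcore : ∀ f ∈ core, c.transplant φ.mapE ψ.mapE f ∈ core')
    {T : L2 X.E X.μ →ₗ.[B] L2 X.F X.μ} {T' : L2 Y.E Y.μ →ₗ.[B] L2 Y.F Y.μ}
    (hT : X.IsClosedRealization D core T) (hT' : Y.IsClosedRealization D' core' T')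
    (hreg : IsRegularOp T) (hreg' : IsRegularOp T')
    (hcomm : X.CommutatorCompact D core T b) :
    ∃ S : Dom T →ₗ[B] Dom T', IsAdjointable S ∧
      Dom.incl T' ∘ₗ S = c.transplantL2 φ.mapE ψ.mapE ∘ₗ Dom.incl T ∧
      IsCompactOp (Dom.op T' ∘ₗ S - c.transplantL2 φ.mapF ψ.mapF ∘ₗ Dom.op T) := by
  obtain ⟨K, hK, hKf⟩ := hcomm
  have hK' := hK.comp_left (p.transplantL2 φ.mapF ψ.mapF)
    ⟨1, one_pos, p.norm_transplantL2_le φ.mapF ψ.mapF⟩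
  obtain ⟨S, hS, hS1, hS2⟩ := Dom.exists_lift (T' := T') hreg
    (c.isAdjointable_transplantL2 φ.mapE ψ.mapE) (c.isAdjointable_transplantL2 φ.mapF ψ.mapF) hK'
    fun z => by
      obtain ⟨f, s, hf, hs1, hs2, hs⟩ := exists_seq_of_isClosedRealization hT z
      obtain ⟨h1, h2⟩ := Dom.tendsto_iff.mp hs
      obtain ⟨M, -, hM⟩ := hK'.exists_bound
      have h3 := ((AddMonoidHomClass.continuous_of_bound _ M hM).tendsto z).comp hs
      have h4 := (((c.continuous_transplantL2 φ.mapE ψ.mapE).tendsto _).comp h1).prodMk_nhds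
        ((((c.continuous_transplantL2 φ.mapF ψ.mapF).tendsto _).comp h2).add h3)
      -- For `f` in the core, the pair formed by the transplants of `f` and of `D f`, the latter
      -- corrected by the compact term, is `(c f, D' (c f))`, where `c f` is the transplant of `f`.
      -- It lies in the graph of `T'`, and closedness covers the whole domain.
      refine hreg'.closed.mem_of_tendsto h4 (.of_forall fun n => ?_)
      rw [hT']
      refine subset_closure ⟨c.transplant φ.mapE ψ.mapE (f n), hcore _ (hf n), ?_⟩
      refine Prod.ext ?_ ?_
      · simp only [Function.comp_apply, hs1, transplantL2_toL2]
      · simp only [Function.comp_apply, hs2, LinearMap.comp_apply, hKf _ (hf n) _ (hs1 n),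
          transplantL2_toL2]
        rw [← toL2_add, ← c.apply_transplant_sub p hD hD' hDD' ha hC hp hb, add_sub_cancel]
  exact ⟨S, hS, hS1, hS2 ▸ hK'⟩

end Transplant

/-! ### A transition function on the gluing diagram -/

/-- Compactness is known in one manifold `M`, while closedness is wanted in a piece `V` of another.
An ultrafilter on `N` converging to `p` in `V` also converges in `M`, to a point `r` of the common
piece `W`. The Hausdorff manifold `M'`, in which `V` and `W` are glued, then forces `p = r` there,
so `p` comes from `U`. -/
theorem isClosed_image_of_glued {U V W M M' : Type*} [TopologicalSpace U] [TopologicalSpace V]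
    [TopologicalSpace W] [TopologicalSpace M] [TopologicalSpace M'] [T2Space M']
    {a : U → V} (ha : IsEmbedding a) {b : U → W} {w : W → M} (hw : IsEmbedding w) {v' : V → M'}
    (hv' : Continuous v') {w' : W → M'} (hw' : Continuous w') (hcomm : ∀ x, v' (a x) = w' (b x))
    (hglue : ∀ p r, v' p = w' r → p ∈ range a) {K : Set M} (hK : IsCompact K)
    (hUK : ∀ x, w (b x) ∈ K) {N : Set U} (hN : IsClosed N)
    (hNw : closure ((fun x => w (b x)) '' N) ⊆ range w) : IsClosed (a '' N) := by
  rw [isClosed_iff_ultrafilter]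
  intro p 𝒰 hp hm
  have hr : range a ∈ 𝒰 := Filter.mem_of_superset hm (image_subset_range _ _)
  let 𝒢 : Ultrafilter U := 𝒰.comap ha.injective hr
  have h𝒢 : (𝒢 : Filter U) = Filter.comap a 𝒰 := rfl
  have hN𝒢 : N ∈ 𝒢 := by
    change N ∈ (𝒢 : Filter U)
    rw [h𝒢]
    refine ⟨a '' N, hm, ?_⟩
    rw [preimage_image_eq _ ha.injective]
  have ht : Filter.Tendsto a 𝒢 (𝓝 p) := by
    rw [h𝒢]
    exact Filter.tendsto_comap.mono_right hp
  obtain ⟨x, -, hx⟩ := hK.ultrafilter_le_nhds (𝒢.map fun x => w (b x))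
    (Filter.le_principal_iff.mpr (Filter.mem_map.mpr (Filter.univ_mem' hUK)))
  have hx' : Filter.Tendsto (fun x => w (b x)) 𝒢 (𝓝 x) := hx
  obtain ⟨r, rfl⟩ : x ∈ range w := hNw (isClosed_closure.mem_of_tendsto hx' (by
    filter_upwards [hN𝒢] with y hy using subset_closure ⟨y, hy, rfl⟩))
  have hbr : Filter.Tendsto b 𝒢 (𝓝 r) := hw.tendsto_nhds_iff.mpr hx'
  have h1 : Filter.Tendsto (fun x => v' (a x)) 𝒢 (𝓝 (v' p)) := (hv'.tendsto p).comp ht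
  have h2 : Filter.Tendsto (fun x => v' (a x)) 𝒢 (𝓝 (w' r)) := by
    simp only [hcomm]
    exact (hw'.tendsto r).comp hbr
  obtain ⟨u, rfl⟩ := hglue p r (tendsto_nhds_unique h1 h2)
  refine ⟨u, hN.mem_of_tendsto (ha.tendsto_nhds_iff.mpr ht) hN𝒢, rfl⟩

section Geometry

variable {EM : Type*} [NormedAddCommGroup EM] [NormedSpace ℝ EM]
  {HM : Type*} [TopologicalSpace HM] {I : ModelWithCorners ℝ EM HM}
  {B : Type u} [CStarAlgebra B] [PartialOrder B] [StarOrderedRing B]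

theorem contMDiffAt_of_comp_isLocalDiffeomorphAt {X Y : Type*} [TopologicalSpace X]
    [ChartedSpace HM X] [TopologicalSpace Y] [ChartedSpace HM Y] {F : Type*}
    [NormedAddCommGroup F] [NormedSpace ℝ F] {n : WithTop ℕ∞} {f : X → Y} {x : X}
    (hf : IsLocalDiffeomorphAt I I n f x) {g : Y → F}
    (hg : ContMDiffAt I 𝓘(ℝ, F) n (fun x => g (f x)) x) : ContMDiffAt I 𝓘(ℝ, F) n g (f x) := by
  have h1 : hf.localInverse (f x) = x := hf.localInverse_left_inv hf.localInverse_mem_target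
  have h2 := ContMDiffAt.comp (f x) (h1.symm ▸ hg) hf.localInverse_contMDiffAt
  refine h2.congr_of_eventuallyEq ?_
  filter_upwards [hf.localInverse_eventuallyEq_right] with y hy
  exact congrArg g hy.symm

namespace GluingDiagram

variable (𝔇 : GluingDiagram.{u, v, w} I B)

/-- The embedding of `U` in `M i j`. -/
def uM (i j : Fin 2) (x : 𝔇.U) : 𝔇.M i j := (𝔇.vM i j).toFun ((𝔇.uV i).toFun x)

theorem uM_eq (i j : Fin 2) (x : 𝔇.U) : 𝔇.uM i j x = (𝔇.wM i j).toFun ((𝔇.uW j).toFun x) :=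
  𝔇.comm i j x

theorem isOpenEmbedding_uM (i j : Fin 2) : IsOpenEmbedding (𝔇.uM i j) :=
  (𝔇.vM i j).isOpenEmbedding.comp (𝔇.uV i).isOpenEmbedding

theorem range_inter (i j : Fin 2) :
    range (𝔇.vM i j).toFun ∩ range (𝔇.wM i j).toFun = range (𝔇.uM i j) := 𝔇.inter i j

theorem mem_range_or (i j : Fin 2) (x : 𝔇.M i j) :
    x ∈ range (𝔇.vM i j).toFun ∨ x ∈ range (𝔇.wM i j).toFun := by
  rw [← mem_union, 𝔇.union]
  trivial

theorem mem_range_uV {i j : Fin 2} {p : 𝔇.V i} (h : (𝔇.vM i j).toFun p ∈ range (𝔇.wM i j).toFun) :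
    p ∈ range (𝔇.uV i).toFun := by
  obtain ⟨u, hu⟩ : (𝔇.vM i j).toFun p ∈ range (𝔇.uM i j) := 𝔇.range_inter i j ▸ ⟨⟨p, rfl⟩, h⟩
  exact ⟨u, (𝔇.vM i j).injective hu⟩

theorem mem_range_uW {i j : Fin 2} {r : 𝔇.W j} (h : (𝔇.wM i j).toFun r ∈ range (𝔇.vM i j).toFun) :
    r ∈ range (𝔇.uW j).toFun := by
  obtain ⟨u, hu⟩ : (𝔇.wM i j).toFun r ∈ range (𝔇.uM i j) := 𝔇.range_inter i j ▸ ⟨h, ⟨r, rfl⟩⟩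
  exact ⟨u, (𝔇.wM i j).injective ((𝔇.uM_eq i j u).symm.trans hu)⟩

theorem uM_mem_left (i j : Fin 2) (x : 𝔇.U) : 𝔇.uM i j x ∈ range (𝔇.vM i j).toFun := ⟨_, rfl⟩

theorem uM_mem_right (i j : Fin 2) (x : 𝔇.U) : 𝔇.uM i j x ∈ range (𝔇.wM i j).toFun :=
  ⟨_, (𝔇.uM_eq i j x).symm⟩

/-- Smooth functions on the four manifolds of the diagram, compatible with the diagram, that vanish
near the complement of `W j`, are `1` near the complement of `V i`, and are locally constant outside
a compact subset of `U`. -/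
structure Transition where
  core : Set 𝔇.U
  isCompact_core : IsCompact core
  toFun : ∀ i j, 𝔇.M i j → ℝ
  smooth : ∀ i j, ContMDiff I 𝓘(ℝ) ∞ (toFun i j)
  restrict_left : ∀ i j j' p, toFun i j ((𝔇.vM i j).toFun p) = toFun i j' ((𝔇.vM i j').toFun p)
  restrict_right : ∀ i i' j r, toFun i j ((𝔇.wM i j).toFun r) = toFun i' j ((𝔇.wM i' j).toFun r)
  eventually_eq_zero : ∀ i j x, x ∉ range (𝔇.wM i j).toFun → ∀ᶠ y in 𝓝 x, toFun i j y = 0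
  eventually_eq_one : ∀ i j x, x ∉ range (𝔇.vM i j).toFun → ∀ᶠ y in 𝓝 x, toFun i j y = 1
  eventually_eq : ∀ i j x, x ∉ 𝔇.uM i j '' core → ∀ᶠ y in 𝓝 x, toFun i j y = toFun i j x

section Extend

variable (χ : 𝔇.U → ℝ) (i j : Fin 2)

open Classical in
/-- Extension of a function on `U` by `0` on the rest of `V i` and by `1` elsewhere. -/
noncomputable def extendTransition : 𝔇.M i j → ℝ :=
  Function.extend (𝔇.uM i j) χ fun x => if x ∈ range (𝔇.vM i j).toFun then 0 else 1

theorem extendTransition_uM (x : 𝔇.U) : 𝔇.extendTransition χ i j (𝔇.uM i j x) = χ x :=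
  (𝔇.isOpenEmbedding_uM i j).injective.extend_apply _ _ x

/-- The right side does not mention `j`: on `V i` the extension is by zero whichever `W j` is glued
on. -/
theorem extendTransition_left (p : 𝔇.V i) : 𝔇.extendTransition χ i j ((𝔇.vM i j).toFun p) =
    Function.extend (𝔇.uV i).toFun χ (fun _ => 0) p := by
  by_cases h : ∃ u, (𝔇.uV i).toFun u = p
  · obtain ⟨u, rfl⟩ := h
    rw [(𝔇.uV i).injective.extend_apply]
    exact 𝔇.extendTransition_uM χ i j u
  · rw [Function.extend_apply' _ _ _ h, extendTransition, Function.extend_apply', if_pos ⟨p, rfl⟩]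
    exact fun ⟨u, hu⟩ => h ⟨u, (𝔇.vM i j).injective hu⟩

theorem extendTransition_right (r : 𝔇.W j) : 𝔇.extendTransition χ i j ((𝔇.wM i j).toFun r) =
    Function.extend (𝔇.uW j).toFun χ (fun _ => 1) r := by
  by_cases h : ∃ u, (𝔇.uW j).toFun u = r
  · obtain ⟨u, rfl⟩ := h
    rw [(𝔇.uW j).injective.extend_apply, ← 𝔇.uM_eq]
    exact 𝔇.extendTransition_uM χ i j u
  · rw [Function.extend_apply' _ _ _ h, extendTransition, Function.extend_apply', if_neg]
    · exact fun h' => h (𝔇.mem_range_uW h')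
    · exact fun ⟨u, hu⟩ => h ⟨u, (𝔇.wM i j).injective ((𝔇.uM_eq i j u).symm.trans hu)⟩

variable {χ} {N₀ N₁ : Set 𝔇.U}

/-- A point outside `W j` lies in `V i` and off the closed image of `N₀ᶜ`; nearby points of `V i`
are outside `U` or in `N₀`, and the function is zero on both. -/
theorem eventually_extendTransition_eq_zero (h0 : ∀ x ∈ N₀, χ x = 0)
    (hc : IsClosed ((𝔇.uV i).toFun '' N₀ᶜ)) {x : 𝔇.M i j} (hx : x ∉ range (𝔇.wM i j).toFun) :
    ∀ᶠ y in 𝓝 x, 𝔇.extendTransition χ i j y = 0 := by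
  obtain ⟨p, rfl⟩ := (𝔇.mem_range_or i j x).resolve_right hx
  have hp : p ∉ (𝔇.uV i).toFun '' N₀ᶜ := by
    rintro ⟨u, -, rfl⟩
    exact hx (𝔇.uM_mem_right i j u)
  filter_upwards [(𝔇.vM i j).isOpenEmbedding.isOpenMap.image_mem_nhds (hc.isOpen_compl.mem_nhds hp)]
  rintro - ⟨q, hq, rfl⟩
  rw [extendTransition_left]
  by_cases h : ∃ u, (𝔇.uV i).toFun u = q
  · obtain ⟨u, rfl⟩ := h
    rw [(𝔇.uV i).injective.extend_apply]
    exact h0 u (not_not.mp fun hu => hq ⟨u, hu, rfl⟩)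
  · rw [Function.extend_apply' _ _ _ h]

theorem eventually_extendTransition_eq_one (h1 : ∀ x ∈ N₁, χ x = 1)
    (hc : IsClosed ((𝔇.uW j).toFun '' N₁ᶜ)) {x : 𝔇.M i j} (hx : x ∉ range (𝔇.vM i j).toFun) :
    ∀ᶠ y in 𝓝 x, 𝔇.extendTransition χ i j y = 1 := by
  obtain ⟨r, rfl⟩ := (𝔇.mem_range_or i j x).resolve_left hx
  have hr : r ∉ (𝔇.uW j).toFun '' N₁ᶜ := by
    rintro ⟨u, -, rfl⟩
    exact hx (𝔇.uM_eq i j u ▸ 𝔇.uM_mem_left i j u)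
  filter_upwards [(𝔇.wM i j).isOpenEmbedding.isOpenMap.image_mem_nhds (hc.isOpen_compl.mem_nhds hr)]
  rintro - ⟨q, hq, rfl⟩
  rw [extendTransition_right]
  by_cases h : ∃ u, (𝔇.uW j).toFun u = q
  · obtain ⟨u, rfl⟩ := h
    rw [(𝔇.uW j).injective.extend_apply]
    exact h1 u (not_not.mp fun hu => hq ⟨u, hu, rfl⟩)
  · rw [Function.extend_apply' _ _ _ h]

theorem eventually_extendTransition_uM (x : 𝔇.U) {c : ℝ} (h : ∀ᶠ y in 𝓝 x, χ y = c) :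
    ∀ᶠ y in 𝓝 (𝔇.uM i j x), 𝔇.extendTransition χ i j y = c := by
  filter_upwards [(𝔇.isOpenEmbedding_uM i j).isOpenMap.image_mem_nhds h]
  rintro - ⟨y, hy, rfl⟩
  rw [extendTransition_uM]
  exact hy

/-- A smooth function on `U` that is `0` on the open set `N₀` and `1` on the open set `N₁`, which
contain the respective ends of `U` and the rest of `U` is compact, extends to a transition
function. -/
noncomputable def transitionOfExtend (hχ : ContMDiff I 𝓘(ℝ) ∞ χ) (ho0 : IsOpen N₀)
    (ho1 : IsOpen N₁) (h0 : ∀ x ∈ N₀, χ x = 0) (h1 : ∀ x ∈ N₁, χ x = 1)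
    (hc0 : ∀ i, IsClosed ((𝔇.uV i).toFun '' N₀ᶜ)) (hc1 : ∀ j, IsClosed ((𝔇.uW j).toFun '' N₁ᶜ))
    (hK : IsCompact (N₀ ∪ N₁)ᶜ) : 𝔇.Transition where
  core := (N₀ ∪ N₁)ᶜ
  isCompact_core := hK
  toFun := 𝔇.extendTransition χ
  smooth i j x := by
    by_cases hw : x ∈ range (𝔇.wM i j).toFun
    · by_cases hv : x ∈ range (𝔇.vM i j).toFun
      · obtain ⟨u, rfl⟩ : x ∈ range (𝔇.uM i j) := 𝔇.range_inter i j ▸ ⟨hv, hw⟩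
        refine contMDiffAt_of_comp_isLocalDiffeomorphAt (f := 𝔇.uM i j)
          (((𝔇.uV i).isLocalDiffeomorph u).comp I (𝔇.M i j) ((𝔇.vM i j).isLocalDiffeomorph _)) ?_
        simp only [extendTransition_uM]
        exact hχ u
      · exact contMDiffAt_const.congr_of_eventuallyEq
          (𝔇.eventually_extendTransition_eq_one i j h1 (hc1 j) hv)
    · exact contMDiffAt_const.congr_of_eventuallyEq
        (𝔇.eventually_extendTransition_eq_zero i j h0 (hc0 i) hw)
  restrict_left i j j' p := by rw [extendTransition_left, extendTransition_left]
  restrict_right i i' j r := by rw [extendTransition_right, extendTransition_right]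
  eventually_eq_zero i j x hx := 𝔇.eventually_extendTransition_eq_zero i j h0 (hc0 i) hx
  eventually_eq_one i j x hx := 𝔇.eventually_extendTransition_eq_one i j h1 (hc1 j) hx
  eventually_eq i j x hx := by
    have key : ∀ c, (∀ᶠ y in 𝓝 x, 𝔇.extendTransition χ i j y = c) →
        ∀ᶠ y in 𝓝 x, 𝔇.extendTransition χ i j y = 𝔇.extendTransition χ i j x := by
      intro c h
      rwa [h.self_of_nhds]
    by_cases hw : x ∈ range (𝔇.wM i j).toFun
    · by_cases hv : x ∈ range (𝔇.vM i j).toFun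
      · obtain ⟨u, rfl⟩ : x ∈ range (𝔇.uM i j) := 𝔇.range_inter i j ▸ ⟨hv, hw⟩
        have hu : u ∈ N₀ ∪ N₁ := not_not.mp fun hu => hx ⟨u, hu, rfl⟩
        rcases hu with hu | hu
        · exact key 0 (𝔇.eventually_extendTransition_uM i j u
            (by filter_upwards [ho0.mem_nhds hu] with y hy using h0 y hy))
        · exact key 1 (𝔇.eventually_extendTransition_uM i j u
            (by filter_upwards [ho1.mem_nhds hu] with y hy using h1 y hy))
      · exact key 1 (𝔇.eventually_extendTransition_eq_one i j h1 (hc1 j) hv)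
    · exact key 0 (𝔇.eventually_extendTransition_eq_zero i j h0 (hc0 i) hw)

end Extend

/-- A smooth Urysohn function on `M 0 0` separates the complements of `W 0` and `V 0`. Restricted to
`U`, it is extended anew to all four manifolds. The region of `U` where it is not locally `0` or `1`
is closed in `M 0 0` and contained in the relatively compact set `U`, hence compact. -/
theorem nonempty_transition [FiniteDimensional ℝ EM] : Nonempty 𝔇.Transition := by
  have : LocallyCompactSpace HM := I.locallyCompactSpace
  have : LocallyCompactSpace (𝔇.M 0 0) := ChartedSpace.locallyCompactSpace HM _
  obtain ⟨f, hf0, hf1, -⟩ := exists_contMDiffMap_zero_one_nhds_of_isClosed (M := 𝔇.M 0 0) (n := ⊤) I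
    (𝔇.wM 0 0).isOpenEmbedding.isOpen_range.isClosed_compl
    (𝔇.vM 0 0).isOpenEmbedding.isOpen_range.isClosed_compl (by
      rw [Set.disjoint_compl_left_iff_subset]
      intro x hx
      exact (𝔇.mem_range_or 0 0 x).resolve_left hx)
  have hu := 𝔇.isOpenEmbedding_uM 0 0
  have hr0 : (interior {x | f x = 0})ᶜ ⊆ range (𝔇.wM 0 0).toFun := by
    rw [compl_subset_comm]
    exact fun x hx => mem_interior_iff_mem_nhds.mpr (Filter.eventually_iff.mp
      (Filter.Eventually.filter_mono (nhds_le_nhdsSet hx) hf0))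
  have hr1 : (interior {x | f x = 1})ᶜ ⊆ range (𝔇.vM 0 0).toFun := by
    rw [compl_subset_comm]
    exact fun x hx => mem_interior_iff_mem_nhds.mpr (Filter.eventually_iff.mp
      (Filter.Eventually.filter_mono (nhds_le_nhdsSet hx) hf1))
  have hK : IsCompact (closure (range (𝔇.uM 0 0))) := 𝔇.precompact 0
  have ho0 : IsOpen (𝔇.uM 0 0 ⁻¹' interior {x | f x = 0}) := isOpen_interior.preimage hu.continuous
  have ho1 : IsOpen (𝔇.uM 0 0 ⁻¹' interior {x | f x = 1}) := isOpen_interior.preimage hu.continuous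
  refine ⟨𝔇.transitionOfExtend (χ := fun x => f (𝔇.uM 0 0 x)) (f.contMDiff.comp
    ((𝔇.vM 0 0).isLocalDiffeomorph.contMDiff.comp (𝔇.uV 0).isLocalDiffeomorph.contMDiff))
    ho0 ho1 (fun x hx => interior_subset (s := {x | f x = 0}) hx)
    (fun x hx => interior_subset (s := {x | f x = 1}) hx) (fun i => ?_)
    (fun j => ?_) ?_⟩
  -- Limits exist by compactness in `M 0 0` and land in `W 0`; they are compared with limits in `V
  -- i` inside `M i 0`.
  · refine isClosed_image_of_glued (𝔇.uV i).isOpenEmbedding.isEmbedding (b := (𝔇.uW 0).toFun)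
      (𝔇.wM 0 0).isOpenEmbedding.isEmbedding (𝔇.vM i 0).continuous (𝔇.wM i 0).continuous
      (𝔇.comm i 0) (fun p r h => 𝔇.mem_range_uV (j := 0) ⟨r, h.symm⟩) hK
      (fun x => subset_closure ⟨x, 𝔇.uM_eq 0 0 x⟩)
      ho0.isClosed_compl (Subset.trans (closure_minimal ?_ isOpen_interior.isClosed_compl) hr0)
    rintro - ⟨x, hx, rfl⟩
    dsimp only
    rw [← 𝔇.uM_eq]
    exact hx
  · refine isClosed_image_of_glued (𝔇.uW j).isOpenEmbedding.isEmbedding (b := (𝔇.uV 0).toFun)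
      (𝔇.vM 0 0).isOpenEmbedding.isEmbedding (𝔇.wM 0 j).continuous (𝔇.vM 0 j).continuous
      (fun x => (𝔇.comm 0 j x).symm) (fun r p h => 𝔇.mem_range_uW (i := 0) ⟨p, h.symm⟩) hK
      (fun x => subset_closure ⟨x, rfl⟩) ho1.isClosed_compl
      (Subset.trans (closure_minimal ?_ isOpen_interior.isClosed_compl) hr1)
    rintro - ⟨x, hx, rfl⟩
    exact hx
  · rw [hu.isEmbedding.isCompact_iff, ← preimage_union, ← preimage_compl,
      image_preimage_eq_of_subset]
    · refine hK.of_isClosed_subset (isOpen_interior.union isOpen_interior).isClosed_compl ?_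
      refine Subset.trans ?_ subset_closure
      rw [compl_union, ← 𝔇.range_inter, inter_comm]
      exact inter_subset_inter hr1 hr0
    · rw [compl_union, ← 𝔇.range_inter, inter_comm]
      exact inter_subset_inter hr1 hr0

end GluingDiagram

end Geometry

/-! ### Cutoff functions and transplantation on the gluing diagram -/

section Geometry

variable {EM : Type*} [NormedAddCommGroup EM] [NormedSpace ℝ EM]
  {HM : Type*} [TopologicalSpace HM] {I : ModelWithCorners ℝ EM HM}
  {B : Type u} [CStarAlgebra B] [PartialOrder B] [StarOrderedRing B]

section Pair

variable {X Y Z Z' : BundledManifold.{u, v, w} I B}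

/-- A limit point of the support outside `Z` is impossible, since `g` vanishes near every such
point. -/
theorem OpenEmb.isClosed_image_tsupport (ψ : OpenEmb Z Y) {f : Z → ℝ} {g : Y → ℝ}
    (hfg : ∀ z, f z = g (ψ.toFun z)) (h : ∀ y ∉ range ψ.toFun, ∀ᶠ y' in 𝓝 y, g y' = 0) :
    IsClosed (ψ.toFun '' tsupport f) := by
  refine isClosed_of_closure_subset fun y hy => ?_
  have hy' : y ∈ closure (ψ.toFun '' Function.support f) := by
    refine closure_minimal ?_ isClosed_closure hy
    exact image_closure_subset_closure_image ψ.continuous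
  by_cases hr : y ∈ range ψ.toFun
  · obtain ⟨z, rfl⟩ := hr
    refine ⟨z, ?_, rfl⟩
    rw [tsupport, ψ.isOpenEmbedding.isEmbedding.closure_eq_preimage_closure_image]
    exact hy'
  · obtain ⟨-, h0, z, hz, rfl⟩ := mem_closure_iff_nhds.mp hy' _ (h y hr)
    exact absurd ((hfg z).trans h0) hz

/-- The cutoff function given by smooth functions on `X` and on `Y` that agree on `Z` and vanish
near the complement of `Z`. -/
noncomputable def CutOff.ofPair (φ : OpenEmb Z X) (ψ : OpenEmb Z Y) (g : X → ℝ) (g' : Y → ℝ)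
    (hg : ContMDiff I 𝓘(ℝ) ∞ g) (habs : ∀ x, |g x| ≤ 1)
    (hgg' : ∀ z, g (φ.toFun z) = g' (ψ.toFun z))
    (h : ∀ x ∉ range φ.toFun, ∀ᶠ y in 𝓝 x, g y = 0)
    (h' : ∀ y ∉ range ψ.toFun, ∀ᶠ x in 𝓝 y, g' x = 0) : CutOff φ ψ where
  toFun z := g (φ.toFun z)
  smooth := hg.comp φ.isLocalDiffeomorph.contMDiff
  abs_le _ := habs _
  isClosed_left := φ.isClosed_image_tsupport (fun _ => rfl) h
  isClosed_right := ψ.isClosed_image_tsupport hgg' h'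

namespace CutOff

variable {φ : OpenEmb Z X} {ψ : OpenEmb Z Y} {EX : HermitianBundle.{u, v, w} I B X}
  {EY : HermitianBundle.{u, v, w} I B Y} {EZ : HermitianBundle.{u, v, w} I B Z}
  {Φ : BundleIso φ.toFun EZ EX} {Ψ : BundleIso ψ.toFun EZ EY}

theorem transplantFun_of_notMem_range (c : CutOff φ ψ) (s : ∀ x, EX.fiber x) {y : Y}
    (hy : y ∉ range ψ.toFun) : c.transplantFun Φ Ψ s y = 0 :=
  c.transplantFun_of_notMem s fun h => hy (image_subset_range _ _ h)

theorem transplantFun_transplantFun (c : CutOff φ ψ) (c' : CutOff ψ φ) {g : X → ℝ}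
    (hc : ∀ z, c.toFun z = g (φ.toFun z)) (hc' : ∀ z, c'.toFun z = g (φ.toFun z))
    (hg : ∀ x ∉ range φ.toFun, g x = 0) (s : ∀ x, EX.fiber x) (x : X) :
    c'.transplantFun Ψ Φ (c.transplantFun Φ Ψ s) x = ((g x ^ 2 : ℝ) : ℂ) • s x := by
  by_cases hx : x ∈ range φ.toFun
  · obtain ⟨z, rfl⟩ := hx
    refine (Φ.equiv z).symm.injective ?_
    have h1 := c'.pull_transplantFun (Φ := Ψ) (Ψ := Φ) (c.transplantFun Φ Ψ s) z
    have h2 := Φ.pull_smul (fun x => ((g x ^ 2 : ℝ) : ℂ)) s z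
    rw [c.pull_transplantFun, hc', hc, smul_smul, ← Complex.ofReal_mul, ← sq] at h1
    exact h1.trans h2.symm
  · rw [transplantFun_of_notMem_range _ _ hx, hg x hx]
    simp

end CutOff

theorem BoundaryOp.congr {G : Type*} [AddCommGroup G] [Module B G] (b : BoundaryOp Z G)
    {s t : Z.E.SmoothSec} (h : ∀ x ∈ I.boundary Z, ∀ᶠ y in 𝓝 x, s.1 y = t.1 y) :
    b.toFun s = b.toFun t := by
  have h0 : b.toFun (s - t) = 0 := b.eq_zero _ fun x hx => by
    filter_upwards [h x hx] with y hy
    exact sub_eq_zero.mpr hy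
  rw [map_sub] at h0
  exact sub_eq_zero.mp h0

open HermitianBundle in
/-- Transplantation by a function that is `1` near the boundary preserves boundary values. -/
theorem BoundaryOp.apply_transplant {φ : OpenEmb Z X} {ψ : OpenEmb Z Y} {G : Type*}
    [AddCommGroup G] [Module B G] (b : BoundaryOp Z G) (c : CutOff φ ψ)
    (h : ∀ x ∈ I.boundary Z, ∀ᶠ z in 𝓝 x, c.toFun z = 1) (s : X.E.CcSec) :
    b.toFun (ψ.mapE.pullSmooth (CcSec.toSmooth _ (c.transplant φ.mapE ψ.mapE s))) =
      b.toFun (φ.mapE.pullSmooth (CcSec.toSmooth _ s)) := by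
  refine b.congr fun x hx => ?_
  filter_upwards [h x hx] with z hz
  change ψ.mapE.pull (c.transplantFun φ.mapE ψ.mapE s.1) z = φ.mapE.pull s.1 z
  rw [c.pull_transplantFun, hz, Complex.ofReal_one, one_smul]

open HermitianBundle in
-- The transplant vanishes near every point outside the image of `ψ`, in particular near the
-- boundary of the other piece.
theorem BoundaryOp.apply_transplant_eq_zero {φ : OpenEmb Z X} {ψ : OpenEmb Z Y}
    {ψ' : OpenEmb Z' Y} {G : Type*} [AddCommGroup G] [Module B G] (b : BoundaryOp Z' G)
    (c : CutOff φ ψ) (h : ∀ x ∈ I.boundary Z', ψ'.toFun x ∉ range ψ.toFun) (s : X.E.CcSec) :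
    b.toFun (ψ'.mapE.pullSmooth (CcSec.toSmooth _ (c.transplant φ.mapE ψ.mapE s))) = 0 := by
  refine b.eq_zero _ fun x hx => ?_
  filter_upwards [(ψ'.continuous.tendsto x).eventually (c.eventually_transplantFun_eq_zero
    (Φ := φ.mapE) (Ψ := ψ.mapE) s.1 fun h' => h x hx (image_subset_range _ _ h'))] with z hz
  change (ψ'.mapE.equiv z).symm (c.transplantFun φ.mapE ψ.mapE s.1 _) = 0
  rw [hz, map_zero]

theorem OpenEmb.notMem_range_of_boundary [BoundarylessManifold I X] (φ : OpenEmb X Y) {y : Y}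
    (hy : y ∈ I.boundary Y) : y ∉ range φ.toFun := by
  rintro ⟨x, rfl⟩
  have h : I.IsInteriorPoint (φ.toFun x) :=
    ((φ.isLocalDiffeomorph x).isInteriorPoint_iff (by simp)).mp
      BoundarylessManifold.isInteriorPoint
  exact (I.isInteriorPoint_iff_not_isBoundaryPoint _).mp h hy

open HermitianBundle in
/-- If the cutoff function extends to `X` and is locally constant outside a compact subset of an
open set `O`, and if commutators with functions supported in `O` are relatively compact, then
transplantation acts on the domains of closed realizations and commutes with the operators up to
compact operators. -/
theorem CutOff.exists_transplant_dom_of_commutatorCompact [FiniteDimensional ℝ EM]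
    {φ : OpenEmb Z X} {ψ : OpenEmb Z Y} (c : CutOff φ ψ) {g : X → ℝ}
    (hg : ContMDiff I 𝓘(ℝ) ∞ g) (hgc : ∀ z, c.toFun z = g (φ.toFun z)) {O C : Set X}
    (hO : IsOpen O) (hOφ : O ⊆ range φ.toFun) (hC : IsCompact C) (hCO : C ⊆ O)
    (hgC : ∀ x ∉ C, ∀ᶠ y in 𝓝 x, g y = g x)
    {D : X.E.CcSec →ₗ[B] X.F.CcSec} {D' : Y.E.CcSec →ₗ[B] Y.F.CcSec} (hD : IsDiffOp D)
    (hD' : IsDiffOp D') (hDD' : AgreeOn φ ψ D D')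
    {core : Set X.E.CcSec} {core' : Set Y.E.CcSec}
    (hcore : ∀ f ∈ core, c.transplant φ.mapE ψ.mapE f ∈ core')
    {T : L2 X.E X.μ →ₗ.[B] L2 X.F X.μ} {T' : L2 Y.E Y.μ →ₗ.[B] L2 Y.F Y.μ}
    (hT : X.IsClosedRealization D core T) (hT' : Y.IsClosedRealization D' core' T')
    (hreg : IsRegularOp T) (hreg' : IsRegularOp T')
    (hcomm : ∀ a : C^∞⟮I, X; 𝓘(ℝ, ℂ), ℂ⟯, IsCompact (tsupport a) → tsupport a ⊆ O →
      X.CommutatorCompact D core T a) :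
    ∃ S : Dom T →ₗ[B] Dom T', IsAdjointable S ∧
      Dom.incl T' ∘ₗ S = c.transplantL2 φ.mapE ψ.mapE ∘ₗ Dom.incl T ∧
      IsCompactOp (Dom.op T' ∘ₗ S - c.transplantL2 φ.mapF ψ.mapF ∘ₗ Dom.op T) := by
  have : LocallyCompactSpace HM := I.locallyCompactSpace
  have : LocallyCompactSpace X := ChartedSpace.locallyCompactSpace HM _
  -- Two nested compact neighbourhoods `C ⊂ L ⊂ L' ⊂ O`: the function `q₁` is `1` near `C` and lives
  -- in `L`, and `q` is `1` near `L` and lives in `L'`. So `p = q₁` and `b = g q` meet the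
  -- requirements, and `b` has compact support in `O`.
  obtain ⟨L, hL, hCL, hLO⟩ := exists_compact_between hC hO hCO
  obtain ⟨L', hL', hLL', hLO'⟩ := exists_compact_between hL hO hLO
  obtain ⟨q₁, h1, h1', h1''⟩ := exists_contMDiffMap_one_nhds_of_subset_interior (n := ⊤) I
    hC.isClosed hCL
  obtain ⟨q, hq, hq', -⟩ := exists_contMDiffMap_one_nhds_of_subset_interior (n := ⊤) I
    hL.isClosed hLL'
  have hcpt : IsCompact (tsupport fun z => q₁ (φ.toFun z)) := by
    refine (φ.isOpenEmbedding.isInducing.isCompact_preimage' hL (hLO.trans hOφ)).of_isClosed_subset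
      (isClosed_tsupport _)
      (closure_minimal (fun z hz => ?_) (hL.isClosed.preimage φ.continuous))
    by_contra h
    exact hz (h1' _ h)
  have ha : ContMDiff I 𝓘(ℝ, ℂ) ∞ fun x => (g x : ℂ) := Complex.ofRealCLM.contMDiff.comp hg
  have hb : ContMDiff I 𝓘(ℝ, ℂ) ∞ fun x => ((g x * q x : ℝ) : ℂ) :=
    Complex.ofRealCLM.contMDiff.comp (hg.mul q.contMDiff)
  have hsub : (tsupport fun x => ((g x * q x : ℝ) : ℂ)) ⊆ L' := by
    refine closure_minimal (fun x hx => ?_) hL'.isClosed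
    by_contra h
    exact hx (by simp [hq' x h])
  refine c.exists_transplant_dom ⟨fun z => q₁ (φ.toFun z),
    q₁.contMDiff.comp φ.isLocalDiffeomorph.contMDiff, fun z => ?_,
    (hcpt.image φ.continuous).isClosed, (hcpt.image ψ.continuous).isClosed⟩ hD hD' hDD'
    (a := ⟨fun x => (g x : ℂ), ha⟩) (b := ⟨fun x => ((g x * q x : ℝ) : ℂ), hb⟩)
    (fun z => congrArg Complex.ofReal (hgc z).symm) (C := C) (fun x hx => ?_) (fun z hz => ?_)
    (fun z hz => ?_) hcore hT hT' hreg hreg' (hcomm _ ?_ ?_)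
  · exact _root_.abs_le.mpr ⟨by linarith [(h1'' (φ.toFun z)).1], (h1'' (φ.toFun z)).2⟩
  · filter_upwards [hgC x hx] with y hy
    exact congrArg Complex.ofReal hy
  · exact h1.self_of_nhdsSet _ hz
  · have hzL : φ.toFun z ∈ L := by
      by_contra h
      exact hz (h1' _ h)
    filter_upwards [hq.filter_mono (nhds_le_nhdsSet hzL)] with x hx
    change ((g x * q x : ℝ) : ℂ) = g x
    rw [hx, mul_one]
  · exact hL'.of_isClosed_subset (isClosed_tsupport _) hsub
  · exact hsub.trans hLO'

end Pair

end Geometry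

/-! ### The rotation relations between transplantations along `V i` and `W j`. -/

section Geometry

variable {EM : Type*} [NormedAddCommGroup EM] [NormedSpace ℝ EM]
  {HM : Type*} [TopologicalSpace HM] {I : ModelWithCorners ℝ EM HM}
  {B : Type u} [CStarAlgebra B] [PartialOrder B] [StarOrderedRing B]

namespace GluingDiagram

variable (𝔇 : GluingDiagram.{u, v, w} I B)

/-- A bundle over each manifold of the diagram, satisfying the same diagram. -/
structure BundleDiagram where
  U : HermitianBundle.{u, v, w} I B 𝔇.U
  V : ∀ i, HermitianBundle.{u, v, w} I B (𝔇.V i)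
  W : ∀ j, HermitianBundle.{u, v, w} I B (𝔇.W j)
  M : ∀ i j, HermitianBundle.{u, v, w} I B (𝔇.M i j)
  uV : ∀ i, BundleIso (𝔇.uV i).toFun U (V i)
  uW : ∀ j, BundleIso (𝔇.uW j).toFun U (W j)
  vM : ∀ i j, BundleIso (𝔇.vM i j).toFun (V i) (M i j)
  wM : ∀ i j, BundleIso (𝔇.wM i j).toFun (W j) (M i j)
  comm : ∀ i j (s : ∀ y, (M i j).fiber y),
    (uV i).pull ((vM i j).pull s) = (uW j).pull ((wM i j).pull s)

/-- The bundles `E`. -/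
@[reducible] noncomputable def bundleE : 𝔇.BundleDiagram where
  U := 𝔇.U.E
  V i := (𝔇.V i).E
  W j := (𝔇.W j).E
  M i j := (𝔇.M i j).E
  uV i := (𝔇.uV i).mapE
  uW j := (𝔇.uW j).mapE
  vM i j := (𝔇.vM i j).mapE
  wM i j := (𝔇.wM i j).mapE
  comm := 𝔇.commE

/-- The bundles `F`. -/
@[reducible] noncomputable def bundleF : 𝔇.BundleDiagram where
  U := 𝔇.U.F
  V i := (𝔇.V i).F
  W j := (𝔇.W j).F
  M i j := (𝔇.M i j).F
  uV i := (𝔇.uV i).mapF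
  uW j := (𝔇.uW j).mapF
  vM i j := (𝔇.vM i j).mapF
  wM i j := (𝔇.wM i j).mapF
  comm := 𝔇.commF

namespace Transition

variable {𝔇} (χ : 𝔇.Transition)

/-- `cos (π χ / 2)`. -/
noncomputable def cosFun (i j : Fin 2) (x : 𝔇.M i j) : ℝ := Real.cos (Real.pi / 2 * χ.toFun i j x)

/-- `sin (π χ / 2)`. -/
noncomputable def sinFun (i j : Fin 2) (x : 𝔇.M i j) : ℝ := Real.sin (Real.pi / 2 * χ.toFun i j x)

theorem contMDiff_cosFun (i j : Fin 2) : ContMDiff I 𝓘(ℝ) ∞ (χ.cosFun i j) :=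
  (Real.contDiff_cos.comp (contDiff_const.mul contDiff_id)).contMDiff.comp (χ.smooth i j)

theorem contMDiff_sinFun (i j : Fin 2) : ContMDiff I 𝓘(ℝ) ∞ (χ.sinFun i j) :=
  (Real.contDiff_sin.comp (contDiff_const.mul contDiff_id)).contMDiff.comp (χ.smooth i j)

theorem eventually_cosFun_eq_zero {i j : Fin 2} {x : 𝔇.M i j} (hx : x ∉ range (𝔇.vM i j).toFun) :
    ∀ᶠ y in 𝓝 x, χ.cosFun i j y = 0 := by
  filter_upwards [χ.eventually_eq_one i j x hx] with y hy
  rw [cosFun, hy, mul_one, Real.cos_pi_div_two]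

theorem eventually_cosFun_eq_one {i j : Fin 2} {x : 𝔇.M i j} (hx : x ∉ range (𝔇.wM i j).toFun) :
    ∀ᶠ y in 𝓝 x, χ.cosFun i j y = 1 := by
  filter_upwards [χ.eventually_eq_zero i j x hx] with y hy
  rw [cosFun, hy, mul_zero, Real.cos_zero]

theorem eventually_sinFun_eq_zero {i j : Fin 2} {x : 𝔇.M i j} (hx : x ∉ range (𝔇.wM i j).toFun) :
    ∀ᶠ y in 𝓝 x, χ.sinFun i j y = 0 := by
  filter_upwards [χ.eventually_eq_zero i j x hx] with y hy
  rw [sinFun, hy, mul_zero, Real.sin_zero]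

theorem eventually_sinFun_eq_one {i j : Fin 2} {x : 𝔇.M i j} (hx : x ∉ range (𝔇.vM i j).toFun) :
    ∀ᶠ y in 𝓝 x, χ.sinFun i j y = 1 := by
  filter_upwards [χ.eventually_eq_one i j x hx] with y hy
  rw [sinFun, hy, mul_one, Real.sin_pi_div_two]

theorem cosFun_left (i j j' : Fin 2) (p : 𝔇.V i) :
    χ.cosFun i j ((𝔇.vM i j).toFun p) = χ.cosFun i j' ((𝔇.vM i j').toFun p) := by
  rw [cosFun, cosFun, χ.restrict_left i j j']

theorem sinFun_right (i i' j : Fin 2) (r : 𝔇.W j) :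
    χ.sinFun i j ((𝔇.wM i j).toFun r) = χ.sinFun i' j ((𝔇.wM i' j).toFun r) := by
  rw [sinFun, sinFun, χ.restrict_right i i' j]

/-- Two corners of the diagram are joined by changing `j` along `V i` and then `i` along `W j'`. -/
theorem toFun_uM (i j i' j' : Fin 2) (x : 𝔇.U) :
    χ.toFun i j (𝔇.uM i j x) = χ.toFun i' j' (𝔇.uM i' j' x) := by
  have h := χ.restrict_left i j j' ((𝔇.uV i).toFun x)
  rw [𝔇.comm i j', χ.restrict_right i i' j', ← 𝔇.comm i' j'] at h
  exact h

/-- The cutoff function `cos (π χ / 2)` on `V i`. -/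
noncomputable def cutV (i j j' : Fin 2) : CutOff (𝔇.vM i j) (𝔇.vM i j') :=
  .ofPair _ _ (χ.cosFun i j) (χ.cosFun i j') (χ.contMDiff_cosFun i j)
    (fun _ => Real.abs_cos_le_one _) (χ.cosFun_left i j j')
    (fun _ hx => χ.eventually_cosFun_eq_zero hx) (fun _ hx => χ.eventually_cosFun_eq_zero hx)

/-- The cutoff function `sin (π χ / 2)` on `W j`. -/
noncomputable def cutW (i i' j : Fin 2) : CutOff (𝔇.wM i j) (𝔇.wM i' j) :=
  .ofPair _ _ (χ.sinFun i j) (χ.sinFun i' j) (χ.contMDiff_sinFun i j)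
    (fun _ => Real.abs_sin_le_one _) (χ.sinFun_right i i' j)
    (fun _ hx => χ.eventually_sinFun_eq_zero hx) (fun _ hx => χ.eventually_sinFun_eq_zero hx)

theorem cutV_apply (i j j' : Fin 2) (p : 𝔇.V i) :
    (χ.cutV i j j').toFun p = χ.cosFun i j ((𝔇.vM i j).toFun p) := rfl

theorem cutW_apply (i i' j : Fin 2) (r : 𝔇.W j) :
    (χ.cutW i i' j).toFun r = χ.sinFun i j ((𝔇.wM i j).toFun r) := rfl

section Relations

variable (𝔈 : 𝔇.BundleDiagram)

/-- Transplantation along `V i` of `L²`-sections. -/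
noncomputable abbrev shiftV (i j j' : Fin 2) :
    L2 (𝔈.M i j) (𝔇.M i j).μ →ₗ[B] L2 (𝔈.M i j') (𝔇.M i j').μ :=
  (χ.cutV i j j').transplantL2 (𝔈.vM i j) (𝔈.vM i j')

/-- Transplantation along `W j` of `L²`-sections. -/
noncomputable abbrev shiftW (i i' j : Fin 2) :
    L2 (𝔈.M i j) (𝔇.M i j).μ →ₗ[B] L2 (𝔈.M i' j) (𝔇.M i' j).μ :=
  (χ.cutW i i' j).transplantL2 (𝔈.wM i j) (𝔈.wM i' j)

/-- Going there and back along `V i` multiplies by `cos²`, along `W j` by `sin²`. It suffices to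
check this on sections, by density. -/
theorem shiftV_shiftV_add (i i' j j' : Fin 2) :
    χ.shiftV 𝔈 i j' j ∘ₗ χ.shiftV 𝔈 i j j' + χ.shiftW 𝔈 i' i j ∘ₗ χ.shiftW 𝔈 i i' j =
      LinearMap.id := by
  have hV := fun j j' => (χ.cutV i j j').isAdjointable_transplantL2 (𝔈.vM i j) (𝔈.vM i j')
  have hW := fun i i' => (χ.cutW i i' j).isAdjointable_transplantL2 (𝔈.wM i j) (𝔈.wM i' j)
  refine IsAdjointable.ext_toL2 (((hV _ _).comp (hV _ _)).add ((hW _ _).comp (hW _ _)))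
    IsAdjointable.id fun s => ?_
  simp only [LinearMap.add_apply, LinearMap.comp_apply, CutOff.transplantL2_toL2,
    LinearMap.id_apply]
  rw [← toL2_add]
  congr 1
  ext x
  change (χ.cutV i j' j).transplantFun _ _ ((χ.cutV i j j').transplantFun _ _ s.1) x +
    (χ.cutW i' i j).transplantFun _ _ ((χ.cutW i i' j).transplantFun _ _ s.1) x = s.1 x
  rw [CutOff.transplantFun_transplantFun _ _ (χ.cutV_apply i j j')
      (fun p => (χ.cosFun_left i j j' p).symm)
      (fun x hx => (χ.eventually_cosFun_eq_zero hx).self_of_nhds),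
    CutOff.transplantFun_transplantFun _ _ (χ.cutW_apply i i' j)
      (fun p => (χ.sinFun_right i i' j p).symm)
      (fun x hx => (χ.eventually_sinFun_eq_zero hx).self_of_nhds),
    ← add_smul, ← Complex.ofReal_add, cosFun, sinFun, Real.cos_sq_add_sin_sq, Complex.ofReal_one,
    one_smul]

theorem pull_transplantFun_cutV (i j j' : Fin 2) (s : ∀ x, (𝔈.M i j).fiber x) (u : 𝔇.U) :
    (𝔈.uV i).pull ((𝔈.vM i j').pull
        ((χ.cutV i j j').transplantFun (𝔈.vM i j) (𝔈.vM i j') s)) u =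
      (χ.cosFun i j (𝔇.uM i j u) : ℂ) • (𝔈.uV i).pull ((𝔈.vM i j).pull s) u := by
  rw [uM, ← BundleIso.pull_smul (𝔈.uV i) (fun p => (χ.cosFun i j ((𝔇.vM i j).toFun p) : ℂ))]
  congr 1
  ext p
  exact (χ.cutV i j j').pull_transplantFun s p

theorem pull_transplantFun_cutW (i i' j : Fin 2) (s : ∀ x, (𝔈.M i j).fiber x) (u : 𝔇.U) :
    (𝔈.uW j).pull ((𝔈.wM i' j).pull
        ((χ.cutW i i' j).transplantFun (𝔈.wM i j) (𝔈.wM i' j) s)) u =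
      (χ.sinFun i j (𝔇.uM i j u) : ℂ) • (𝔈.uW j).pull ((𝔈.wM i j).pull s) u := by
  rw [uM_eq, ← BundleIso.pull_smul (𝔈.uW j) (fun p => (χ.sinFun i j ((𝔇.wM i j).toFun p) : ℂ))]
  congr 1
  ext p
  exact (χ.cutW i i' j).pull_transplantFun s p

/-- A point of `V i` outside `W j'` is not in `U`, so its counterpart in `M i j` is outside `W j`,
where `s` vanishes. -/
theorem transplantFun_cutV_of_notMem (i j j' : Fin 2) {s : ∀ x, (𝔈.M i j).fiber x}
    (hs : ∀ x ∉ range (𝔇.wM i j).toFun, s x = 0) {y : 𝔇.M i j'}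
    (hy : y ∉ range (𝔇.wM i j').toFun) :
    (χ.cutV i j j').transplantFun (𝔈.vM i j) (𝔈.vM i j') s y = 0 := by
  obtain ⟨p, rfl⟩ := (𝔇.mem_range_or i j' y).resolve_right hy
  rw [CutOff.transplantFun_apply, BundleIso.pull, hs, map_zero, smul_zero, map_zero]
  intro h
  obtain ⟨u, rfl⟩ := 𝔇.mem_range_uV h
  exact hy (𝔇.uM_mem_right i j' u)

theorem transplantFun_cutW_of_notMem (i i' j : Fin 2) {s : ∀ x, (𝔈.M i j).fiber x}
    (hs : ∀ x ∉ range (𝔇.vM i j).toFun, s x = 0) {y : 𝔇.M i' j}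
    (hy : y ∉ range (𝔇.vM i' j).toFun) :
    (χ.cutW i i' j).transplantFun (𝔈.wM i j) (𝔈.wM i' j) s y = 0 := by
  obtain ⟨p, rfl⟩ := (𝔇.mem_range_or i' j y).resolve_left hy
  rw [CutOff.transplantFun_apply, BundleIso.pull, hs, map_zero, smul_zero, map_zero]
  intro h
  obtain ⟨u, rfl⟩ := 𝔇.mem_range_uW h
  exact hy (𝔇.uM_eq i' j u ▸ 𝔇.uM_mem_left i' j u)

/-- Outside `U` both sides vanish. Over `U` both multiply by `sin · cos` of the same function, and
the commuting diagram of bundles identifies the two transports. -/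
theorem transplantFun_comm (i i' j j' : Fin 2) (s : ∀ x, (𝔈.M i j).fiber x) :
    (χ.cutV i' j j').transplantFun (𝔈.vM i' j) (𝔈.vM i' j')
        ((χ.cutW i i' j).transplantFun (𝔈.wM i j) (𝔈.wM i' j) s) =
      (χ.cutW i i' j').transplantFun (𝔈.wM i j') (𝔈.wM i' j')
        ((χ.cutV i j j').transplantFun (𝔈.vM i j) (𝔈.vM i j') s) := by
  ext y
  by_cases hv : y ∈ range (𝔇.vM i' j').toFun
  · by_cases hw : y ∈ range (𝔇.wM i' j').toFun
    · obtain ⟨u, rfl⟩ : y ∈ range (𝔇.uM i' j') := 𝔇.range_inter i' j' ▸ ⟨hv, hw⟩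
      refine ((𝔈.vM i' j').equiv ((𝔇.uV i').toFun u)).symm.injective
        (((𝔈.uV i').equiv u).symm.injective ?_)
      have h : ∀ t : ∀ x, (𝔈.M i' j').fiber x, ((𝔈.uV i').equiv u).symm
          (((𝔈.vM i' j').equiv ((𝔇.uV i').toFun u)).symm (t (𝔇.uM i' j' u))) =
          (𝔈.uV i').pull ((𝔈.vM i' j').pull t) u := fun _ => rfl
      rw [h, h, pull_transplantFun_cutV, 𝔈.comm, pull_transplantFun_cutW, 𝔈.comm,
        pull_transplantFun_cutW, ← 𝔈.comm, ← 𝔈.comm, pull_transplantFun_cutV, smul_comm]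
      simp only [cosFun, sinFun]
      rw [χ.toFun_uM i' j i j, χ.toFun_uM i j' i j]
    · rw [CutOff.transplantFun_of_notMem_range _ _ hw]
      exact χ.transplantFun_cutV_of_notMem 𝔈 i' j j'
        (fun x hx => CutOff.transplantFun_of_notMem_range _ _ hx) hw
  · rw [CutOff.transplantFun_of_notMem_range _ _ hv]
    exact (χ.transplantFun_cutW_of_notMem 𝔈 i i' j'
      (fun x hx => CutOff.transplantFun_of_notMem_range _ _ hx) hv).symm

theorem shiftV_shiftW (i i' j j' : Fin 2) :
    χ.shiftV 𝔈 i' j j' ∘ₗ χ.shiftW 𝔈 i i' j = χ.shiftW 𝔈 i i' j' ∘ₗ χ.shiftV 𝔈 i j j' := by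
  have hV := fun i j j' => (χ.cutV i j j').isAdjointable_transplantL2 (𝔈.vM i j) (𝔈.vM i j')
  have hW := fun i i' j => (χ.cutW i i' j).isAdjointable_transplantL2 (𝔈.wM i j) (𝔈.wM i' j)
  refine IsAdjointable.ext_toL2 ((hV _ _ _).comp (hW _ _ _)) ((hW _ _ _).comp (hV _ _ _))
    fun s => ?_
  simp only [LinearMap.comp_apply, CutOff.transplantL2_toL2]
  congr 1
  exact Subtype.ext (χ.transplantFun_comm 𝔈 i i' j j' s.1)

end Relations

end Transition

end GluingDiagram

end Geometry

/-! ### Squares of modules and operators with rotation relations. -/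

section Square

variable {B : Type u} [CStarAlgebra B] [PartialOrder B] [StarOrderedRing B]
variable {X : Fin 2 → Fin 2 → Type*} [∀ i j, AddCommGroup (X i j)] [∀ i j, Module B (X i j)]

/-- The isomorphism `X₀₀ ⊕ X₁₁ ≅ X₀₁ ⊕ X₁₀` given by the rotation matrix formed by maps along the
rows and the columns of a square of modules. -/
def squareEquiv (S : ∀ i j j', X i j →ₗ[B] X i j') (R : ∀ i i' j, X i j →ₗ[B] X i' j)
    (h : ∀ i i' j j', S i j' j ∘ₗ S i j j' + R i' i j ∘ₗ R i i' j = LinearMap.id)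
    (hc : ∀ i i' j j', S i' j j' ∘ₗ R i i' j = R i i' j' ∘ₗ S i j j') :
    (X 0 0 × X 1 1) ≃ₗ[B] X 0 1 × X 1 0 := by
  -- The matrices have rows `(S, R)`, `(-R, S)` and `(S, -R)`, `(R, S)`. In the products the
  -- diagonal entries are `S S + R R = 1`, and the others cancel because `S` and `R` commute.
  refine LinearEquiv.ofLinearMap
    (((S 0 0 1).coprod (R 1 0 1)).prod ((-R 0 1 0).coprod (S 1 1 0)))
    (((S 0 1 0).coprod (-R 1 0 0)).prod ((R 0 1 1).coprod (S 1 0 1))) ?_ ?_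
  all_goals
    have h' := fun i i' j j' x => LinearMap.congr_fun (h i i' j j') x
    have hc' := fun i i' j j' x => LinearMap.congr_fun (hc i i' j j') x
    simp only [LinearMap.add_apply, LinearMap.comp_apply, LinearMap.id_apply] at h' hc'
    refine LinearMap.ext fun x => Prod.ext ?_ ?_
  · have h1 := h' 0 1 1 0 x.1
    have h2 := hc' 1 0 0 1 x.2
    refine Eq.trans ?_ h1
    simp [h2]
    abel
  · have h1 := h' 1 0 0 1 x.2
    have h2 := hc' 0 1 1 0 x.1
    refine Eq.trans ?_ h1
    simp [h2]
    abel
  · have h1 := h' 0 1 0 1 x.1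
    have h2 := hc' 1 0 1 0 x.2
    refine Eq.trans ?_ h1
    simp [h2]
  · have h1 := h' 1 0 1 0 x.2
    have h2 := hc' 0 1 0 1 x.1
    refine Eq.trans ?_ h1
    simp [h2]
    abel

end Square

section Square

variable {B : Type u} [CStarAlgebra B] [PartialOrder B] [StarOrderedRing B]
variable {X Y : Fin 2 → Fin 2 → Type*}
  [∀ i j, NormedAddCommGroup (X i j)] [∀ i j, NormedSpace ℂ (X i j)] [∀ i j, Module B (X i j)]
  [∀ i j, CStarModule B (X i j)] [∀ i j, CompleteSpace (X i j)]
  [∀ i j, NormedAddCommGroup (Y i j)] [∀ i j, NormedSpace ℂ (Y i j)] [∀ i j, Module B (Y i j)]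
  [∀ i j, CStarModule B (Y i j)] [∀ i j, CompleteSpace (Y i j)]

/-- The abstract relative index theorem: a square of operators on Hilbert modules intertwined, up
to compact operators, by maps along rows and columns that form rotation matrices. -/
theorem square_index {T : ∀ i j, X i j →ₗ[B] Y i j} (hT : ∀ i j, IsAdjointable (T i j))
    {S : ∀ i j j', X i j →ₗ[B] X i j'} {R : ∀ i i' j, X i j →ₗ[B] X i' j}
    {S' : ∀ i j j', Y i j →ₗ[B] Y i j'} {R' : ∀ i i' j, Y i j →ₗ[B] Y i' j}
    (hS : ∀ i j j', IsAdjointable (S i j j')) (hR : ∀ i i' j, IsAdjointable (R i i' j))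
    (hS' : ∀ i j j', IsAdjointable (S' i j j')) (hR' : ∀ i i' j, IsAdjointable (R' i i' j))
    (h : ∀ i i' j j', S i j' j ∘ₗ S i j j' + R i' i j ∘ₗ R i i' j = LinearMap.id)
    (hc : ∀ i i' j j', S i' j j' ∘ₗ R i i' j = R i i' j' ∘ₗ S i j j')
    (h' : ∀ i i' j j', S' i j' j ∘ₗ S' i j j' + R' i' i j ∘ₗ R' i i' j = LinearMap.id)
    (hc' : ∀ i i' j j', S' i' j j' ∘ₗ R' i i' j = R' i i' j' ∘ₗ S' i j j')
    (hTS : ∀ i j j', IsCompactOp (T i j' ∘ₗ S i j j' - S' i j j' ∘ₗ T i j))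
    (hTR : ∀ i i' j, IsCompactOp (T i' j ∘ₗ R i i' j - R' i i' j ∘ₗ T i j)) :
    ((IsFredholm (T 0 0) ∧ IsFredholm (T 1 1)) ↔ (IsFredholm (T 0 1) ∧ IsFredholm (T 1 0))) ∧
    (IsFredholm (T 0 0) ∧ IsFredholm (T 1 1) →
      index (T 0 0) + index (T 1 1) = index (T 0 1) + index (T 1 0)) := by
  -- The two neighbours of the corner `(i, j)` are reached by `S` along the row and by `R` along the
  -- column, and `S S + R R = 1` makes `T i j` a summand of their sum.
  have key : ∀ i i' j j', IsFredholm (T i j') → IsFredholm (T i' j) → IsFredholm (T i j) :=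
    fun i i' j j' h₀ h₁ => h₀.of_summand h₁ (hT i j) (hS i j' j) (hR i' i j) (hS i j j')
      (hR i i' j) (hS' i j' j) (hR' i' i j) (hS' i j j') (hR' i i' j) (h i i' j j') (h' i i' j j')
      (hTS i j' j) (hTR i' i j) (hTS i j j') (hTR i i' j)
  have hiff : (IsFredholm (T 0 0) ∧ IsFredholm (T 1 1)) ↔
      (IsFredholm (T 0 1) ∧ IsFredholm (T 1 0)) :=
    ⟨fun hf => ⟨key 0 1 1 0 hf.1 hf.2, key 1 0 0 1 hf.2 hf.1⟩,
      fun hf => ⟨key 0 1 0 1 hf.1 hf.2, key 1 0 1 0 hf.2 hf.1⟩⟩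
  refine ⟨hiff, fun hf => ?_⟩
  obtain ⟨h01, h10⟩ := hiff.mp hf
  refine index_add_index_eq hf.1 hf.2 h01 h10 (hS' 0 1 0) (hR' 1 0 0).neg (hR' 0 1 1) (hS' 1 0 1)
    (squareEquiv S R h hc) rfl (squareEquiv S' R' h' hc') rfl rfl (hTS 0 0 1) (hTR 1 0 1) ?_
    (hTS 1 1 0)
  -- The lower left entry of both rotation matrices is `-R`, so its defect is minus that of `R`.
  convert (hTR 0 1 0).neg using 1
  rw [LinearMap.comp_neg, LinearMap.neg_comp]
  abel

end Square

/-! ### The relative index theorem -/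

section Geometry

variable {EM : Type*} [NormedAddCommGroup EM] [NormedSpace ℝ EM] [FiniteDimensional ℝ EM]
  {HM : Type*} [TopologicalSpace HM] {I : ModelWithCorners ℝ EM HM}
  {B : Type u} [CStarAlgebra B] [PartialOrder B] [StarOrderedRing B]

section AgreeOn

variable {X Y Z : BundledManifold.{u, v, w} I B}

theorem AgreeOn.symm {φ : OpenEmb Z X} {ψ : OpenEmb Z Y} {D : X.E.CcSec →ₗ[B] X.F.CcSec}
    {D' : Y.E.CcSec →ₗ[B] Y.F.CcSec} (h : AgreeOn φ ψ D D') : AgreeOn ψ φ D' D :=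
  fun s t hst => (h t s hst.symm).symm

/-- Locality of `D` over the open image. This covers the degenerate index pairs `j = j'` and `i =
i'` in the square. -/
theorem AgreeOn.refl (φ : OpenEmb Z X) {D : X.E.CcSec →ₗ[B] X.F.CcSec}
    (hD : HermitianBundle.IsDiffOp D) : AgreeOn φ φ D D := fun s t hst => by
  ext z
  refine congrArg (φ.mapF.equiv z).symm (hD.apply_congr ?_)
  filter_upwards [φ.isOpenEmbedding.isOpen_range.mem_nhds ⟨z, rfl⟩]
  rintro - ⟨z', rfl⟩
  exact (φ.mapE.equiv z').symm.injective (congrFun hst z')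

end AgreeOn

namespace GluingDiagram.Transition

variable {𝔇 : GluingDiagram.{u, v, w} I B} (χ : 𝔇.Transition)
  {D : ∀ i j, (𝔇.M i j).E.CcSec →ₗ[B] (𝔇.M i j).F.CcSec}
  {GV GW : Fin 2 → Type*}
  [∀ i, AddCommGroup (GV i)] [∀ i, Module B (GV i)]
  [∀ j, AddCommGroup (GW j)] [∀ j, Module B (GW j)]
  (bV : ∀ i, BoundaryOp (𝔇.V i) (GV i)) (bW : ∀ j, BoundaryOp (𝔇.W j) (GW j))
  {T : ∀ i j, L2 (𝔇.M i j).E (𝔇.M i j).μ →ₗ.[B] L2 (𝔇.M i j).F (𝔇.M i j).μ}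

/-- A point of `V i` that lies in `W j` comes from `U`, and `U`, being open and without boundary,
contains only interior points of `V i`. -/
theorem notMem_range_wM {i j : Fin 2} {p : 𝔇.V i} (hp : p ∈ I.boundary (𝔇.V i)) :
    (𝔇.vM i j).toFun p ∉ range (𝔇.wM i j).toFun := by
  have := 𝔇.boundaryless
  exact fun h => (𝔇.uV i).notMem_range_of_boundary hp (𝔇.mem_range_uV h)

theorem notMem_range_vM {i j : Fin 2} {r : 𝔇.W j} (hr : r ∈ I.boundary (𝔇.W j)) :
    (𝔇.wM i j).toFun r ∉ range (𝔇.vM i j).toFun := by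
  have := 𝔇.boundaryless
  exact fun h => (𝔇.uW j).notMem_range_of_boundary hr (𝔇.mem_range_uW h)

/-- Near `∂V i` the cutoff `cos (π χ / 2)` is `1`, so the boundary values are unchanged; near `∂W
j'`, which misses `V i`, the transplant vanishes. -/
theorem transplant_cutV_mem_bcSections (i j j' : Fin 2) {f : (𝔇.M i j).E.CcSec}
    (hf : f ∈ 𝔇.bcSections bV bW i j) :
    (χ.cutV i j j').transplant (𝔇.vM i j).mapE (𝔇.vM i j').mapE f ∈ 𝔇.bcSections bV bW i j' :=
  ⟨((bV i).apply_transplant _ (fun p hp => ((𝔇.vM i j).continuous.tendsto p).eventually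
      (χ.eventually_cosFun_eq_one (notMem_range_wM hp))) f).trans hf.1,
    (bW j').apply_transplant_eq_zero _ (fun _ hr => notMem_range_vM hr) f⟩

theorem transplant_cutW_mem_bcSections (i i' j : Fin 2) {f : (𝔇.M i j).E.CcSec}
    (hf : f ∈ 𝔇.bcSections bV bW i j) :
    (χ.cutW i i' j).transplant (𝔇.wM i j).mapE (𝔇.wM i' j).mapE f ∈ 𝔇.bcSections bV bW i' j :=
  ⟨(bV i').apply_transplant_eq_zero _ (fun _ hr => notMem_range_wM hr) f,
    ((bW j).apply_transplant _ (fun p hp => ((𝔇.wM i j).continuous.tendsto p).eventually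
      (χ.eventually_sinFun_eq_one (notMem_range_vM hp))) f).trans hf.2⟩

/-- Outside the compact core of `χ` in `U` the cutoff is locally constant, so only commutators with
functions supported in `U` enter. -/
theorem exists_shiftV_dom
    (hD : ∀ i j, HermitianBundle.IsDiffOp (D i j))
    (hT : ∀ i j, (𝔇.M i j).IsClosedRealization (D i j) (𝔇.bcSections bV bW i j) (T i j))
    (hreg : ∀ i j, IsRegularOp (T i j))
    (hcomm : ∀ i j (a : C^∞⟮I, 𝔇.M i j; 𝓘(ℝ, ℂ), ℂ⟯), IsCompact (tsupport a) →
      tsupport a ⊆ range (𝔇.uM i j) →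
      (𝔇.M i j).CommutatorCompact (D i j) (𝔇.bcSections bV bW i j) (T i j) a)
    {i j j' : Fin 2}
    (hV : AgreeOn (𝔇.vM i j) (𝔇.vM i j') (D i j) (D i j')) :
    ∃ S : Dom (T i j) →ₗ[B] Dom (T i j'), IsAdjointable S ∧
      Dom.incl (T i j') ∘ₗ S = χ.shiftV 𝔇.bundleE i j j' ∘ₗ Dom.incl (T i j) ∧
      IsCompactOp (Dom.op (T i j') ∘ₗ S - χ.shiftV 𝔇.bundleF i j j' ∘ₗ Dom.op (T i j)) :=
  (χ.cutV i j j').exists_transplant_dom_of_commutatorCompact (χ.contMDiff_cosFun i j)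
    (χ.cutV_apply i j j') (𝔇.isOpenEmbedding_uM i j).isOpen_range
    (range_comp_subset_range _ _)
    (χ.isCompact_core.image (𝔇.isOpenEmbedding_uM i j).continuous) (image_subset_range _ _)
    (fun x hx => by
      filter_upwards [χ.eventually_eq i j x hx] with y hy
      rw [cosFun, cosFun, hy])
    (hD i j) (hD i j') hV (fun f hf => χ.transplant_cutV_mem_bcSections bV bW i j j' hf)
    (hT i j) (hT i j') (hreg i j) (hreg i j') (hcomm i j)

theorem exists_shiftW_dom
    (hD : ∀ i j, HermitianBundle.IsDiffOp (D i j))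
    (hT : ∀ i j, (𝔇.M i j).IsClosedRealization (D i j) (𝔇.bcSections bV bW i j) (T i j))
    (hreg : ∀ i j, IsRegularOp (T i j))
    (hcomm : ∀ i j (a : C^∞⟮I, 𝔇.M i j; 𝓘(ℝ, ℂ), ℂ⟯), IsCompact (tsupport a) →
      tsupport a ⊆ range (𝔇.uM i j) →
      (𝔇.M i j).CommutatorCompact (D i j) (𝔇.bcSections bV bW i j) (T i j) a)
    {i i' j : Fin 2}
    (hW : AgreeOn (𝔇.wM i j) (𝔇.wM i' j) (D i j) (D i' j)) :
    ∃ S : Dom (T i j) →ₗ[B] Dom (T i' j), IsAdjointable S ∧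
      Dom.incl (T i' j) ∘ₗ S = χ.shiftW 𝔇.bundleE i i' j ∘ₗ Dom.incl (T i j) ∧
      IsCompactOp (Dom.op (T i' j) ∘ₗ S - χ.shiftW 𝔇.bundleF i i' j ∘ₗ Dom.op (T i j)) :=
  (χ.cutW i i' j).exists_transplant_dom_of_commutatorCompact (χ.contMDiff_sinFun i j)
    (χ.cutW_apply i i' j) (𝔇.isOpenEmbedding_uM i j).isOpen_range
    (by
      rintro - ⟨u, rfl⟩
      exact 𝔇.uM_mem_right i j u)
    (χ.isCompact_core.image (𝔇.isOpenEmbedding_uM i j).continuous) (image_subset_range _ _)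
    (fun x hx => by
      filter_upwards [χ.eventually_eq i j x hx] with y hy
      rw [sinFun, sinFun, hy])
    (hD i j) (hD i' j) hW (fun f hf => χ.transplant_cutW_mem_bcSections bV bW i i' j hf)
    (hT i j) (hT i' j) (hreg i j) (hreg i' j) (hcomm i j)

end GluingDiagram.Transition

end Geometry

end RelIndex

theorem theorem1p1
    {EM : Type*} [NormedAddCommGroup EM] [NormedSpace ℝ EM] [FiniteDimensional ℝ EM]
    {HM : Type*} [TopologicalSpace HM] (I : ModelWithCorners ℝ EM HM)
    {B : Type u} [CStarAlgebra B] [PartialOrder B] [StarOrderedRing B]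
    -- the manifolds `M i j = V i ∪ W j` with their bundles
    (𝔇 : GluingDiagram.{u, v, w} I B)
    -- the differential operators
    (D : ∀ i j, (𝔇.M i j).E.CcSec →ₗ[B] (𝔇.M i j).F.CcSec)
    (hD : ∀ i j, HermitianBundle.IsDiffOp (D i j))
    -- the boundary conditions
    {GV GW : Fin 2 → Type*}
    [∀ i, AddCommGroup (GV i)] [∀ i, Module B (GV i)]
    [∀ j, AddCommGroup (GW j)] [∀ j, Module B (GW j)]
    (bV : ∀ i, BoundaryOp (𝔇.V i) (GV i)) (bW : ∀ j, BoundaryOp (𝔇.W j) (GW j))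
    -- the regular closed realizations
    (T : ∀ i j, L2 (𝔇.M i j).E (𝔇.M i j).μ →ₗ.[B] L2 (𝔇.M i j).F (𝔇.M i j).μ)
    (hT : ∀ i j, (𝔇.M i j).IsClosedRealization (D i j) (𝔇.bcSections bV bW i j) (T i j))
    (hreg : ∀ i j, IsRegularOp (T i j))
    -- the operators agree on the common pieces
    (hV : ∀ i, AgreeOn (𝔇.vM i 0) (𝔇.vM i 1) (D i 0) (D i 1))
    (hW : ∀ j, AgreeOn (𝔇.wM 0 j) (𝔇.wM 1 j) (D 0 j) (D 1 j))
    -- the commutators with `a ∈ C_c^∞(U)` are relatively compact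
    (hcomm : ∀ i j (a : ContMDiffMap I (modelWithCornersSelf ℝ ℂ) (𝔇.M i j) ℂ (⊤ : ℕ∞)),
      IsCompact (tsupport a) →
      tsupport a ⊆ Set.range ((𝔇.vM i j).toFun ∘ (𝔇.uV i).toFun) →
      (𝔇.M i j).CommutatorCompact (D i j) (𝔇.bcSections bV bW i j) (T i j) a) :
    ((IsFredholmOp (T 0 0) ∧ IsFredholmOp (T 1 1)) ↔
      (IsFredholmOp (T 0 1) ∧ IsFredholmOp (T 1 0))) ∧
    (IsFredholmOp (T 0 0) ∧ IsFredholmOp (T 1 1) →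
      indexOp (T 0 0) + indexOp (T 1 1) = indexOp (T 0 1) + indexOp (T 1 0)) := by
  obtain ⟨χ⟩ := 𝔇.nonempty_transition
  have hV' : ∀ i j j', AgreeOn (𝔇.vM i j) (𝔇.vM i j') (D i j) (D i j') := fun i =>
    Fin.forall_fin_two.mpr ⟨Fin.forall_fin_two.mpr ⟨.refl _ (hD i 0), hV i⟩,
      Fin.forall_fin_two.mpr ⟨(hV i).symm, .refl _ (hD i 1)⟩⟩
  have hW' : ∀ i i' j, AgreeOn (𝔇.wM i j) (𝔇.wM i' j) (D i j) (D i' j) :=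
    Fin.forall_fin_two.mpr
      ⟨Fin.forall_fin_two.mpr ⟨fun j => .refl _ (hD 0 j), hW⟩,
        Fin.forall_fin_two.mpr ⟨fun j => (hW j).symm, fun j => .refl _ (hD 1 j)⟩⟩
  choose S hS hS1 hS2 using fun i j j' =>
    χ.exists_shiftV_dom bV bW hD hT hreg hcomm (hV' i j j')
  choose R hR hR1 hR2 using fun i i' j =>
    χ.exists_shiftW_dom bV bW hD hT hreg hcomm (hW' i i' j)
  have : ∀ i j, CompleteSpace (Dom (T i j)) := fun i j => Dom.completeSpace (hreg i j).closed
  have hS1' := fun i j j' x => LinearMap.congr_fun (hS1 i j j') x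
  have hR1' := fun i i' j x => LinearMap.congr_fun (hR1 i i' j) x
  simp only [LinearMap.comp_apply] at hS1' hR1'
  -- The rotation relations on the domains follow from those on `L²`, because the inclusions of the
  -- domains are injective and intertwine the lifted operators with the transplantations.
  refine square_index (fun i j => Dom.isAdjointable_op (hreg i j)) hS hR
    (fun i j j' => CutOff.isAdjointable_transplantL2 _ _ _)
    (fun i i' j => CutOff.isAdjointable_transplantL2 _ _ _)
    (fun i i' j j' => LinearMap.ext fun x => Dom.incl_injective _ ?_)
    (fun i i' j j' => LinearMap.ext fun x => Dom.incl_injective _ ?_)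
    (χ.shiftV_shiftV_add 𝔇.bundleF) (χ.shiftV_shiftW 𝔇.bundleF) hS2 hR2
  · rw [LinearMap.add_apply, map_add, LinearMap.comp_apply, LinearMap.comp_apply, hS1', hS1', hR1',
      hR1']
    exact LinearMap.congr_fun (χ.shiftV_shiftV_add 𝔇.bundleE i i' j j') (Dom.incl _ x)
  · rw [LinearMap.comp_apply, LinearMap.comp_apply, hS1', hR1', hR1', hS1']
    exact LinearMap.congr_fun (χ.shiftV_shiftW 𝔇.bundleE i i' j j') (Dom.incl _ x)
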